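/- Let $T^2=\mathbb R^2/\mathbb Z^2$ with coordinates $(x,y)$ and $S^1=\mathbb R/\mathbb Z$. A \emph{Denjoy vector field} is a $C^1$ vector field $\partial_y+h\,\partial_x$ on $T^2$ that has no periodic orbits and has a minimal set (a nonempty closed flow-invariant set containing no smaller such set) $\mathfrak D\neq T^2$, its \emph{Denjoy continuum}. Call it \emph{sufficiently smooth} if $h$ is $C^{1+\alpha}$ for all $\alpha\in(0,1)$, $\partial_xh=0$ on $\mathfrak D$, and $(x,y)\mapsto\int_0^x(\partial_xh(\xi,y))^2\,d\xi$ is $C^2$ on $\mathbb R^2$. Sufficiently smooth Denjoy vector fields exist. Moreover, let $\partial_y+h\,\partial_x$ be any of them, with Denjoy continuum $\mathfrak D$; let $V_0$ be a neighborhood of a point $(x_0,y_0)\in T^2$ with $\overline{V_0}\cap\mathfrak D=\emptyset$; let $0<\delta<1$, and let $$N=\{(t,x,y)\in[-1,1]\times T^2 : |t|>1-\delta\}\ \cup\ \{(t,x,y+t) : (x,y)\in V_0,\ t\in[-1,1]\}.$$ Put $K_0(t,x,y)=x$. Then for every $\epsilon>0$ there is a $C^2$ map $K\colon[-1,1]\times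 T^2\to S^1$, with Hamiltonian vector field $v=(\partial_xK)\,\partial_t-(\partial_tK)\,\partial_x+\partial_y$, such that 1. at every point of $\{0\}\times\mathfrak D$ the field $v$ equals the Denjoy vector field, i.e. $\partial_xK=0$ and $\partial_tK=-h$; 2. $\partial_xK>0$ at every point of $[-1,1]\times T^2$ outside $\{0\}\times\mathfrak D$; 3. $\|K-K_0\|<\epsilon$ in the $C^0$ sense (distance in $S^1$); 4. $K=K_0$ on $N$. -/

import Mathlib

open Set Topology

noncomputable section

/-- The two-torus `ℝ² / ℤ²`. -/
abbrev Torus : Type := UnitAddCircle × UnitAddCircle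

/-- The covering projection `ℝ² → ℝ² / ℤ²`. -/
def toTorus (p : ℝ × ℝ) : Torus := ((p.1 : UnitAddCircle), (p.2 : UnitAddCircle))

/-- The manifold with boundary `[-1, 1] × T²`, with coordinates `(t, x, y)`. -/
abbrev ThickTorus : Type := Icc (-1 : ℝ) 1 × Torus

/-- The `ℤ²`-periodic function on `ℝ²` that represents a real function on the torus. -/
def torusLift (h : Torus → ℝ) (p : ℝ × ℝ) : ℝ := h (toTorus p)

/-- `c` is the lift to `ℝ²` of an integral curve (defined for all times) of the vector field
`∂_y + h ∂_x` on the torus. -/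
def IsTrajectory (h : Torus → ℝ) (c : ℝ → ℝ × ℝ) : Prop :=
  IsIntegralCurve c (fun _ p => (torusLift h p, 1))

/-- The flow of `∂_y + h ∂_x` on the torus has no periodic orbits. -/
def IsAperiodic (h : Torus → ℝ) : Prop :=
  ∀ c : ℝ → ℝ × ℝ, IsTrajectory h c → ∀ s : ℝ, 0 < s → toTorus (c s) ≠ toTorus (c 0)

/-- `D` is invariant under the flow of `∂_y + h ∂_x`. -/
def IsFlowInvariant (h : Torus → ℝ) (D : Set Torus) : Prop :=
  ∀ c : ℝ → ℝ × ℝ, IsTrajectory h c → toTorus (c 0) ∈ D → ∀ s : ℝ, toTorus (c s) ∈ D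

/-- `D` is a minimal set of `∂_y + h ∂_x`: a nonempty closed invariant set that contains no smaller
nonempty closed invariant set. -/
structure IsMinimalSet (h : Torus → ℝ) (D : Set Torus) : Prop where
  isClosed : IsClosed D
  nonempty : D.Nonempty
  invariant : IsFlowInvariant h D
  minimal : ∀ E : Set Torus, E ⊆ D → IsClosed E → E.Nonempty → IsFlowInvariant h E → E = D

/-- `∂_y + h ∂_x` is a Denjoy vector field with Denjoy continuum `D`: it is a `C^1` vector field
without periodic orbits, and `D` is an exceptional minimal set of it, that is, a minimal set which
is not the whole torus. -/
structure IsDenjoyField (h : Torus → ℝ) (D : Set Torus) : Prop where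
  contDiff : ContDiff ℝ 1 (torusLift h)
  aperiodic : IsAperiodic h
  isMinimalSet : IsMinimalSet h D
  ne_univ : D ≠ univ

/-- `∂_x h` for a function `h` on the torus, as a periodic function on `ℝ²`. -/
def torusDx (h : Torus → ℝ) (p : ℝ × ℝ) : ℝ := deriv (fun ξ => torusLift h (ξ, p.2)) p.1

/-- A sufficiently smooth Denjoy vector field `∂_y + h ∂_x` with Denjoy continuum `D`: it is of
class `C^{1+α}` for all `α ∈ (0, 1)`, `∂_x h` vanishes on `D`, and
`(x, y) ↦ ∫_0^x (∂_x h (ξ, y))² dξ` is of class `C^2`. -/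
structure IsSmoothDenjoyField (h : Torus → ℝ) (D : Set Torus) : Prop where
  isDenjoyField : IsDenjoyField h D
  holder : ∀ α : NNReal, 0 < α → α < 1 →
    ∃ C : NNReal, HolderWith C α (fderiv ℝ (torusLift h))
  dx_eq_zero : ∀ p : ℝ × ℝ, toTorus p ∈ D → torusDx h p = 0
  contDiff_integral :
    ContDiff ℝ 2 (fun p : ℝ × ℝ => ∫ ξ in (0 : ℝ)..p.1, (torusDx h (ξ, p.2)) ^ 2)

/-- The map `K₀ : (t, x, y) ↦ x` from `[-1, 1] × T²` to the circle. -/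
def K₀ (q : ThickTorus) : UnitAddCircle := q.2.1

/-- `k` is a `C^2` real-valued lift, on `[-1, 1] × ℝ²`, of the circle-valued map `K` on
`[-1, 1] × T²`. The map `K` is of class `C^2` if and only if it has such a lift, and the partial
derivatives of `K` are those of any such lift. -/
structure IsC2Lift (K : ThickTorus → UnitAddCircle) (k : ℝ × ℝ × ℝ → ℝ) : Prop where
  contDiffOn : ContDiffOn ℝ 2 k (Icc (-1 : ℝ) 1 ×ˢ univ)
  lift : ∀ (t : Icc (-1 : ℝ) 1) (x y : ℝ),
    K (t, toTorus (x, y)) = ((k ((t : ℝ), x, y) : ℝ) : UnitAddCircle)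

/-- `∂_t k` on `[-1, 1] × ℝ²` (one-sided at the boundary). -/
def partialT (k : ℝ × ℝ × ℝ → ℝ) (t x y : ℝ) : ℝ :=
  derivWithin (fun s => k (s, x, y)) (Icc (-1 : ℝ) 1) t

/-- `∂_x k` on `[-1, 1] × ℝ²`. -/
def partialX (k : ℝ × ℝ × ℝ → ℝ) (t x y : ℝ) : ℝ := deriv (fun s => k (t, s, y)) x

/-- The components `(t, x, y)` of the Hamiltonian vector field
`v = (∂_x K) ∂_t - (∂_t K) ∂_x + ∂_y` of the circle-valued map with lift `k`. -/
def hamiltonianField (k : ℝ × ℝ × ℝ → ℝ) (t x y : ℝ) : ℝ × ℝ × ℝ :=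
  (partialX k t x y, -partialT k t x y, 1)

/-- The union of the collar `{|t| > 1 - δ}` of the boundary of `[-1, 1] × T²` and of the tube
`{(t, x, y + t) | (x, y) ∈ V, t ∈ [-1, 1]}`. -/
def collarTube (δ : ℝ) (V : Set Torus) : Set ThickTorus :=
  {q | 1 - δ < |(q.1 : ℝ)|} ∪
    {q | ∃ p ∈ V, q.2 = (p.1, p.2 + ((q.1 : ℝ) : UnitAddCircle))}

end

/-!
The two halves are independent. Functions on the torus are handled as doubly periodic functions on
the plane.

**Existence of a sufficiently smooth Denjoy field.** An orbit of the rotation flow of slope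
`rot = √2` is blown up: at time `s` a gap of length `gap s` is inserted, where the translates of
`gap` by integers have a constant sum (`hasSum_gap`), and `gap s` decays like
`1 / (s log² s)`, with derivatives that gain one power of `s` each. The point of angle `θ` at
height `y` is then moved to `pos fl θ y`, where `fl` chooses an end of the gap at which the angle
may sit. Over each gap, the field interpolates between the velocities of the two edges by a smooth
step (`denjoyLift`). It is a series over the gaps, of the kind `gapSum m c ζ`, in which the weights
`m` are evaluated along the orbit, and a staircase with steps of shape `ζ` and height `c` is placed
over each gap. Partial derivatives of such series are again such series (`hasDerivAt_gapSum`): an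
`x`-derivative divides the weight by `gap` and turns the height `c` into `0`. If `c = 0`, then the
terms have disjoint supports, so that the series converges uniformly as soon as its weights tend to
zero. This is what makes all of the required regularity a matter of counting powers of `s`:

* The first derivatives of the field have weights of decay almost `1`, and gradients of the terms
  grow at most like a small power; interpolation gives every Hölder exponent below `1`
  (`isHolder_gapSum`).
* By disjointness, the square of the `x`-derivative is the series of the squares. Its weights
  `(gap' / gap)²` decay like `s⁻²`, up to logarithms, and those of its primitive like `s⁻³`. This
  suffices for two derivatives of the primitive (`contDiff_integral_denjoyDx_sq`).

On the complement of the gaps the trajectories are the curves `s ↦ (pos fl (θ + rot s) s, s)`. Other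
trajectories cannot cross them, so that they have an irrational rotation number and none is periodic.
The complement is minimal because the angles of an orbit are dense and `pos` has one-sided limits,
namely the two ends of a gap (`isMinimalSet_denjoySet`).

**The Hamiltonian.** Its lift is `x + a(t) ψ(x, y) ((1 - C t²) g - u)`. Here `ψ` cuts off near the
continuum and `a` near `t = 0`. The function `g(x, y)` is `C²`, small, and has `1 + ∂ₓg = 0` on the
continuum while `1 + ∂ₓg ≥ P` everywhere, where `P` is a small multiple of `(∂ₓh)²` plus a smooth
function whose zero set is the continuum (`exists_flat_perturbation`). The function `u(t, x, y)` is
`C²` with `u = 0` and `∂ₜu = h` at `t = 0`, and `∂ₓu = t ∂ₓh + O(t²)`. It is `t` times the average of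
`h` over a square of side `t²`, and a Hölder exponent `3/4` of the derivatives of `h` is enough for
this to be `C²` (`exists_smoothing`). Where `a = ψ = 1`, the `x`-derivative of the Hamiltonian is at
least `(1 - C t²) P + C t² - t ∂ₓh - O(t²)`; as `P` dominates a multiple of `(∂ₓh)²`, the quadratic
form in `t` and `∂ₓh` is positive for large `C`, off the continuum at time `0` (`exists_model`).
-/

noncomputable section

/-! ### Doubly periodic functions and the torus -/

/-- `f` is invariant under the translations of `ℤ²`. -/
def IsBiperiodic {β : Type*} (f : ℝ × ℝ → β) : Prop :=
  ∀ (p : ℝ × ℝ) (k m : ℤ), f (p.1 + k, p.2 + m) = f p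

lemma toTorus_add_int (p : ℝ × ℝ) (k m : ℤ) :
    toTorus (p.1 + k, p.2 + m) = toTorus p := by
  simp [toTorus]

lemma toTorus_eq_iff {p q : ℝ × ℝ} :
    toTorus p = toTorus q ↔ ∃ k m : ℤ, q = (p.1 + k, p.2 + m) := by
  constructor
  · intro h
    have key (a b : ℝ) (h : (a : UnitAddCircle) = b) : ∃ k : ℤ, b = a + k := by
      have : ((b - a : ℝ) : UnitAddCircle) = 0 := by
        rw [AddCircle.coe_sub, h, sub_self]
      obtain ⟨n, hn⟩ := AddCircle.coe_eq_zero_iff 1 |>.1 this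
      exact ⟨n, by simp at hn; linarith⟩
    obtain ⟨k, hk⟩ := key _ _ (congrArg Prod.fst h)
    obtain ⟨m, hm⟩ := key _ _ (congrArg Prod.snd h)
    exact ⟨k, m, Prod.ext hk hm⟩
  · rintro ⟨k, m, rfl⟩
    exact (toTorus_add_int p k m).symm

lemma toTorus_surjective : Function.Surjective toTorus := by
  rintro ⟨a, b⟩
  obtain ⟨x, rfl⟩ := QuotientAddGroup.mk_surjective a
  obtain ⟨y, rfl⟩ := QuotientAddGroup.mk_surjective b
  exact ⟨(x, y), rfl⟩

lemma continuous_toTorus : Continuous toTorus :=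
  ((AddCircle.continuous_mk' 1).comp continuous_fst).prodMk
    ((AddCircle.continuous_mk' 1).comp continuous_snd)

lemma isOpenMap_toTorus : IsOpenMap toTorus := by
  have : toTorus = Prod.map (QuotientAddGroup.mk : ℝ → UnitAddCircle)
      (QuotientAddGroup.mk : ℝ → UnitAddCircle) := rfl
  rw [this]
  exact QuotientAddGroup.isOpenMap_coe.prodMap QuotientAddGroup.isOpenMap_coe

lemma isOpenQuotientMap_toTorus : IsOpenQuotientMap toTorus :=
  ⟨toTorus_surjective, continuous_toTorus, isOpenMap_toTorus⟩

lemma isBiperiodic_torusLift (h : Torus → ℝ) : IsBiperiodic (torusLift h) := fun p k m => by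
  simp only [torusLift, toTorus_add_int]

lemma IsBiperiodic.exists_descent {β : Type*} {f : ℝ × ℝ → β} (hf : IsBiperiodic f) :
    ∃ F : Torus → β, ∀ p, F (toTorus p) = f p := by
  refine ⟨fun q => f (Function.surjInv toTorus_surjective q), fun p => ?_⟩
  have := Function.surjInv_eq toTorus_surjective (toTorus p)
  obtain ⟨k, m, h⟩ := toTorus_eq_iff.1 this
  conv_rhs => rw [h]
  exact (hf _ k m).symm

lemma IsBiperiodic.exists_bound {E : Type*} [NormedAddCommGroup E] {f : ℝ × ℝ → E}
    (hf : IsBiperiodic f) (hc : Continuous f) : ∃ C : ℝ, 0 < C ∧ ∀ p, ‖f p‖ ≤ C := by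
  obtain ⟨C, hC⟩ := (isCompact_Icc.prod isCompact_Icc :
    IsCompact (Icc (0 : ℝ) 1 ×ˢ Icc (0 : ℝ) 1)).exists_bound_of_continuousOn hc.continuousOn
  refine ⟨max C 1, by positivity, fun p => le_max_of_le_left ?_⟩
  have h := hf p (-⌊p.1⌋) (-⌊p.2⌋)
  rw [← h]
  refine hC _ ⟨⟨?_, ?_⟩, ?_, ?_⟩ <;> push_cast
  · linarith [Int.floor_le p.1]
  · linarith [Int.lt_floor_add_one p.1]
  · linarith [Int.floor_le p.2]
  · linarith [Int.lt_floor_add_one p.2]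

lemma IsBiperiodic.fderiv {f : ℝ × ℝ → ℝ} (hf : IsBiperiodic f) :
    IsBiperiodic (fderiv ℝ f) := fun p k m => by
  have h : (fun q : ℝ × ℝ => f (q + ((k : ℝ), (m : ℝ)))) = f := by
    funext q; exact hf q k m
  have := fderiv_comp_add_right (𝕜 := ℝ) (f := f) (x := p) ((k : ℝ), (m : ℝ))
  rw [h] at this
  exact this.symm

/-- Every closed subset of the torus is the zero set of a smooth function with values in
`[0, 1]`. It is pulled back from the plane `ℂ²` by the standard embedding of the torus. -/
lemma exists_smooth_zeroSet {C : Set Torus} (hC : IsClosed C) (n : ℕ) :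
    ∃ G : ℝ × ℝ → ℝ, ContDiff ℝ n G ∧ IsBiperiodic G ∧ (∀ p, 0 ≤ G p) ∧ (∀ p, G p ≤ 1) ∧
      ∀ p, G p = 0 ↔ toTorus p ∈ C := by
  let e : Torus → ℂ × ℂ := fun q => (AddCircle.toCircle q.1, AddCircle.toCircle q.2)
  have he : Continuous e := by
    refine Continuous.prodMk ?_ ?_
    · exact continuous_subtype_val.comp (AddCircle.continuous_toCircle.comp continuous_fst)
    · exact continuous_subtype_val.comp (AddCircle.continuous_toCircle.comp continuous_snd)
  have hinj : Function.Injective e := by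
    intro q r h
    have h1 := congrArg Prod.fst h
    have h2 := congrArg Prod.snd h
    exact Prod.ext (AddCircle.injective_toCircle one_ne_zero (Subtype.coe_injective h1))
      (AddCircle.injective_toCircle one_ne_zero (Subtype.coe_injective h2))
  have hcl : IsClosed (e '' C) := (hC.isCompact.image he).isClosed
  obtain ⟨f, hf1, hf2, hf3⟩ := hcl.isOpen_compl.exists_contDiff_support_eq (n := (n : ℕ∞))
  have hexp (x : ℝ) : ((AddCircle.toCircle (x : UnitAddCircle) : Circle) : ℂ)
      = Complex.exp ((2 * Real.pi * x : ℝ) * Complex.I) := by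
    rw [AddCircle.toCircle_apply_mk, Circle.coe_exp]; simp
  have hsm : ContDiff ℝ n (fun x : ℝ => Complex.exp ((2 * Real.pi * x : ℝ) * Complex.I)) := by
    have h1 : ContDiff ℝ n (fun x : ℝ => ((2 * Real.pi * x : ℝ) : ℂ)) :=
      Complex.ofRealCLM.contDiff.comp (contDiff_const.mul contDiff_id)
    exact (h1.mul contDiff_const).cexp
  have hval (p : ℝ × ℝ) : e (toTorus p) = (Complex.exp ((2 * Real.pi * p.1 : ℝ) * Complex.I),
      Complex.exp ((2 * Real.pi * p.2 : ℝ) * Complex.I)) := Prod.ext (hexp p.1) (hexp p.2)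
  refine ⟨fun p => f (e (toTorus p)), ?_, fun p k m => by simp only [toTorus_add_int],
    fun p => (hf3 ⟨_, rfl⟩).1, fun p => (hf3 ⟨_, rfl⟩).2, fun p => ?_⟩
  · simp_rw [hval]
    refine ContDiff.comp (by exact_mod_cast hf2) ?_
    exact (hsm.comp contDiff_fst).prodMk (hsm.comp contDiff_snd)
  · have h : e (toTorus p) ∈ f.support ↔ e (toTorus p) ∈ (e '' C)ᶜ := by rw [hf1]
    rw [Function.mem_support, mem_compl_iff, not_iff_not, hinj.mem_set_image] at h
    exact h

/-! ### Differentiability from partial derivatives, and parametric integrals -/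

section Partial

variable {E₁ E₂ F : Type*} [NormedAddCommGroup E₁] [NormedSpace ℝ E₁]
  [NormedAddCommGroup E₂] [NormedSpace ℝ E₂] [NormedAddCommGroup F] [NormedSpace ℝ F]

lemma hasFDerivAt_of_continuous_partials {f : E₁ × E₂ → F} {f₁ : E₁ × E₂ → E₁ →L[ℝ] F}
    {f₂ : E₁ × E₂ → E₂ →L[ℝ] F} (h₁ : ∀ x y, HasFDerivAt (fun z => f (z, y)) (f₁ (x, y)) x)
    (h₂ : ∀ x y, HasFDerivAt (fun z => f (x, z)) (f₂ (x, y)) y)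
    (c₁ : Continuous f₁) (c₂ : Continuous f₂) (p : E₁ × E₂) :
    HasFDerivAt f ((f₁ p).coprod (f₂ p)) p := by
  have := hasStrictFDerivAt_uncurry_coprod (𝕜 := ℝ) (u := p) (f := fun x y => f (x, y))
    (f₁ := fun x y => f₁ (x, y)) (f₂ := fun x y => f₂ (x, y))
    (Filter.Eventually.of_forall fun v => h₁ v.1 v.2)
    (Filter.Eventually.of_forall fun v => h₂ v.1 v.2) c₁.continuousAt c₂.continuousAt
  exact this.hasFDerivAt

lemma contDiff_succ_of_partials {n : ℕ} {f : E₁ × E₂ → F} {f₁ : E₁ × E₂ → E₁ →L[ℝ] F}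
    {f₂ : E₁ × E₂ → E₂ →L[ℝ] F} (h₁ : ∀ x y, HasFDerivAt (fun z => f (z, y)) (f₁ (x, y)) x)
    (h₂ : ∀ x y, HasFDerivAt (fun z => f (x, z)) (f₂ (x, y)) y)
    (c₁ : ContDiff ℝ n f₁) (c₂ : ContDiff ℝ n f₂) : ContDiff ℝ (n + 1) f := by
  refine contDiff_succ_iff_hasFDerivAt.2 ⟨fun p => (f₁ p).coprod (f₂ p), ?_,
    hasFDerivAt_of_continuous_partials h₁ h₂ c₁.continuous c₂.continuous⟩
  have h : (fun p => (f₁ p).coprod (f₂ p)) = fun p =>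
      (f₁ p).comp (ContinuousLinearMap.fst ℝ E₁ E₂) +
      (f₂ p).comp (ContinuousLinearMap.snd ℝ E₁ E₂) := by
    funext p; ext <;> simp
  rw [h]
  exact (c₁.clm_comp contDiff_const).add (c₂.clm_comp contDiff_const)

lemma contDiff_toSpanSingleton {n : ℕ} {g : E₁ → F} (hg : ContDiff ℝ n g) :
    ContDiff ℝ n (fun p => ContinuousLinearMap.toSpanSingleton ℝ (g p)) := by
  have : (fun p => ContinuousLinearMap.toSpanSingleton ℝ (g p)) =
      fun p => ContinuousLinearMap.smulRightL ℝ ℝ F (1 : ℝ →L[ℝ] ℝ) (g p) := by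
    funext p; ext; simp
  rw [this]
  exact (ContinuousLinearMap.contDiff _).comp hg

/-- A function on the plane with `C^n` partial derivatives is `C^(n+1)`. -/
lemma contDiff_succ_of_deriv₂ {n : ℕ} {f f₁ f₂ : ℝ × ℝ → ℝ}
    (h₁ : ∀ x y, HasDerivAt (fun z => f (z, y)) (f₁ (x, y)) x)
    (h₂ : ∀ x y, HasDerivAt (fun z => f (x, z)) (f₂ (x, y)) y)
    (c₁ : ContDiff ℝ n f₁) (c₂ : ContDiff ℝ n f₂) : ContDiff ℝ (n + 1) f :=
  contDiff_succ_of_partials (fun x y => (h₁ x y).hasFDerivAt) (fun x y => (h₂ x y).hasFDerivAt)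
    (contDiff_toSpanSingleton c₁) (contDiff_toSpanSingleton c₂)

/-- A function on `ℝ³` with `C^n` partial derivatives is `C^(n+1)`. -/
lemma contDiff_succ_of_deriv₃ {n : ℕ} {f f₀ f₁ f₂ : ℝ × ℝ × ℝ → ℝ}
    (h₀ : ∀ t x y, HasDerivAt (fun z => f (z, x, y)) (f₀ (t, x, y)) t)
    (h₁ : ∀ t x y, HasDerivAt (fun z => f (t, z, y)) (f₁ (t, x, y)) x)
    (h₂ : ∀ t x y, HasDerivAt (fun z => f (t, x, z)) (f₂ (t, x, y)) y)
    (c₀ : ContDiff ℝ n f₀) (c₁ : ContDiff ℝ n f₁) (c₂ : ContDiff ℝ n f₂) :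
    ContDiff ℝ (n + 1) f := by
  let A (p : ℝ × ℝ × ℝ) : ℝ →L[ℝ] ℝ := ContinuousLinearMap.toSpanSingleton ℝ (f₁ p)
  let B (p : ℝ × ℝ × ℝ) : ℝ →L[ℝ] ℝ := ContinuousLinearMap.toSpanSingleton ℝ (f₂ p)
  have cA : ContDiff ℝ n A := contDiff_toSpanSingleton c₁
  have cB : ContDiff ℝ n B := contDiff_toSpanSingleton c₂
  have hAB : ContDiff ℝ n (fun p => (A p).coprod (B p)) := by
    have h : (fun p => (A p).coprod (B p)) = fun p =>
        (A p).comp (ContinuousLinearMap.fst ℝ ℝ ℝ) +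
        (B p).comp (ContinuousLinearMap.snd ℝ ℝ ℝ) := by
      funext p; ext <;> simp
    rw [h]
    exact (cA.clm_comp contDiff_const).add (cB.clm_comp contDiff_const)
  refine contDiff_succ_of_partials (fun t q => (h₀ t q.1 q.2).hasFDerivAt) (fun t q => ?_)
    (contDiff_toSpanSingleton c₀) hAB
  have cA' : Continuous fun q : ℝ × ℝ => A (t, q) := cA.continuous.comp (by fun_prop)
  have cB' : Continuous fun q : ℝ × ℝ => B (t, q) := cB.continuous.comp (by fun_prop)
  exact hasFDerivAt_of_continuous_partials (f := fun q : ℝ × ℝ => f (t, q))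
    (f₁ := fun q => A (t, q)) (f₂ := fun q => B (t, q))
    (fun x y => (h₁ t x y).hasFDerivAt) (fun x y => (h₂ t x y).hasFDerivAt) cA' cB' q

end Partial

section Parametric

variable {H : Type*} [NormedAddCommGroup H] [NormedSpace ℝ H] [ProperSpace H]

open MeasureTheory in
lemma hasFDerivAt_parametric_integral {f : H × ℝ → ℝ} (hf : ContDiff ℝ 1 f) (a b : ℝ) (p : H) :
    HasFDerivAt (fun q => ∫ z in a..b, f (q, z))
      (∫ z in a..b, (fderiv ℝ f (p, z)).comp (ContinuousLinearMap.inl ℝ H ℝ)) p := by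
  have hc : Continuous (fun q : H × ℝ =>
      (fderiv ℝ f q).comp (ContinuousLinearMap.inl ℝ H ℝ)) :=
    ((hf.continuous_fderiv one_ne_zero)).clm_comp continuous_const
  obtain ⟨C, hC⟩ := ((isCompact_closedBall p 1).prod
    (isCompact_uIcc (a := a) (b := b))).exists_bound_of_continuousOn hc.continuousOn
  refine intervalIntegral.hasFDerivAt_integral_of_dominated_of_fderiv_le (bound := fun _ => C)
    (F := fun q z => f (q, z))
    (F' := fun q z => (fderiv ℝ f (q, z)).comp (ContinuousLinearMap.inl ℝ H ℝ))
    (Metric.closedBall_mem_nhds p one_pos) ?_ ?_ ?_ ?_ ?_ ?_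
  · exact Filter.Eventually.of_forall fun q =>
      (hf.continuous.comp (by fun_prop : Continuous fun z : ℝ => (q, z))).aestronglyMeasurable
  · exact (hf.continuous.comp (by fun_prop : Continuous fun z : ℝ => (p, z))).intervalIntegrable _ _
  · exact (hc.comp (by fun_prop : Continuous fun z : ℝ => (p, z))).aestronglyMeasurable
  · exact Filter.Eventually.of_forall fun z hz q hq => hC (q, z) ⟨hq, uIoc_subset_uIcc hz⟩
  · exact intervalIntegrable_const
  · refine Filter.Eventually.of_forall fun z _ q _ => ?_
    have h1 := ((hf.differentiable one_ne_zero) (q, z)).hasFDerivAt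
    exact h1.comp q (hasFDerivAt_prodMk_left q z)

/-- Integrals of a `C¹` function over a fixed interval are `C¹` in the parameters. -/
lemma contDiff_parametric_integral {f : H × ℝ → ℝ} (hf : ContDiff ℝ 1 f) (a b : ℝ) :
    ContDiff ℝ 1 (fun q => ∫ z in a..b, f (q, z)) := by
  refine contDiff_one_iff_hasFDerivAt.2 ⟨_, ?_, hasFDerivAt_parametric_integral hf a b⟩
  have hc : Continuous (fun q : H × ℝ =>
      (fderiv ℝ f q).comp (ContinuousLinearMap.inl ℝ H ℝ)) :=
    ((hf.continuous_fderiv one_ne_zero)).clm_comp continuous_const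
  exact intervalIntegral.continuous_parametric_intervalIntegral_of_continuous' (by exact hc) a b

end Parametric

/-- The derivative in `y` of a function of `(x, y)`. -/
def pdy (b : ℝ × ℝ → ℝ) (p : ℝ × ℝ) : ℝ := fderiv ℝ b p (0, 1)

/-- The derivative in `x` of a function of `(x, y)`. -/
def pdx (b : ℝ × ℝ → ℝ) (p : ℝ × ℝ) : ℝ := fderiv ℝ b p (1, 0)

lemma hasDerivAt_pdx {b : ℝ × ℝ → ℝ} {p : ℝ × ℝ} (hb : DifferentiableAt ℝ b p) :
    HasDerivAt (fun z => b (z, p.2)) (pdx b p) p.1 := by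
  have h := hb.hasFDerivAt.comp_hasDerivAt p.1
    ((hasDerivAt_id p.1).prodMk (hasDerivAt_const p.1 p.2))
  exact h

lemma hasDerivAt_pdy {b : ℝ × ℝ → ℝ} {p : ℝ × ℝ} (hb : DifferentiableAt ℝ b p) :
    HasDerivAt (fun z => b (p.1, z)) (pdy b p) p.2 := by
  have h := hb.hasFDerivAt.comp_hasDerivAt p.2
    ((hasDerivAt_const p.2 p.1).prodMk (hasDerivAt_id p.2))
  exact h

lemma contDiff_pdx {n : ℕ} {b : ℝ × ℝ → ℝ} (hb : ContDiff ℝ (n + 1) b) :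
    ContDiff ℝ n (pdx b) :=
  (hb.fderiv_right (m := n) le_rfl).clm_apply contDiff_const

lemma contDiff_pdy {n : ℕ} {b : ℝ × ℝ → ℝ} (hb : ContDiff ℝ (n + 1) b) :
    ContDiff ℝ n (pdy b) :=
  (hb.fderiv_right (m := n) le_rfl).clm_apply contDiff_const

/-- The primitive `(x, y) ↦ ∫_0^x b(ξ, y) dξ`. -/
def primX (b : ℝ × ℝ → ℝ) (p : ℝ × ℝ) : ℝ := ∫ ξ in (0 : ℝ)..p.1, b (ξ, p.2)

lemma continuous_primX {b : ℝ × ℝ → ℝ} (hb : Continuous b) : Continuous (primX b) := by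
  have h := intervalIntegral.continuous_parametric_primitive_of_continuous
    (μ := MeasureTheory.volume) (f := fun y ξ : ℝ => b (ξ, y)) (a₀ := 0)
    (by exact hb.comp (by fun_prop : Continuous fun q : ℝ × ℝ => (q.2, q.1)))
  exact h.comp (by fun_prop : Continuous fun p : ℝ × ℝ => (p.2, p.1))

lemma hasDerivAt_primX_fst {b : ℝ × ℝ → ℝ} (hb : Continuous b) (x y : ℝ) :
    HasDerivAt (fun z => primX b (z, y)) (b (x, y)) x := by
  have hc : Continuous fun ξ : ℝ => b (ξ, y) := hb.comp (by fun_prop)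
  exact intervalIntegral.integral_hasDerivAt_right (hc.intervalIntegrable _ _)
    (hc.stronglyMeasurableAtFilter _ _) hc.continuousAt

lemma hasDerivAt_primX_snd {b : ℝ × ℝ → ℝ} (hb : ContDiff ℝ 1 b) (x y : ℝ) :
    HasDerivAt (fun z => primX b (x, z)) (primX (pdy b) (x, y)) y := by
  have hsw : ContDiff ℝ 1 fun q : ℝ × ℝ => b (q.2, q.1) := hb.comp (by fun_prop)
  have h := (hasFDerivAt_parametric_integral hsw 0 x y).hasDerivAt
  convert! h using 1
  have hc : Continuous (fun z : ℝ => (fderiv ℝ (fun q : ℝ × ℝ => b (q.2, q.1)) (y, z)).comp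
      (ContinuousLinearMap.inl ℝ ℝ ℝ)) :=
    ((hsw.continuous_fderiv one_ne_zero).comp (by fun_prop)).clm_comp continuous_const
  rw [ContinuousLinearMap.intervalIntegral_apply (hc.intervalIntegrable _ _)]
  refine intervalIntegral.integral_congr fun ξ _ => ?_
  have h1 := ((hsw.differentiable one_ne_zero) (y, ξ)).hasFDerivAt.comp_hasDerivAt y
    ((hasDerivAt_id y).prodMk (hasDerivAt_const y ξ))
  have h2 := hasDerivAt_pdy (p := (ξ, y)) (hb.differentiable one_ne_zero _)
  exact h2.unique h1

lemma contDiff_primX {n : ℕ} : ∀ {b : ℝ × ℝ → ℝ}, ContDiff ℝ n b → ContDiff ℝ n (primX b) := by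
  induction n with
  | zero =>
    intro b hb
    exact contDiff_zero.2 (continuous_primX hb.continuous)
  | succ n ih =>
    intro b hb
    have hb' : ContDiff ℝ (n + 1) b := by exact_mod_cast hb
    have h1 : ContDiff ℝ 1 b := hb'.of_le (by simp)
    have := contDiff_succ_of_deriv₂ (hasDerivAt_primX_fst hb.continuous)
      (hasDerivAt_primX_snd h1) (hb'.of_le (by simp)) (ih (contDiff_pdy hb'))
    exact_mod_cast this

/-! ### The flow of a field on the torus -/

section Flow

variable {h : Torus → ℝ}

lemma exists_lipschitz_torusLift (hh : ContDiff ℝ 1 (torusLift h)) :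
    ∃ K : NNReal, LipschitzWith K (torusLift h) := by
  obtain ⟨C, hC, hb⟩ := (isBiperiodic_torusLift h).fderiv.exists_bound
    (hh.continuous_fderiv one_ne_zero)
  exact ⟨⟨C, hC.le⟩, lipschitzWith_of_nnnorm_fderiv_le (hh.differentiable one_ne_zero) hb⟩

lemma exists_lipschitz_field (hh : ContDiff ℝ 1 (torusLift h)) :
    ∃ K : NNReal, LipschitzWith K (fun p : ℝ × ℝ => (torusLift h p, (1 : ℝ))) := by
  obtain ⟨K, hK⟩ := exists_lipschitz_torusLift hh
  exact ⟨max K 0, hK.prodMk (LipschitzWith.const 1)⟩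

lemma IsTrajectory.unique (hh : ContDiff ℝ 1 (torusLift h)) {c d : ℝ → ℝ × ℝ}
    (hc : IsTrajectory h c) (hd : IsTrajectory h d) {s : ℝ} (hs : c s = d s) : c = d := by
  obtain ⟨K, hK⟩ := exists_lipschitz_field hh
  exact ODE_solution_unique_univ (v := fun _ p => (torusLift h p, (1 : ℝ))) (K := K)
    (s := fun _ => univ) (fun _ => hK.lipschitzOnWith) (fun t => ⟨hc t, trivial⟩)
    (fun t => ⟨hd t, trivial⟩) hs

lemma IsTrajectory.snd_eq {c : ℝ → ℝ × ℝ} (hc : IsTrajectory h c) (s : ℝ) :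
    (c s).2 = (c 0).2 + s := by
  have h1 (s : ℝ) : HasDerivAt (fun s => (c s).2 - s) 0 s := by
    have h2 : HasDerivAt (fun s => (c s).2) 1 s := (hc s).snd
    have h3 := h2.sub (hasDerivAt_id' s)
    rw [sub_self] at h3
    exact h3
  have := is_const_of_deriv_eq_zero (fun s => (h1 s).differentiableAt) (fun s => (h1 s).deriv) s 0
  linarith

lemma IsTrajectory.continuous {c : ℝ → ℝ × ℝ} (hc : IsTrajectory h c) : Continuous c :=
  IsIntegralCurve.continuous hc

lemma isTrajectory_of_hasDerivAt {ξ : ℝ → ℝ} {y : ℝ}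
    (hξ : ∀ s, HasDerivAt ξ (torusLift h (ξ s, y + s)) s) :
    IsTrajectory h (fun s => (ξ s, y + s)) := fun s => by
  simpa using (hξ s).prodMk ((hasDerivAt_id s).const_add y)

lemma IsTrajectory.shift {c : ℝ → ℝ × ℝ} (hc : IsTrajectory h c) (a : ℝ) :
    IsTrajectory h (fun s => c (s + a)) := fun s => by
  simpa using HasDerivAt.comp_add_const s a (hc (s + a))

lemma IsTrajectory.translate {c : ℝ → ℝ × ℝ} (hc : IsTrajectory h c) (k m : ℤ) :
    IsTrajectory h (fun s => ((c s).1 + k, (c s).2 + m)) := fun s => by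
  have := (hc s).add_const ((k : ℝ), (m : ℝ))
  simp only [isBiperiodic_torusLift h (c s) k m]
  exact this

/-- A `C¹` field on the torus is complete. -/
lemma exists_isTrajectory (hh : ContDiff ℝ 1 (torusLift h)) (p : ℝ × ℝ) :
    ∃ c, IsTrajectory h c ∧ c 0 = p := by
  obtain ⟨K, hK⟩ := exists_lipschitz_field hh
  obtain ⟨C, hC, hb⟩ := (isBiperiodic_torusLift h).exists_bound hh.continuous
  let v : ℝ → ℝ × ℝ → ℝ × ℝ := fun _ p => (torusLift h p, 1)
  let L : NNReal := ⟨max C 1, by positivity⟩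
  -- As the field is bounded, the solution exists on every interval `[-T, T]`.
  have ex (n : ℕ) : ∃ α : ℝ → ℝ × ℝ, α 0 = p ∧
      ∀ t ∈ Ioo (-(n + 1 : ℝ)) (n + 1), HasDerivAt α (v t (α t)) t := by
    have h0 : (0 : ℝ) ∈ Icc (-(n + 1 : ℝ)) (n + 1) := ⟨by linarith [n.cast_nonneg (α := ℝ)],
      by positivity⟩
    have hPL : IsPicardLindelof v (⟨0, h0⟩ : Icc (-(n + 1 : ℝ)) (n + 1)) p (L * (n + 1)) 0 L K :=
      { lipschitzOnWith := fun _ _ => hK.lipschitzOnWith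
        continuousOn := fun _ _ => continuousOn_const
        norm_le := fun _ _ q _ => by
          rw [Prod.norm_def]
          exact max_le (le_max_of_le_left (hb q)) (le_max_of_le_right (by simp [v]))
        mul_max_le := by simp }
    obtain ⟨α, h1, h2⟩ := hPL.exists_eq_forall_mem_Icc_hasDerivWithinAt₀
    exact ⟨α, h1, fun t ht => (h2 t (Ioo_subset_Icc_self ht)).hasDerivAt (Icc_mem_nhds ht.1 ht.2)⟩
  choose α hα0 hα using ex
  have agree (m n : ℕ) (hmn : m ≤ n) : EqOn (α m) (α n) (Ioo (-(m + 1 : ℝ)) (m + 1)) := by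
    have hmn' : (m : ℝ) ≤ n := by exact_mod_cast hmn
    refine ODE_solution_unique_of_mem_Ioo (v := v) (K := K) (s := fun _ => univ) (t₀ := 0)
      (fun _ _ => hK.lipschitzOnWith) ?_ (fun t ht => ⟨hα m t ht, trivial⟩)
      (fun t ht => ⟨hα n t ⟨by linarith [ht.1], by linarith [ht.2]⟩, trivial⟩) (by rw [hα0, hα0])
    exact ⟨by linarith [m.cast_nonneg (α := ℝ)], by positivity⟩
  have mem (s : ℝ) : s ∈ Ioo (-(⌈|s|⌉₊ + 1 : ℝ)) (⌈|s|⌉₊ + 1) := by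
    have := Nat.le_ceil |s|
    exact ⟨by linarith [neg_abs_le s], by linarith [le_abs_self s]⟩
  refine ⟨fun s => α ⌈|s|⌉₊ s, fun s => ?_, by simp [hα0]⟩
  refine (hα ⌈|s|⌉₊ s (mem s)).congr_of_eventuallyEq ?_
  filter_upwards [Ioo_mem_nhds (mem s).1 (mem s).2] with r hr
  rcases le_total ⌈|r|⌉₊ ⌈|s|⌉₊ with h1 | h1
  · exact agree _ _ h1 (mem r)
  · exact (agree _ _ h1 hr).symm

/-- Trajectories on the plane cannot cross. -/
lemma IsTrajectory.lt_of_lt (hh : ContDiff ℝ 1 (torusLift h)) {c d : ℝ → ℝ × ℝ}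
    (hc : IsTrajectory h c) (hd : IsTrajectory h d) (h2 : (c 0).2 = (d 0).2) {s₀ : ℝ}
    (h1 : (c s₀).1 < (d s₀).1) (s : ℝ) : (c s).1 < (d s).1 := by
  by_contra! hcon
  have hcont : Continuous fun s => (d s).1 - (c s).1 :=
    (continuous_fst.comp hd.continuous).sub (continuous_fst.comp hc.continuous)
  obtain ⟨r, hr⟩ := mem_range_of_exists_le_of_exists_ge hcont
    ⟨s, (sub_nonpos.2 hcon)⟩ ⟨s₀, (sub_pos.2 h1).le⟩
  have : c r = d r := Prod.ext (by linarith) (by rw [hc.snd_eq, hd.snd_eq, h2])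
  rw [hc.unique hh hd this] at h1
  exact lt_irrefl _ h1

end Flow

/-! ### Horizontal slices of a Denjoy continuum -/

section Slices

variable {h : Torus → ℝ} {D : Set Torus}

/-- The points of the plane around which the horizontal slice of the lift of `D` contains an
interval. -/
def sliceInterior (D : Set Torus) : Set (ℝ × ℝ) :=
  {p | ∃ r > 0, ∀ ξ, |ξ - p.1| < r → toTorus (ξ, p.2) ∈ D}

lemma mem_of_mem_sliceInterior {p : ℝ × ℝ} (hp : p ∈ sliceInterior D) : toTorus p ∈ D := by
  obtain ⟨r, hr, H⟩ := hp
  exact H p.1 (by simpa)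

/-- The trajectories through two nearby points on either side of a point of `sliceInterior D`
bound an open strip inside `sliceInterior D`. -/
lemma exists_strip (hh : ContDiff ℝ 1 (torusLift h)) (hD : IsFlowInvariant h D) {p : ℝ × ℝ}
    (hp : p ∈ sliceInterior D) : ∃ c d : ℝ → ℝ × ℝ, IsTrajectory h c ∧ IsTrajectory h d ∧
      (c 0).2 = p.2 ∧ (d 0).2 = p.2 ∧ (c 0).1 < p.1 ∧ p.1 < (d 0).1 ∧
      ∀ ξ s, (c s).1 < ξ → ξ < (d s).1 → (ξ, p.2 + s) ∈ sliceInterior D := by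
  obtain ⟨r, hr, H⟩ := hp
  obtain ⟨c, hc, hc0⟩ := exists_isTrajectory hh (p.1 - r / 2, p.2)
  obtain ⟨d, hd, hd0⟩ := exists_isTrajectory hh (p.1 + r / 2, p.2)
  have key : ∀ ξ s, (c s).1 < ξ → ξ < (d s).1 → toTorus (ξ, p.2 + s) ∈ D := by
    intro ξ s h1 h2
    obtain ⟨e, he, he0⟩ := exists_isTrajectory hh (ξ, p.2 + s)
    have hf := he.shift (-s)
    set f : ℝ → ℝ × ℝ := fun r => e (r + -s) with hfdef
    have hfs : f s = (ξ, p.2 + s) := by simp [hfdef, he0]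
    have hf0 : (f 0).2 = p.2 := by
      have := hf.snd_eq s
      rw [hfs] at this
      simp only at this
      linarith
    have hcf := hc.lt_of_lt hh hf (by rw [hf0, hc0]) (s₀ := s) (by rw [hfs]; exact h1) 0
    have hfd := hf.lt_of_lt hh hd (by rw [hf0, hd0]) (s₀ := s) (by rw [hfs]; exact h2) 0
    rw [hc0] at hcf
    rw [hd0] at hfd
    have hmem : toTorus (f 0) ∈ D := by
      have := H (f 0).1 (by rw [abs_lt]; constructor <;> simp only at hcf hfd <;> linarith)
      rwa [← hf0] at this
    have := hD f hf hmem s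
    rwa [hfs] at this
  refine ⟨c, d, hc, hd, by rw [hc0], by rw [hd0], by rw [hc0]; simpa, by rw [hd0]; simpa, ?_⟩
  intro ξ s h1 h2
  refine ⟨min (ξ - (c s).1) ((d s).1 - ξ), lt_min (by linarith) (by linarith), fun η hη => ?_⟩
  rw [lt_min_iff, abs_lt, abs_lt] at hη
  exact key η s (by linarith) (by linarith)

lemma isOpen_sliceInterior (hh : ContDiff ℝ 1 (torusLift h)) (hD : IsFlowInvariant h D) :
    IsOpen (sliceInterior D) := by
  rw [isOpen_iff_mem_nhds]
  intro p hp
  obtain ⟨c, d, hc, hd, hc2, hd2, h1, h2, H⟩ := exists_strip hh hD hp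
  have cc : Continuous fun q : ℝ × ℝ => (c (q.2 - p.2)).1 :=
    continuous_fst.comp (hc.continuous.comp (by fun_prop))
  have cd : Continuous fun q : ℝ × ℝ => (d (q.2 - p.2)).1 :=
    continuous_fst.comp (hd.continuous.comp (by fun_prop))
  have ho : IsOpen {q : ℝ × ℝ | (c (q.2 - p.2)).1 < q.1 ∧ q.1 < (d (q.2 - p.2)).1} :=
    (isOpen_lt cc continuous_fst).inter (isOpen_lt continuous_fst cd)
  refine Filter.mem_of_superset (ho.mem_nhds (by simpa using ⟨h1, h2⟩)) fun q hq => ?_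
  have := H q.1 (q.2 - p.2) hq.1 hq.2
  simpa using this

lemma IsTrajectory.mem_sliceInterior (hh : ContDiff ℝ 1 (torusLift h)) (hD : IsFlowInvariant h D)
    {c : ℝ → ℝ × ℝ} (hc : IsTrajectory h c) {r : ℝ} (h0 : c r ∈ sliceInterior D) (s : ℝ) :
    c s ∈ sliceInterior D := by
  obtain ⟨a, b, ha, hb, ha2, hb2, h1, h2, H⟩ := exists_strip hh hD h0
  have hf := hc.shift r
  have e0 : (c (0 + r)).2 = (c r).2 := by simp
  have i1 := ha.lt_of_lt hh hf (by rw [ha2, e0]) (s₀ := 0) (by simpa using h1) (s - r)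
  have i2 := hf.lt_of_lt hh hb (by rw [hb2, e0]) (s₀ := 0) (by simpa using h2) (s - r)
  have := H _ _ i1 i2
  convert! this using 1
  refine Prod.ext (by simp) ?_
  rw [hc.snd_eq s, hc.snd_eq r]
  simp

/-- The horizontal slices of a Denjoy continuum have empty interior: the points of the continuum
outside the (open, flow-invariant) `sliceInterior` form a closed invariant set, which by minimality
is everything unless the continuum is open. -/
lemma IsDenjoyField.sliceInterior_eq_empty (H : IsDenjoyField h D) : sliceInterior D = ∅ := by
  have hh := H.contDiff
  have hD := H.isMinimalSet.invariant
  have ho := isOpen_sliceInterior hh hD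
  set U := sliceInterior D with hU
  have hper : ∀ p q : ℝ × ℝ, toTorus p = toTorus q → p ∈ U → q ∈ U := by
    rintro p q hpq ⟨r, hr, hp⟩
    obtain ⟨k, m, rfl⟩ := toTorus_eq_iff.1 hpq
    refine ⟨r, hr, fun ξ hξ => ?_⟩
    have := hp (ξ - k) (by simp only at hξ; convert hξ using 2; ring)
    rw [← toTorus_add_int _ k m] at this
    simpa using this
  set E : Set Torus := D \ toTorus '' U with hE
  have hEcl : IsClosed E := H.isMinimalSet.isClosed.sdiff (isOpenMap_toTorus _ ho)
  have hEinv : IsFlowInvariant h E := by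
    rintro c hc ⟨h0, h0'⟩ s
    refine ⟨hD c hc h0 s, ?_⟩
    rintro ⟨p, hp, hpc⟩
    exact h0' ⟨c 0, hc.mem_sliceInterior hh hD (hper _ _ hpc hp) 0, rfl⟩
  by_cases hne : E.Nonempty
  · have hED := H.isMinimalSet.minimal E sdiff_subset hEcl hne hEinv
    by_contra hcon
    obtain ⟨p, hp⟩ := nonempty_iff_ne_empty.2 hcon
    have : toTorus p ∈ E := hED ▸ mem_of_mem_sliceInterior hp
    exact this.2 ⟨p, hp, rfl⟩
  · exfalso
    rw [not_nonempty_iff_eq_empty, hE, sdiff_eq_empty] at hne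
    have hpre : U = toTorus ⁻¹' D := by
      refine Subset.antisymm (fun p hp => mem_of_mem_sliceInterior hp) fun p hp => ?_
      obtain ⟨q, hq, hqp⟩ := hne hp
      exact hper _ _ hqp hq
    have hclopen : IsClopen U :=
      ⟨hpre ▸ H.isMinimalSet.isClosed.preimage continuous_toTorus, ho⟩
    rcases isClopen_iff.1 hclopen with h1 | h1
    · obtain ⟨q, hq⟩ := H.isMinimalSet.nonempty
      obtain ⟨p, rfl⟩ := toTorus_surjective q
      have : p ∈ U := by rw [hpre]; exact hq
      rw [h1] at this
      exact this
    · refine H.ne_univ (eq_univ_of_forall fun q => ?_)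
      obtain ⟨p, rfl⟩ := toTorus_surjective q
      have : p ∈ U := h1 ▸ mem_univ p
      exact mem_of_mem_sliceInterior this

/-- Every horizontal interval contains a point outside a Denjoy continuum. -/
lemma IsDenjoyField.exists_notMem (H : IsDenjoyField h D) {a b : ℝ} (hab : a < b) (y : ℝ) :
    ∃ x ∈ Ioo a b, toTorus (x, y) ∉ D := by
  by_contra! hcon
  have : ((a + b) / 2, y) ∈ sliceInterior D := by
    refine ⟨(b - a) / 2, by linarith, fun ξ hξ => hcon ξ ?_⟩
    rw [abs_lt] at hξ
    simp only at hξ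
    exact ⟨by linarith, by linarith⟩
  rw [H.sliceInterior_eq_empty] at this
  exact this

end Slices

/-! ### Flattening the projection to the circle along the continuum -/

lemma primX_sub {b : ℝ × ℝ → ℝ} (hb : Continuous b) (x₁ x₂ y : ℝ) :
    primX b (x₂, y) - primX b (x₁, y) = ∫ ξ in x₁..x₂, b (ξ, y) := by
  have hc : Continuous fun ξ : ℝ => b (ξ, y) := hb.comp (by fun_prop)
  exact intervalIntegral.integral_interval_sub_left (hc.intervalIntegrable _ _)
    (hc.intervalIntegrable _ _)

lemma primX_mono {b : ℝ × ℝ → ℝ} (hb : Continuous b) (h0 : ∀ p, 0 ≤ b p) {x₁ x₂ : ℝ}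
    (hx : x₁ ≤ x₂) (y : ℝ) : primX b (x₁, y) ≤ primX b (x₂, y) := by
  rw [← sub_nonneg, primX_sub hb]
  exact intervalIntegral.integral_nonneg hx fun _ _ => h0 _

lemma primX_sub_le {b : ℝ × ℝ → ℝ} (hb : Continuous b) (h1 : ∀ p, b p ≤ 1) {x₁ x₂ : ℝ}
    (hx : x₁ ≤ x₂) (y : ℝ) : primX b (x₂, y) - primX b (x₁, y) ≤ x₂ - x₁ := by
  have hc : Continuous fun ξ : ℝ => b (ξ, y) := hb.comp (by fun_prop)
  rw [primX_sub hb]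
  have := intervalIntegral.integral_mono_on hx (hc.intervalIntegrable _ _)
    (intervalIntegrable_const (μ := MeasureTheory.volume) (c := (1 : ℝ))) fun ξ _ => h1 (ξ, y)
  simpa using this

lemma primX_zero (b : ℝ × ℝ → ℝ) (y : ℝ) : primX b (0, y) = 0 := by simp [primX]

lemma IsBiperiodic.primX_add {b : ℝ × ℝ → ℝ} (hb : IsBiperiodic b) (hc : Continuous b) (x y : ℝ)
    (k m : ℤ) : primX b (x + k, y + m) = primX b (x, y) + k * primX b (1, y) := by
  have h1 : primX b (x + k, y + m) = primX b (x + k, y) := by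
    refine intervalIntegral.integral_congr fun ξ _ => ?_
    have := hb (ξ, y) 0 m
    simpa using this
  have hper : Function.Periodic (fun ξ => b (ξ, y)) 1 := fun ξ => by
    have := hb (ξ, y) 1 0
    simpa using this
  have h2 := primX_sub hc x (x + k) y
  have h3 := hper.intervalIntegral_add_zsmul_eq k x
    (fun _ _ => (hc.comp (by fun_prop : Continuous fun ξ : ℝ => (ξ, y))).intervalIntegrable _ _)
  have h4 := hper.intervalIntegral_add_eq x 0
  simp only [zsmul_eq_mul, mul_one] at h3
  rw [h3, h4, zero_add] at h2
  rw [h1]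
  have h5 : primX b (1, y) = ∫ ξ in (0 : ℝ)..1, b (ξ, y) := rfl
  rw [h5]
  linarith

/-- Given a continuous function `P` with values in `[0, 1]` that vanishes on `D` and has a `C²`
primitive in `x`, there is a `C⁰`-small `C²` perturbation `x + g` of the coordinate `x` whose
`x`-derivative vanishes on `D` and is at least `P` everywhere.

The horizontal circle is cut into `n` cells. On each cell the increase of `x` that `∫ P dx` does not
account for is made up by an integral of a bump function supported in the cell and vanishing
exactly on `D`; it is available since `D` has no interior in the horizontal direction. -/
lemma exists_flat_perturbation {D : Set Torus} (hD : IsClosed D)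
    (hden : ∀ a b y : ℝ, a < b → ∃ x ∈ Ioo a b, toTorus (x, y) ∉ D)
    {P : ℝ × ℝ → ℝ} (hPc : Continuous P) (hPper : IsBiperiodic P) (hP0 : ∀ p, 0 ≤ P p)
    (hP1 : ∀ p, P p ≤ 1) (hPD : ∀ p, toTorus p ∈ D → P p = 0)
    (hI : ContDiff ℝ 2 (primX P)) {ε : ℝ} (hε : 0 < ε) :
    ∃ g : ℝ × ℝ → ℝ, ContDiff ℝ 2 g ∧ IsBiperiodic g ∧ (∀ p, |g p| ≤ ε) ∧
      (∀ p, P p ≤ 1 + pdx g p) ∧ ∀ p, toTorus p ∈ D → 1 + pdx g p = 0 := by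
  obtain ⟨n', hn'⟩ := exists_nat_one_div_lt hε
  set n : ℕ := n' + 1 with hn
  have hn0 : (0 : ℝ) < n := by rw [hn]; positivity
  have hnε : 1 / (n : ℝ) ≤ ε := by rw [hn]; push_cast; exact hn'.le
  -- The bump functions of the cells.
  let C (i : ℕ) : Set Torus := (toTorus '' (Ioo ((i : ℝ) / n) ((i + 1) / n) ×ˢ univ))ᶜ
  have hCcl (i : ℕ) : IsClosed (C i) :=
    (isOpenMap_toTorus _ (isOpen_Ioo.prod isOpen_univ)).isClosed_compl
  have hex (i : ℕ) := exists_smooth_zeroSet (hD.union (hCcl i)) 2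
  choose b hb2 hbper hb0 hb1 hbz using hex
  have hbc (i : ℕ) : Continuous (b i) := (hb2 i).continuous
  have hcell {i : ℕ} (hi : i < n) {x : ℝ} (y : ℝ) (hx0 : 0 ≤ x) (hx1 : x ≤ 1)
      (hx : x ≤ (i : ℝ) / n ∨ ((i : ℝ) + 1) / n ≤ x) : b i (x, y) = 0 := by
    rw [hbz]
    right
    rintro ⟨q, ⟨⟨hq1, hq2⟩, -⟩, hqp⟩
    obtain ⟨k, m, hkm⟩ := toTorus_eq_iff.1 hqp
    have hxk : x = q.1 + k := congrArg Prod.fst hkm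
    have i1 : ((i : ℝ) + 1) / n ≤ 1 := by
      rw [div_le_one hn0]; exact_mod_cast hi
    have i0 : (0 : ℝ) ≤ (i : ℝ) / n := by positivity
    have k1 : (k : ℝ) < 1 := by linarith
    have k2 : (-1 : ℝ) < k := by linarith
    have k0 : k = 0 := by
      have a1 : k < 1 := by exact_mod_cast k1
      have a2 : -1 < k := by exact_mod_cast k2
      omega
    rw [k0] at hxk
    simp only [Int.cast_zero, add_zero] at hxk
    rcases hx with h | h <;> linarith
  let N (i : ℕ) (y : ℝ) : ℝ := primX (b i) (1, y)
  have hNpos {i : ℕ} (hi : i < n) (y : ℝ) : 0 < N i y := by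
    obtain ⟨x, ⟨hx1, hx2⟩, hxD⟩ := hden ((i : ℝ) / n) ((i + 1) / n) y (by gcongr; linarith)
    have i1 : ((i : ℝ) + 1) / n ≤ 1 := by
      rw [div_le_one hn0]; exact_mod_cast hi
    have i0 : (0 : ℝ) ≤ (i : ℝ) / n := by positivity
    refine intervalIntegral.integral_pos one_pos
      ((hbc i).comp (by fun_prop : Continuous fun ξ : ℝ => (ξ, y))).continuousOn
      (fun ξ _ => hb0 i _) ⟨x, ⟨by linarith, by linarith⟩, ?_⟩
    refine lt_of_le_of_ne (hb0 i _) fun h => ?_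
    rcases (hbz i _).1 h.symm with h | h
    · exact hxD h
    · exact h ⟨(x, y), ⟨⟨hx1, hx2⟩, trivial⟩, rfl⟩
  let κ (i : ℕ) (y : ℝ) : ℝ := 1 / n - (primX P ((i + 1) / n, y) - primX P (i / n, y))
  have hcellle (i : ℕ) : (i : ℝ) / n ≤ (i + 1) / n := by gcongr; linarith
  have hκ0 (i : ℕ) (y : ℝ) : 0 ≤ κ i y := by
    have := primX_sub_le hPc hP1 (hcellle i) y
    have e : ((i : ℝ) + 1) / n - i / n = 1 / n := by ring
    rw [e] at this
    simp only [κ]; linarith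
  have hκ1 (i : ℕ) (y : ℝ) : κ i y ≤ 1 / n := by
    have := primX_mono hPc hP0 (hcellle i) y
    simp only [κ]; linarith
  have hκsum (m : ℕ) (y : ℝ) : ∑ i ∈ Finset.range m, κ i y = m / n - primX P (m / n, y) := by
    induction m with
    | zero => simp [primX_zero]
    | succ m ih => rw [Finset.sum_range_succ, ih]; simp only [κ]; push_cast; ring
  let S (i : ℕ) (p : ℝ × ℝ) : ℝ := primX (b i) p / N i p.2
  let g (p : ℝ × ℝ) : ℝ := primX P p + ∑ i ∈ Finset.range n, κ i p.2 * S i p - p.1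
  have hκ2 (i : ℕ) : ContDiff ℝ 2 fun p : ℝ × ℝ => κ i p.2 :=
    contDiff_const.sub ((hI.comp (contDiff_const.prodMk contDiff_snd)).sub
      (hI.comp (contDiff_const.prodMk contDiff_snd)))
  have hN2 (i : ℕ) : ContDiff ℝ 2 fun p : ℝ × ℝ => N i p.2 :=
    (contDiff_primX (n := 2) (hb2 i)).comp (contDiff_const.prodMk contDiff_snd)
  have hg2 : ContDiff ℝ 2 g := by
    refine (hI.add (ContDiff.sum fun i hi => ?_)).sub contDiff_fst
    exact (hκ2 i).mul ((contDiff_primX (n := 2) (hb2 i)).div (hN2 i)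
      fun p => (hNpos (Finset.mem_range.1 hi) p.2).ne')
  have hgper : IsBiperiodic g := by
    rintro ⟨x, y⟩ k m
    have hκp (i : ℕ) : κ i (y + m) = κ i y := by
      have h (x : ℝ) : primX P (x, y + m) = primX P (x, y) := by
        simpa using hPper.primX_add hPc x y 0 m
      simp only [κ, h]
    have hS (i : ℕ) (hi : i ∈ Finset.range n) :
        κ i (y + m) * S i (x + k, y + m) = κ i y * S i (x, y) + k * κ i y := by
      have h1 := (hbper i).primX_add (hbc i) x y k m
      have h2 : N i (y + m) = N i y := by
        simpa using (hbper i).primX_add (hbc i) 1 y 0 m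
      have h3 := (hNpos (Finset.mem_range.1 hi) y).ne'
      simp only [S, hκp, h1, h2]
      change κ i y * ((primX (b i) (x, y) + k * N i y) / N i y) = _
      field_simp
    simp only [g]
    rw [Finset.sum_congr rfl hS, hPper.primX_add hPc, Finset.sum_add_distrib, ← Finset.mul_sum,
      hκsum, div_self hn0.ne']
    ring
  have hgdx (p : ℝ × ℝ) : 1 + pdx g p =
      P p + ∑ i ∈ Finset.range n, κ i p.2 * (b i p / N i p.2) := by
    have h1 := hasDerivAt_pdx (p := p) (hg2.differentiable two_ne_zero p)
    have h2 : HasDerivAt (fun z => g (z, p.2))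
        (P p + ∑ i ∈ Finset.range n, κ i p.2 * (b i p / N i p.2) - 1) p.1 := by
      refine ((hasDerivAt_primX_fst hPc p.1 p.2).add (HasDerivAt.fun_sum fun i _ => ?_)).sub
        (hasDerivAt_id' _)
      exact ((hasDerivAt_primX_fst (hbc i) p.1 p.2).div_const (N i p.2)).const_mul (κ i p.2)
    rw [h1.unique h2]; ring
  refine ⟨g, hg2, hgper, ?_, fun p => ?_, fun p hp => ?_⟩
  · have key (x y : ℝ) (hx0 : 0 ≤ x) (hx1 : x < 1) : |g (x, y)| ≤ 1 / n := by
      set m : ℕ := ⌊n * x⌋₊ with hm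
      have hm1 : (m : ℝ) / n ≤ x := by
        rw [div_le_iff₀ hn0, mul_comm]; exact Nat.floor_le (by positivity)
      have hm2 : x < ((m : ℝ) + 1) / n := by
        rw [lt_div_iff₀ hn0, mul_comm]; exact Nat.lt_floor_add_one _
      have hmn : m < n := by
        rw [hm, Nat.floor_lt (by positivity)]; nlinarith
      have hSm : S m (x, y) ∈ Icc (0 : ℝ) 1 := by
        have h0 := primX_mono (hbc m) (hb0 m) hx0 y
        have h1 := primX_mono (hbc m) (hb0 m) hx1.le y
        rw [primX_zero] at h0
        exact ⟨div_nonneg h0 (hNpos hmn y).le, (div_le_one (hNpos hmn y)).2 h1⟩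
      have hSlt (i : ℕ) (hi : i < m) : S i (x, y) = 1 := by
        refine (div_eq_one_iff_eq (hNpos (hi.trans hmn) y).ne').2 ?_
        have h := primX_sub (hbc i) x 1 y
        have h0 : ∫ ξ in x..1, b i (ξ, y) = 0 := by
          rw [← intervalIntegral.integral_zero (a := x) (b := 1) (E := ℝ)]
          refine intervalIntegral.integral_congr fun ξ hξ => ?_
          rw [uIcc_of_le hx1.le] at hξ
          refine hcell (hi.trans hmn) y (hx0.trans hξ.1) hξ.2 (Or.inr (le_trans ?_ hξ.1))
          refine le_trans ?_ hm1
          gcongr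
          exact_mod_cast hi
        change primX (b i) (x, y) = primX (b i) (1, y)
        linarith
      have hSgt (i : ℕ) (hi : m < i) (hin : i < n) : S i (x, y) = 0 := by
        have h0 : primX (b i) (x, y) = 0 := by
          rw [← intervalIntegral.integral_zero (a := 0) (b := x) (E := ℝ)]
          refine intervalIntegral.integral_congr fun ξ hξ => ?_
          rw [uIcc_of_le hx0] at hξ
          refine hcell hin y hξ.1 (hξ.2.trans hx1.le) (Or.inl (hξ.2.trans (hm2.le.trans ?_)))
          gcongr
          exact_mod_cast hi
        simp only [S, h0, zero_div]
      have hsum : ∑ i ∈ Finset.range n, κ i y * S i (x, y) =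
          (m / n - primX P (m / n, y)) + κ m y * S m (x, y) := by
        rw [← hκsum, ← Finset.sum_subset (Finset.range_subset_range.2 (Nat.succ_le_of_lt hmn)),
          Finset.sum_range_succ]
        · congr 1
          refine Finset.sum_congr rfl fun i hi => ?_
          rw [hSlt i (Finset.mem_range.1 hi), mul_one]
        · intro i hi1 hi2
          simp only [Finset.mem_range] at hi1 hi2
          rw [hSgt i (by omega) hi1, mul_zero]
      have hgx : g (x, y) = primX P (x, y) - primX P (m / n, y) + κ m y * S m (x, y)
          - (x - m / n) := by
        simp only [g]; rw [hsum]; ring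
      have j1 := primX_mono hPc hP0 hm1 y
      have j2 := primX_sub_le hPc hP1 hm1 y
      have j3 := mul_nonneg (hκ0 m y) hSm.1
      have j4 : κ m y * S m (x, y) ≤ 1 / n :=
        (mul_le_of_le_one_right (hκ0 m y) hSm.2).trans (hκ1 m y)
      have j5 : x - m / n ≤ 1 / n := by
        have : ((m : ℝ) + 1) / n = m / n + 1 / n := by ring
        linarith
      rw [hgx, abs_le]
      constructor <;> linarith
    intro p
    have h := hgper p (-⌊p.1⌋) 0
    rw [← h]
    refine (key _ _ ?_ ?_).trans hnε <;> push_cast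
    · linarith [Int.floor_le p.1]
    · linarith [Int.lt_floor_add_one p.1]
  · rw [hgdx]
    refine le_add_of_nonneg_right (Finset.sum_nonneg fun i hi => ?_)
    exact mul_nonneg (hκ0 _ _) (div_nonneg (hb0 _ _) (hNpos (Finset.mem_range.1 hi) _).le)
  · rw [hgdx, hPD p hp, zero_add]
    refine Finset.sum_eq_zero fun i _ => ?_
    rw [(hbz i p).2 (Or.inl hp)]
    simp

/-! ### Smoothing by averages over small squares -/

section Smoothing

/-- The average of `k` over the square `[x, x + t²] × [y, y + t²]`. -/
def boxAvg (k : ℝ × ℝ → ℝ) (q : ℝ × ℝ × ℝ) : ℝ :=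
  ∫ z in (0 : ℝ)..1, ∫ w in (0 : ℝ)..1, k (q.2.1 + q.1 ^ 2 * z, q.2.2 + q.1 ^ 2 * w)

/-- The average of `k` over the vertical segment `{x + a t²} × [y, y + t²]`. -/
def vertAvg (k : ℝ × ℝ → ℝ) (a : ℝ) (q : ℝ × ℝ × ℝ) : ℝ :=
  ∫ w in (0 : ℝ)..1, k (q.2.1 + a * q.1 ^ 2, q.2.2 + q.1 ^ 2 * w)

/-- The average of `k` over the horizontal segment `[x, x + t²] × {y + a t²}`. -/
def horizAvg (k : ℝ × ℝ → ℝ) (a : ℝ) (q : ℝ × ℝ × ℝ) : ℝ :=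
  ∫ z in (0 : ℝ)..1, k (q.2.1 + q.1 ^ 2 * z, q.2.2 + a * q.1 ^ 2)

variable {k : ℝ × ℝ → ℝ}

lemma continuous_integral_param {H : Type*} [TopologicalSpace H] [FirstCountableTopology H]
    {f : H × ℝ → ℝ} (hf : Continuous f) : Continuous fun q => ∫ z in (0 : ℝ)..1, f (q, z) :=
  intervalIntegral.continuous_parametric_intervalIntegral_of_continuous' (by exact hf) 0 1

lemma continuous_boxAvg (hk : Continuous k) : Continuous (boxAvg k) := by
  refine continuous_integral_param
    (f := fun p : (ℝ × ℝ × ℝ) × ℝ => ∫ w in (0 : ℝ)..1, k (p.1.2.1 + p.1.1 ^ 2 * p.2,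
      p.1.2.2 + p.1.1 ^ 2 * w)) ?_
  exact continuous_integral_param (f := fun p : ((ℝ × ℝ × ℝ) × ℝ) × ℝ =>
    k (p.1.1.2.1 + p.1.1.1 ^ 2 * p.1.2, p.1.1.2.2 + p.1.1.1 ^ 2 * p.2)) (by fun_prop)

lemma continuous_vertAvg (hk : Continuous k) (a : ℝ) : Continuous (vertAvg k a) :=
  continuous_integral_param (f := fun p : (ℝ × ℝ × ℝ) × ℝ =>
    k (p.1.2.1 + a * p.1.1 ^ 2, p.1.2.2 + p.1.1 ^ 2 * p.2)) (by fun_prop)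

lemma continuous_horizAvg (hk : Continuous k) (a : ℝ) : Continuous (horizAvg k a) :=
  continuous_integral_param (f := fun p : (ℝ × ℝ × ℝ) × ℝ =>
    k (p.1.2.1 + p.1.1 ^ 2 * p.2, p.1.2.2 + a * p.1.1 ^ 2)) (by fun_prop)

lemma contDiff_vertAvg (hk : ContDiff ℝ 1 k) (a : ℝ) : ContDiff ℝ 1 (vertAvg k a) :=
  contDiff_parametric_integral (f := fun p : (ℝ × ℝ × ℝ) × ℝ =>
    k (p.1.2.1 + a * p.1.1 ^ 2, p.1.2.2 + p.1.1 ^ 2 * p.2)) (by fun_prop) 0 1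

lemma contDiff_horizAvg (hk : ContDiff ℝ 1 k) (a : ℝ) : ContDiff ℝ 1 (horizAvg k a) :=
  contDiff_parametric_integral (f := fun p : (ℝ × ℝ × ℝ) × ℝ =>
    k (p.1.2.1 + p.1.1 ^ 2 * p.2, p.1.2.2 + a * p.1.1 ^ 2)) (by fun_prop) 0 1

lemma contDiff_boxAvg (hk : ContDiff ℝ 1 k) : ContDiff ℝ 1 (boxAvg k) := by
  refine contDiff_parametric_integral
    (f := fun p : (ℝ × ℝ × ℝ) × ℝ => ∫ w in (0 : ℝ)..1, k (p.1.2.1 + p.1.1 ^ 2 * p.2,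
      p.1.2.2 + p.1.1 ^ 2 * w)) ?_ 0 1
  exact contDiff_parametric_integral (f := fun p : ((ℝ × ℝ × ℝ) × ℝ) × ℝ =>
    k (p.1.1.2.1 + p.1.1.1 ^ 2 * p.1.2, p.1.1.2.2 + p.1.1.1 ^ 2 * p.2)) (by fun_prop) 0 1

lemma boxAvg_zero (p : ℝ × ℝ) : boxAvg k (0, p) = k p := by simp [boxAvg]

lemma vertAvg_zero (a : ℝ) (p : ℝ × ℝ) : vertAvg k a (0, p) = k p := by simp [vertAvg]

lemma horizAvg_zero (a : ℝ) (p : ℝ × ℝ) : horizAvg k a (0, p) = k p := by simp [horizAvg]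

lemma integral_integral_comm (hk : Continuous k) (a b c d : ℝ) :
    ∫ z in a..b, ∫ w in c..d, k (z, w) = ∫ w in c..d, ∫ z in a..b, k (z, w) := by
  refine MeasureTheory.intervalIntegral_intervalIntegral_swap ?_
  exact (hk.continuousOn.integrableOn_compact (isCompact_uIcc.prod isCompact_uIcc)).mono_set
    (prod_mono uIoc_subset_uIcc uIoc_subset_uIcc)

/-- The double primitive `(x, y) ↦ ∫_0^x ∫_0^y k`. -/
def dblPrim (k : ℝ × ℝ → ℝ) (p : ℝ × ℝ) : ℝ :=
  ∫ ξ in (0 : ℝ)..p.1, ∫ η in (0 : ℝ)..p.2, k (ξ, η)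

/-- The primitive `(x, y) ↦ ∫_0^y k(x, η) dη`. -/
def primY (k : ℝ × ℝ → ℝ) (p : ℝ × ℝ) : ℝ := ∫ η in (0 : ℝ)..p.2, k (p.1, η)

lemma continuous_primY (hk : Continuous k) : Continuous (primY k) := by
  have h := intervalIntegral.continuous_parametric_primitive_of_continuous
    (μ := MeasureTheory.volume) (f := fun x η : ℝ => k (x, η)) (a₀ := 0)
    (by exact hk)
  exact h

lemma hasFDerivAt_dblPrim (hk : Continuous k) (p : ℝ × ℝ) :
    HasFDerivAt (dblPrim k) ((ContinuousLinearMap.toSpanSingleton ℝ (primY k p)).coprod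
      (ContinuousLinearMap.toSpanSingleton ℝ (primX k p))) p := by
  refine hasFDerivAt_of_continuous_partials
    (f₁ := fun p => ContinuousLinearMap.toSpanSingleton ℝ (primY k p))
    (f₂ := fun p => ContinuousLinearMap.toSpanSingleton ℝ (primX k p)) (fun x y => ?_)
    (fun x y => ?_) ?_ ?_ p
  · exact (hasDerivAt_primX_fst (continuous_primY hk) x y).hasFDerivAt
  · have h : (fun z => dblPrim k (x, z)) = fun z => ∫ η in (0 : ℝ)..z, primX k (x, η) := by
      funext z; exact integral_integral_comm hk _ _ _ _
    rw [h]
    have hc : Continuous fun η => primX k (x, η) := (continuous_primX hk).comp (by fun_prop)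
    exact (intervalIntegral.integral_hasDerivAt_right (hc.intervalIntegrable _ _)
      (hc.stronglyMeasurableAtFilter _ _) hc.continuousAt).hasFDerivAt
  · exact (contDiff_toSpanSingleton (n := 0)
      (contDiff_zero.2 (continuous_primY hk))).continuous
  · exact (contDiff_toSpanSingleton (n := 0)
      (contDiff_zero.2 (continuous_primX hk))).continuous

lemma primX_diff (hk : Continuous k) (a : ℝ) (q : ℝ × ℝ × ℝ) :
    primX k (q.2.1 + q.1 ^ 2, q.2.2 + a * q.1 ^ 2) - primX k (q.2.1, q.2.2 + a * q.1 ^ 2) =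
      q.1 ^ 2 * horizAvg k a q := by
  rw [primX_sub hk, horizAvg]
  have := intervalIntegral.smul_integral_comp_add_mul (a := 0) (b := 1)
    (fun ξ => k (ξ, q.2.2 + a * q.1 ^ 2)) (q.1 ^ 2) q.2.1
  simpa using this.symm

lemma primY_diff (hk : Continuous k) (a : ℝ) (q : ℝ × ℝ × ℝ) :
    primY k (q.2.1 + a * q.1 ^ 2, q.2.2 + q.1 ^ 2) - primY k (q.2.1 + a * q.1 ^ 2, q.2.2) =
      q.1 ^ 2 * vertAvg k a q := by
  have hc : Continuous fun η : ℝ => k (q.2.1 + a * q.1 ^ 2, η) := hk.comp (by fun_prop)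
  have h : primY k (q.2.1 + a * q.1 ^ 2, q.2.2 + q.1 ^ 2) - primY k (q.2.1 + a * q.1 ^ 2, q.2.2) =
      ∫ η in q.2.2..q.2.2 + q.1 ^ 2, k (q.2.1 + a * q.1 ^ 2, η) :=
    intervalIntegral.integral_interval_sub_left (hc.intervalIntegrable _ _)
      (hc.intervalIntegrable _ _)
  rw [h, vertAvg]
  have := intervalIntegral.smul_integral_comp_add_mul (a := 0) (b := 1)
    (fun η => k (q.2.1 + a * q.1 ^ 2, η)) (q.1 ^ 2) q.2.2
  simpa using this.symm

lemma dblPrim_diff (hk : Continuous k) (q : ℝ × ℝ × ℝ) :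
    dblPrim k (q.2.1 + q.1 ^ 2, q.2.2 + q.1 ^ 2) - dblPrim k (q.2.1, q.2.2 + q.1 ^ 2)
      - (dblPrim k (q.2.1 + q.1 ^ 2, q.2.2) - dblPrim k (q.2.1, q.2.2)) =
      q.1 ^ 4 * boxAvg k q := by
  have hY := continuous_primY hk
  have e (y : ℝ) : dblPrim k (q.2.1 + q.1 ^ 2, y) - dblPrim k (q.2.1, y) =
      ∫ ξ in q.2.1..q.2.1 + q.1 ^ 2, primY k (ξ, y) := primX_sub hY _ _ y
  have hYc (y : ℝ) : Continuous fun ξ => primY k (ξ, y) := hY.comp (by fun_prop)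
  rw [e, e, ← intervalIntegral.integral_sub ((hYc _).intervalIntegrable _ _)
    ((hYc _).intervalIntegrable _ _)]
  have h1 := intervalIntegral.smul_integral_comp_add_mul (a := 0) (b := 1)
    (fun ξ => primY k (ξ, q.2.2 + q.1 ^ 2) - primY k (ξ, q.2.2)) (q.1 ^ 2) q.2.1
  simp only [mul_zero, add_zero, mul_one, smul_eq_mul] at h1
  rw [← h1, boxAvg]
  have h2 (z : ℝ) : primY k (q.2.1 + q.1 ^ 2 * z, q.2.2 + q.1 ^ 2) -
      primY k (q.2.1 + q.1 ^ 2 * z, q.2.2) =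
      q.1 ^ 2 * ∫ w in (0 : ℝ)..1, k (q.2.1 + q.1 ^ 2 * z, q.2.2 + q.1 ^ 2 * w) := by
    have := primY_diff hk z q
    simp only [vertAvg, mul_comm z] at this
    exact this
  simp_rw [h2]
  rw [intervalIntegral.integral_const_mul]
  ring

lemma hasDerivAt_dblPrim_time (hk : Continuous k) (a b t x y : ℝ) :
    HasDerivAt (fun t => dblPrim k (x + a * t ^ 2, y + b * t ^ 2))
      (2 * a * t * primY k (x + a * t ^ 2, y + b * t ^ 2) +
        2 * b * t * primX k (x + a * t ^ 2, y + b * t ^ 2)) t := by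
  have hd (a x : ℝ) : HasDerivAt (fun t : ℝ => x + a * t ^ 2) (2 * a * t) t := by
    have := ((hasDerivAt_pow 2 t).const_mul a).const_add x
    convert! this using 1
    push_cast; ring
  have h := (hasFDerivAt_dblPrim hk (x + a * t ^ 2, y + b * t ^ 2)).comp_hasDerivAt t
    ((hd a x).prodMk (hd b y))
  convert! h using 1

lemma hasDerivAt_dblPrim_fst (hk : Continuous k) (c x y : ℝ) :
    HasDerivAt (fun x => dblPrim k (x + c, y)) (primY k (x + c, y)) x := by
  have h := (hasFDerivAt_dblPrim hk (x + c, y)).comp_hasDerivAt x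
    (((hasDerivAt_id x).add_const c).prodMk (hasDerivAt_const x y))
  convert! h using 1
  simp

lemma hasDerivAt_dblPrim_snd (hk : Continuous k) (c x y : ℝ) :
    HasDerivAt (fun y => dblPrim k (x, y + c)) (primX k (x, y + c)) y := by
  have h := (hasFDerivAt_dblPrim hk (x, y + c)).comp_hasDerivAt y
    ((hasDerivAt_const y x).prodMk ((hasDerivAt_id y).add_const c))
  convert! h using 1
  simp

/-- The time derivative of `t ↦ t * boxAvg k (t, x, y)`. -/
def boxAvgDt (k : ℝ × ℝ → ℝ) (q : ℝ × ℝ × ℝ) : ℝ :=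
  -3 * boxAvg k q + 2 * vertAvg k 1 q + 2 * horizAvg k 1 q

lemma boxAvg_eq (hk : Continuous k) (q : ℝ × ℝ × ℝ) (ht : q.1 ≠ 0) :
    q.1 * boxAvg k q = (q.1 ^ 3)⁻¹ *
      (dblPrim k (q.2.1 + q.1 ^ 2, q.2.2 + q.1 ^ 2) - dblPrim k (q.2.1, q.2.2 + q.1 ^ 2)
      - (dblPrim k (q.2.1 + q.1 ^ 2, q.2.2) - dblPrim k (q.2.1, q.2.2))) := by
  rw [dblPrim_diff hk]
  field_simp

lemma hasDerivAt_boxAvg_time (hk : Continuous k) (t x y : ℝ) :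
    HasDerivAt (fun t => t * boxAvg k (t, x, y)) (boxAvgDt k (t, x, y)) t := by
  rcases eq_or_ne t 0 with rfl | ht
  · have h0 : boxAvgDt k (0, x, y) = boxAvg k (0, x, y) := by
      simp only [boxAvgDt, boxAvg_zero, vertAvg_zero, horizAvg_zero]; ring
    rw [h0, hasDerivAt_iff_tendsto_slope]
    have hc : Continuous fun t => boxAvg k (t, x, y) :=
      (continuous_boxAvg hk).comp (by fun_prop)
    refine ((hc.tendsto 0).mono_left nhdsWithin_le_nhds).congr' ?_
    filter_upwards [self_mem_nhdsWithin] with t ht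
    have ht' : t ≠ 0 := ht
    simp [slope_def_field, ht']
  · have h11 := hasDerivAt_dblPrim_time hk 1 1 t x y
    have h01 := hasDerivAt_dblPrim_time hk 0 1 t x y
    have h10 := hasDerivAt_dblPrim_time hk 1 0 t x y
    simp only [one_mul, zero_mul, add_zero, mul_one, mul_zero, zero_add] at h11 h01 h10
    have hsum := (h11.sub h01).sub (h10.sub (hasDerivAt_const t (dblPrim k (x, y))))
    have hinv : HasDerivAt (fun t : ℝ => (t ^ 3)⁻¹) (-3 * (t ^ 4)⁻¹) t := by
      have := (hasDerivAt_pow 3 t).fun_inv (pow_ne_zero 3 ht)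
      convert! this using 1
      field_simp; norm_num
    have hv := hinv.mul hsum
    refine (hv.congr_of_eventuallyEq ?_).congr_deriv ?_
    · filter_upwards [isOpen_ne.mem_nhds ht] with s hs
      exact boxAvg_eq hk (s, x, y) hs
    · have e1 := dblPrim_diff hk (t, x, y)
      have e2 := primX_diff hk 1 (t, x, y)
      have e3 := primY_diff hk 1 (t, x, y)
      simp only [one_mul] at e1 e2 e3
      simp only [boxAvgDt, Pi.sub_apply]
      rw [e1]
      have e4 : 2 * t * primY k (x + t ^ 2, y + t ^ 2) + 2 * t * primX k (x + t ^ 2, y + t ^ 2) -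
          2 * t * primX k (x, y + t ^ 2) - (2 * t * primY k (x + t ^ 2, y) - 0) =
          2 * t * (t ^ 2 * horizAvg k 1 (t, x, y)) + 2 * t * (t ^ 2 * vertAvg k 1 (t, x, y)) := by
        rw [← e2, ← e3]; ring
      rw [e4]
      field_simp
      ring

lemma hasDerivAt_boxAvg_fst (hk : Continuous k) (t x y : ℝ) :
    HasDerivAt (fun x => t * boxAvg k (t, x, y))
      (t⁻¹ * (vertAvg k 1 (t, x, y) - vertAvg k 0 (t, x, y))) x := by
  rcases eq_or_ne t 0 with rfl | ht
  · simpa using hasDerivAt_const x (0 : ℝ)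
  · have h := (((hasDerivAt_dblPrim_fst hk (t ^ 2) x (y + t ^ 2)).sub
      (hasDerivAt_dblPrim_fst hk 0 x (y + t ^ 2))).sub
      ((hasDerivAt_dblPrim_fst hk (t ^ 2) x y).sub
      (hasDerivAt_dblPrim_fst hk 0 x y))).const_mul (t ^ 3)⁻¹
    simp only [add_zero] at h
    refine (h.congr_of_eventuallyEq (Filter.Eventually.of_forall fun s =>
      boxAvg_eq hk (t, s, y) ht)).congr_deriv ?_
    have e1 := primY_diff hk 1 (t, x, y)
    have e0 := primY_diff hk 0 (t, x, y)
    simp only [one_mul, zero_mul, add_zero] at e1 e0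
    rw [show ∀ a b c d : ℝ, a - b - (c - d) = (a - c) - (b - d) by intros; ring, e1, e0]
    field_simp

lemma hasDerivAt_boxAvg_snd (hk : Continuous k) (t x y : ℝ) :
    HasDerivAt (fun y => t * boxAvg k (t, x, y))
      (t⁻¹ * (horizAvg k 1 (t, x, y) - horizAvg k 0 (t, x, y))) y := by
  rcases eq_or_ne t 0 with rfl | ht
  · simpa using hasDerivAt_const y (0 : ℝ)
  · have h := (((hasDerivAt_dblPrim_snd hk (t ^ 2) (x + t ^ 2) y).sub
      (hasDerivAt_dblPrim_snd hk (t ^ 2) x y)).sub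
      ((hasDerivAt_dblPrim_snd hk 0 (x + t ^ 2) y).sub
      (hasDerivAt_dblPrim_snd hk 0 x y))).const_mul (t ^ 3)⁻¹
    simp only [add_zero] at h
    refine (h.congr_of_eventuallyEq (Filter.Eventually.of_forall fun s =>
      boxAvg_eq hk (t, x, s) ht)).congr_deriv ?_
    have e1 := primX_diff hk 1 (t, x, y)
    have e0 := primX_diff hk 0 (t, x, y)
    simp only [one_mul, zero_mul, add_zero] at e1 e0
    rw [e1, e0]
    field_simp

variable {C : ℝ}

lemma holder_le (hC : ∀ p q, |k p - k q| ≤ C * dist p q ^ (3 / 4 : ℝ)) (hC0 : 0 ≤ C) {p q : ℝ × ℝ}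
    {t : ℝ} (h1 : |p.1 - q.1| ≤ t ^ 2) (h2 : |p.2 - q.2| ≤ t ^ 2) :
    |k p - k q| ≤ C * (|t| * √|t|) := by
  refine (hC p q).trans (mul_le_mul_of_nonneg_left ?_ hC0)
  have hd : dist p q ≤ t ^ 2 := max_le h1 h2
  calc dist p q ^ (3 / 4 : ℝ) ≤ (t ^ 2) ^ (3 / 4 : ℝ) := by gcongr
    _ = |t| ^ (1 + 1 / 2 : ℝ) := by
      rw [← sq_abs, ← Real.rpow_natCast, ← Real.rpow_mul (abs_nonneg t)]; norm_num
    _ = |t| * √|t| := by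
      rw [Real.rpow_add' (abs_nonneg t) (by norm_num), Real.rpow_one, Real.sqrt_eq_rpow]

lemma abs_mul_le_of_mem_uIoc {t z : ℝ} (hz : z ∈ uIoc (0 : ℝ) 1) : |t ^ 2 * z| ≤ t ^ 2 := by
  rw [uIoc_of_le zero_le_one] at hz
  rw [abs_mul, abs_of_nonneg (sq_nonneg t), abs_of_pos hz.1]
  exact mul_le_of_le_one_right (sq_nonneg t) hz.2

lemma abs_boxAvg_sub_le (hk : Continuous k) (hC : ∀ p q, |k p - k q| ≤ C * dist p q ^ (3 / 4 : ℝ))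
    (hC0 : 0 ≤ C) (q : ℝ × ℝ × ℝ) : |boxAvg k q - k q.2| ≤ C * (|q.1| * √|q.1|) := by
  have hw (z : ℝ) : Continuous fun w => k (q.2.1 + q.1 ^ 2 * z, q.2.2 + q.1 ^ 2 * w) := by fun_prop
  have hz : Continuous fun z => ∫ w in (0 : ℝ)..1, k (q.2.1 + q.1 ^ 2 * z, q.2.2 + q.1 ^ 2 * w) :=
    continuous_integral_param (f := fun p : ℝ × ℝ =>
      k (q.2.1 + q.1 ^ 2 * p.1, q.2.2 + q.1 ^ 2 * p.2)) (by fun_prop)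
  have h : boxAvg k q - k q.2 = ∫ z in (0 : ℝ)..1, ∫ w in (0 : ℝ)..1,
      (k (q.2.1 + q.1 ^ 2 * z, q.2.2 + q.1 ^ 2 * w) - k q.2) := by
    have (z : ℝ) : ∫ w in (0 : ℝ)..1, (k (q.2.1 + q.1 ^ 2 * z, q.2.2 + q.1 ^ 2 * w) - k q.2) =
        (∫ w in (0 : ℝ)..1, k (q.2.1 + q.1 ^ 2 * z, q.2.2 + q.1 ^ 2 * w)) - k q.2 := by
      rw [intervalIntegral.integral_sub ((hw z).intervalIntegrable _ _) intervalIntegrable_const]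
      simp
    simp_rw [this]
    rw [intervalIntegral.integral_sub (hz.intervalIntegrable _ _) intervalIntegrable_const]
    simp [boxAvg]
  rw [h]
  have := intervalIntegral.norm_integral_le_of_norm_le_const (a := 0) (b := 1)
    (f := fun z => ∫ w in (0 : ℝ)..1, (k (q.2.1 + q.1 ^ 2 * z, q.2.2 + q.1 ^ 2 * w) - k q.2))
    (C := C * (|q.1| * √|q.1|)) fun z hz => ?_
  · simpa using this
  · have := intervalIntegral.norm_integral_le_of_norm_le_const (a := 0) (b := 1)
      (f := fun w => (k (q.2.1 + q.1 ^ 2 * z, q.2.2 + q.1 ^ 2 * w) - k q.2))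
      (C := C * (|q.1| * √|q.1|)) fun w hw => ?_
    · simpa using this
    · refine holder_le hC hC0 ?_ ?_
      · simpa using abs_mul_le_of_mem_uIoc hz
      · simpa using abs_mul_le_of_mem_uIoc hw

lemma abs_vertAvg_sub_le (hk : Continuous k)
    (hC : ∀ p q, |k p - k q| ≤ C * dist p q ^ (3 / 4 : ℝ)) (hC0 : 0 ≤ C) (q : ℝ × ℝ × ℝ) :
    |vertAvg k 1 q - vertAvg k 0 q| ≤ C * (|q.1| * √|q.1|) := by
  have hw (a : ℝ) : Continuous fun w => k (q.2.1 + a * q.1 ^ 2, q.2.2 + q.1 ^ 2 * w) := by fun_prop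
  rw [vertAvg, vertAvg, ← intervalIntegral.integral_sub ((hw _).intervalIntegrable _ _)
    ((hw _).intervalIntegrable _ _)]
  have := intervalIntegral.norm_integral_le_of_norm_le_const (a := 0) (b := 1)
    (f := fun w => k (q.2.1 + 1 * q.1 ^ 2, q.2.2 + q.1 ^ 2 * w) -
      k (q.2.1 + 0 * q.1 ^ 2, q.2.2 + q.1 ^ 2 * w))
    (C := C * (|q.1| * √|q.1|)) fun z hz => holder_le hC hC0 (by simp) (by simp [sq_nonneg])
  simpa using this

lemma abs_horizAvg_sub_le (hk : Continuous k)
    (hC : ∀ p q, |k p - k q| ≤ C * dist p q ^ (3 / 4 : ℝ)) (hC0 : 0 ≤ C) (q : ℝ × ℝ × ℝ) :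
    |horizAvg k 1 q - horizAvg k 0 q| ≤ C * (|q.1| * √|q.1|) := by
  have hw (a : ℝ) : Continuous fun w => k (q.2.1 + q.1 ^ 2 * w, q.2.2 + a * q.1 ^ 2) := by fun_prop
  rw [horizAvg, horizAvg, ← intervalIntegral.integral_sub ((hw _).intervalIntegrable _ _)
    ((hw _).intervalIntegrable _ _)]
  have := intervalIntegral.norm_integral_le_of_norm_le_const (a := 0) (b := 1)
    (f := fun w => k (q.2.1 + q.1 ^ 2 * w, q.2.2 + 1 * q.1 ^ 2) -
      k (q.2.1 + q.1 ^ 2 * w, q.2.2 + 0 * q.1 ^ 2))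
    (C := C * (|q.1| * √|q.1|)) fun z hz => holder_le hC hC0 (by simp [sq_nonneg]) (by simp)
  simpa using this

lemma continuous_inv_time_mul {f : ℝ × ℝ × ℝ → ℝ} (hf : Continuous f)
    (hC : ∀ q, |f q| ≤ C * (|q.1| * √|q.1|)) : Continuous fun q => q.1⁻¹ * f q := by
  rw [continuous_iff_continuousAt]
  intro q
  rcases eq_or_ne q.1 0 with h0 | h0
  · have hlim : Filter.Tendsto (fun q : ℝ × ℝ × ℝ => C * √|q.1|) (𝓝 q) (𝓝 0) := by
      have : Continuous fun q : ℝ × ℝ × ℝ => C * √|q.1| := by fun_prop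
      simpa [h0] using this.tendsto q
    have hval : q.1⁻¹ * f q = 0 := by simp [h0]
    rw [ContinuousAt, hval]
    refine squeeze_zero_norm (fun r => ?_) hlim
    rcases eq_or_ne r.1 0 with h | h
    · simp [h]
    · rw [norm_mul, norm_inv, Real.norm_eq_abs, Real.norm_eq_abs,
        inv_mul_le_iff₀ (abs_pos.2 h)]
      linarith [hC r]
  · exact (continuousAt_fst.inv₀ h0).mul hf.continuousAt

/-- `t ↦ t * boxAvg k` is `C¹` as soon as `k` is Hölder continuous of an exponent above `1 / 2`. -/
lemma contDiff_time_mul_boxAvg (hk : Continuous k)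
    (hC : ∀ p q, |k p - k q| ≤ C * dist p q ^ (3 / 4 : ℝ)) (hC0 : 0 ≤ C) :
    ContDiff ℝ 1 fun q : ℝ × ℝ × ℝ => q.1 * boxAvg k q := by
  have := contDiff_succ_of_deriv₃ (n := 0) (f := fun q : ℝ × ℝ × ℝ => q.1 * boxAvg k q)
    (hasDerivAt_boxAvg_time hk)
    (f₁ := fun q => q.1⁻¹ * (vertAvg k 1 q - vertAvg k 0 q)) (hasDerivAt_boxAvg_fst hk)
    (f₂ := fun q => q.1⁻¹ * (horizAvg k 1 q - horizAvg k 0 q)) (hasDerivAt_boxAvg_snd hk)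
    (contDiff_zero.2 ?_) (contDiff_zero.2 ?_) (contDiff_zero.2 ?_)
  · exact_mod_cast this
  · have h1 := continuous_boxAvg hk
    have h2 := continuous_vertAvg hk 1
    have h3 := continuous_horizAvg hk 1
    unfold boxAvgDt
    fun_prop
  · exact continuous_inv_time_mul ((continuous_vertAvg hk 1).sub (continuous_vertAvg hk 0))
      (abs_vertAvg_sub_le hk hC hC0)
  · exact continuous_inv_time_mul ((continuous_horizAvg hk 1).sub (continuous_horizAvg hk 0))
      (abs_horizAvg_sub_le hk hC hC0)

lemma vertAvg_sub_eq (hk : ContDiff ℝ 1 k) (q : ℝ × ℝ × ℝ) :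
    vertAvg k 1 q - vertAvg k 0 q = q.1 ^ 2 * boxAvg (pdx k) q := by
  have hx : Continuous (pdx k) := (contDiff_pdx (n := 0) (by simpa using hk)).continuous
  have hw (a : ℝ) : Continuous fun w => k (q.2.1 + a * q.1 ^ 2, q.2.2 + q.1 ^ 2 * w) :=
    hk.continuous.comp (by fun_prop)
  have hbox : boxAvg (pdx k) q = ∫ w in (0 : ℝ)..1, ∫ z in (0 : ℝ)..1,
      pdx k (q.2.1 + q.1 ^ 2 * z, q.2.2 + q.1 ^ 2 * w) :=
    integral_integral_comm
      (k := fun p : ℝ × ℝ => pdx k (q.2.1 + q.1 ^ 2 * p.1, q.2.2 + q.1 ^ 2 * p.2))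
      (by fun_prop) 0 1 0 1
  rw [hbox, vertAvg, vertAvg, ← intervalIntegral.integral_sub ((hw _).intervalIntegrable _ _)
    ((hw _).intervalIntegrable _ _), ← intervalIntegral.integral_const_mul]
  refine intervalIntegral.integral_congr fun w _ => ?_
  have h1 := intervalIntegral.smul_integral_comp_add_mul (a := 0) (b := 1)
    (fun ξ => pdx k (ξ, q.2.2 + q.1 ^ 2 * w)) (q.1 ^ 2) q.2.1
  simp only [mul_zero, add_zero, mul_one, smul_eq_mul] at h1
  simp only [one_mul, zero_mul, add_zero]
  rw [h1, intervalIntegral.integral_eq_sub_of_hasDerivAt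
    (f := fun ξ => k (ξ, q.2.2 + q.1 ^ 2 * w))]
  · exact fun ξ _ => hasDerivAt_pdx (p := (ξ, _)) (hk.differentiable one_ne_zero _)
  · exact (hx.comp (by fun_prop : Continuous fun ξ : ℝ => (ξ, q.2.2 + q.1 ^ 2 * w))
      ).intervalIntegrable _ _

lemma horizAvg_sub_eq (hk : ContDiff ℝ 1 k) (q : ℝ × ℝ × ℝ) :
    horizAvg k 1 q - horizAvg k 0 q = q.1 ^ 2 * boxAvg (pdy k) q := by
  have hy : Continuous (pdy k) := (contDiff_pdy (n := 0) (by simpa using hk)).continuous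
  have hw (a : ℝ) : Continuous fun w => k (q.2.1 + q.1 ^ 2 * w, q.2.2 + a * q.1 ^ 2) :=
    hk.continuous.comp (by fun_prop)
  rw [boxAvg, horizAvg, horizAvg, ← intervalIntegral.integral_sub ((hw _).intervalIntegrable _ _)
    ((hw _).intervalIntegrable _ _), ← intervalIntegral.integral_const_mul]
  refine intervalIntegral.integral_congr fun z _ => ?_
  have h1 := intervalIntegral.smul_integral_comp_add_mul (a := 0) (b := 1)
    (fun η => pdy k (q.2.1 + q.1 ^ 2 * z, η)) (q.1 ^ 2) q.2.2
  simp only [mul_zero, add_zero, mul_one, smul_eq_mul] at h1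
  simp only [one_mul, zero_mul, add_zero]
  rw [h1, intervalIntegral.integral_eq_sub_of_hasDerivAt
    (f := fun η => k (q.2.1 + q.1 ^ 2 * z, η))]
  · exact fun η _ => hasDerivAt_pdy (p := (_, η)) (hk.differentiable one_ne_zero _)
  · exact (hy.comp (by fun_prop : Continuous fun η : ℝ => (q.2.1 + q.1 ^ 2 * z, η))
      ).intervalIntegrable _ _

lemma inv_mul_sq_mul (t a : ℝ) : t⁻¹ * (t ^ 2 * a) = t * a := by
  rcases eq_or_ne t 0 with rfl | h
  · simp
  · field_simp

lemma hasDerivAt_boxAvg_fst' (hk : ContDiff ℝ 1 k) (t x y : ℝ) :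
    HasDerivAt (fun x => t * boxAvg k (t, x, y)) (t * boxAvg (pdx k) (t, x, y)) x := by
  have := hasDerivAt_boxAvg_fst hk.continuous t x y
  rwa [vertAvg_sub_eq hk, inv_mul_sq_mul] at this

lemma hasDerivAt_boxAvg_snd' (hk : ContDiff ℝ 1 k) (t x y : ℝ) :
    HasDerivAt (fun y => t * boxAvg k (t, x, y)) (t * boxAvg (pdy k) (t, x, y)) y := by
  have := hasDerivAt_boxAvg_snd hk.continuous t x y
  rwa [horizAvg_sub_eq hk, inv_mul_sq_mul] at this

lemma abs_pdx_sub_le {p q : ℝ × ℝ} : |pdx k p - pdx k q| ≤ dist (fderiv ℝ k p) (fderiv ℝ k q) := by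
  rw [dist_eq_norm, pdx, pdx, ← sub_apply]
  refine ((fderiv ℝ k p - fderiv ℝ k q).le_opNorm (1, 0)).trans ?_
  simp [Prod.norm_def]

lemma abs_pdy_sub_le {p q : ℝ × ℝ} : |pdy k p - pdy k q| ≤ dist (fderiv ℝ k p) (fderiv ℝ k q) := by
  rw [dist_eq_norm, pdy, pdy, ← sub_apply]
  refine ((fderiv ℝ k p - fderiv ℝ k q).le_opNorm (0, 1)).trans ?_
  simp [Prod.norm_def]

/-- A `C^{1 + 3/4}` doubly periodic function `k` on the plane is the time derivative at `t = 0` of a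
`C²` function `u` which vanishes at `t = 0` and whose `x`-derivative is `t ∂_x k + O(t²)`. -/
lemma exists_smoothing (hk : ContDiff ℝ 1 k) (hper : IsBiperiodic k)
    (hC : ∀ p q, dist (fderiv ℝ k p) (fderiv ℝ k q) ≤ C * dist p q ^ (3 / 4 : ℝ)) (hC0 : 0 ≤ C) :
    ∃ u v : ℝ × ℝ × ℝ → ℝ, ContDiff ℝ 2 u ∧ (∀ t, IsBiperiodic fun p => u (t, p)) ∧
      (∀ p, HasDerivAt (fun t => u (t, p)) (k p) 0) ∧ (∀ p, u (0, p) = 0) ∧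
      (∀ t x y, HasDerivAt (fun x => u (t, x, y)) (v (t, x, y)) x) ∧
      ∃ B : ℝ, 0 < B ∧ ∀ t p, |t| ≤ 1 → |u (t, p)| ≤ B * |t| ∧
        |v (t, p) - t * pdx k p| ≤ B * t ^ 2 := by
  have hCx (p q : ℝ × ℝ) : |pdx k p - pdx k q| ≤ C * dist p q ^ (3 / 4 : ℝ) :=
    abs_pdx_sub_le.trans (hC p q)
  have hCy (p q : ℝ × ℝ) : |pdy k p - pdy k q| ≤ C * dist p q ^ (3 / 4 : ℝ) :=
    abs_pdy_sub_le.trans (hC p q)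
  have hx : Continuous (pdx k) := (contDiff_pdx (n := 0) (by simpa using hk)).continuous
  have hy : Continuous (pdy k) := (contDiff_pdy (n := 0) (by simpa using hk)).continuous
  obtain ⟨M, hM, hMb⟩ := hper.exists_bound hk.continuous
  refine ⟨fun q => q.1 * boxAvg k q, fun q => q.1 * boxAvg (pdx k) q, ?_, fun t p k' m => ?_,
    fun p => ?_, fun p => by simp, fun t x y => hasDerivAt_boxAvg_fst' hk t x y,
    max M C, lt_max_of_lt_left hM, fun t p ht => ⟨?_, ?_⟩⟩
  · have := contDiff_succ_of_deriv₃ (n := 1) (f := fun q : ℝ × ℝ × ℝ => q.1 * boxAvg k q)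
      (hasDerivAt_boxAvg_time hk.continuous)
      (f₁ := fun q => q.1 * boxAvg (pdx k) q) (hasDerivAt_boxAvg_fst' hk)
      (f₂ := fun q => q.1 * boxAvg (pdy k) q) (hasDerivAt_boxAvg_snd' hk) ?_
      (contDiff_time_mul_boxAvg hx hCx hC0) (contDiff_time_mul_boxAvg hy hCy hC0)
    · exact this.of_le (by norm_num)
    · have h1 := contDiff_boxAvg hk
      have h2 := contDiff_vertAvg hk 1
      have h3 := contDiff_horizAvg hk 1
      unfold boxAvgDt
      push_cast
      fun_prop
  · simp only [boxAvg]
    congr 1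
    refine intervalIntegral.integral_congr fun z _ => intervalIntegral.integral_congr fun w _ => ?_
    have := hper (p.1 + t ^ 2 * z, p.2 + t ^ 2 * w) k' m
    simp only at this ⊢
    rw [← this]
    congr 2 <;> ring
  · have := hasDerivAt_boxAvg_time hk.continuous 0 p.1 p.2
    convert! this using 1
    simp only [boxAvgDt, boxAvg_zero, vertAvg_zero, horizAvg_zero]; ring
  · simp only
    rw [abs_mul, mul_comm]
    refine mul_le_mul_of_nonneg_right (le_max_of_le_left ?_) (abs_nonneg _)
    have := intervalIntegral.norm_integral_le_of_norm_le_const (a := 0) (b := 1)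
      (f := fun z => ∫ w in (0 : ℝ)..1, k (p.1 + t ^ 2 * z, p.2 + t ^ 2 * w)) (C := M)
      fun z _ => ?_
    · simpa using! this
    · have := intervalIntegral.norm_integral_le_of_norm_le_const (a := 0) (b := 1)
        (f := fun w => k (p.1 + t ^ 2 * z, p.2 + t ^ 2 * w)) (C := M) fun w _ => hMb _
      simpa using this
  · simp only
    rw [← mul_sub, abs_mul]
    have h1 := abs_boxAvg_sub_le hx hCx hC0 (t, p)
    have h2 : √|t| ≤ 1 := Real.sqrt_le_one.2 ht
    have h3 : |t| * √|t| ≤ |t| := mul_le_of_le_one_right (abs_nonneg t) h2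
    calc |t| * |boxAvg (pdx k) (t, p) - pdx k p| ≤ |t| * (C * (|t| * √|t|)) := by gcongr
      _ ≤ |t| * (C * |t|) := by gcongr
      _ = C * t ^ 2 := by rw [← sq_abs t]; ring
      _ ≤ max M C * t ^ 2 := by gcongr; exact le_max_right _ _

end Smoothing

/-! ### The Hamiltonian perturbation near the continuum -/

lemma IsBiperiodic.pdx {f : ℝ × ℝ → ℝ} (hf : IsBiperiodic f) : IsBiperiodic (pdx f) :=
  fun p k m => by simp only [_root_.pdx, hf.fderiv p k m]

lemma torusDx_eq_pdx {h : Torus → ℝ} (hh : ContDiff ℝ 1 (torusLift h)) (p : ℝ × ℝ) :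
    torusDx h p = pdx (torusLift h) p :=
  (hasDerivAt_pdx (hh.differentiable one_ne_zero p)).deriv

lemma norm_coe_unitAddCircle_le (x : ℝ) : ‖(x : UnitAddCircle)‖ ≤ |x| :=
  QuotientAddGroup.norm_mk_le_norm

/-- A smooth doubly periodic cutoff function: `1` near `D`, and `0` near the closure of `V`. -/
lemma exists_cutoff {D V : Set Torus} (hD : IsClosed D) (hV : Disjoint (closure V) D) :
    ∃ (ψ : ℝ × ℝ → ℝ) (O W : Set Torus), ContDiff ℝ 2 ψ ∧ IsBiperiodic ψ ∧ (∀ p, 0 ≤ ψ p) ∧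
      (∀ p, ψ p ≤ 1) ∧ IsOpen O ∧ IsOpen W ∧ D ⊆ O ∧ closure V ⊆ W ∧
      (∀ p, toTorus p ∈ O → ψ p = 1) ∧ ∀ p, toTorus p ∈ W → ψ p = 0 := by
  obtain ⟨O, hO, hDO, hOV⟩ := normal_exists_closure_subset hD
    (isClosed_closure (s := V)).isOpen_compl (subset_compl_iff_disjoint_left.2 hV)
  obtain ⟨W, hW, hVW, hWO⟩ := normal_exists_closure_subset (isClosed_closure (s := V))
    (isClosed_closure (s := O)).isOpen_compl (subset_compl_comm.1 hOV)
  obtain ⟨G₁, s1, p1, n1, -, z1⟩ := exists_smooth_zeroSet (isClosed_closure (s := W)) 2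
  obtain ⟨G₂, s2, p2, n2, -, z2⟩ := exists_smooth_zeroSet (isClosed_closure (s := O)) 2
  have pos (p : ℝ × ℝ) : 0 < G₁ p + G₂ p := by
    rcases (n1 p).lt_or_eq with h | h
    · exact add_pos_of_pos_of_nonneg h (n2 p)
    · refine add_pos_of_nonneg_of_pos (n1 p) ((n2 p).lt_of_ne fun h' => ?_)
      exact hWO ((z1 p).1 h.symm) ((z2 p).1 h'.symm)
  refine ⟨fun p => G₁ p / (G₁ p + G₂ p), O, W, s1.div (s1.add s2) fun p => (pos p).ne',
    fun p k m => by simp only [p1 p k m, p2 p k m], fun p => div_nonneg (n1 p) (pos p).le,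
    fun p => (div_le_one (pos p)).2 (le_add_of_nonneg_right (n2 p)), hO, hW, hDO, hVW,
    fun p hp => ?_, fun p hp => ?_⟩
  · have h2 := (z2 p).2 (subset_closure hp)
    have := pos p
    rw [h2, add_zero] at this
    simp only [h2, add_zero, div_self this.ne']
  · simp only [(z1 p).2 (subset_closure hp), zero_div]

/-- A doubly periodic continuous function that is positive off an open set of the torus is bounded
below there. -/
lemma IsBiperiodic.exists_pos_le {P : ℝ × ℝ → ℝ} (hP : IsBiperiodic P) (hc : Continuous P)
    {O : Set Torus} (hO : IsOpen O) (hpos : ∀ p, toTorus p ∉ O → 0 < P p) :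
    ∃ m : ℝ, 0 < m ∧ m ≤ 1 ∧ ∀ p, toTorus p ∉ O → m ≤ P p := by
  obtain ⟨F, hF⟩ := hP.exists_descent
  have hFc : Continuous F := by
    refine isOpenQuotientMap_toTorus.isQuotientMap.continuous_iff.2 ?_
    have : F ∘ toTorus = P := funext hF
    rwa [this]
  obtain ⟨m, hm, hmF⟩ := hO.isClosed_compl.isCompact.exists_forall_le' (f := F) (a := 0)
    hFc.continuousOn (by
      intro q hq
      obtain ⟨p, rfl⟩ := toTorus_surjective q
      rw [hF]; exact hpos p hq)
  exact ⟨min m 1, lt_min hm one_pos, min_le_right _ _, fun p hp =>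
    (min_le_left _ _).trans ((hmF _ hp).trans_eq (hF p))⟩

/-- The local model: perturbations `g` of the coordinate `x` and `u` of order `t` such that
`x + (1 - C t²) g - u`, cut off by `ψ` in space, still has positive `x`-derivative off
`{0} × D` for small `t`. -/
lemma exists_model {h : Torus → ℝ} {D V : Set Torus} (H : IsSmoothDenjoyField h D)
    (hV : Disjoint (closure V) D) {ε : ℝ} (hε : 0 < ε) :
    ∃ (ψ g : ℝ × ℝ → ℝ) (u v : ℝ × ℝ × ℝ → ℝ) (W : Set Torus) (C η B : ℝ),
      ContDiff ℝ 2 ψ ∧ ContDiff ℝ 2 g ∧ ContDiff ℝ 2 u ∧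
      IsBiperiodic ψ ∧ IsBiperiodic g ∧ (∀ t, IsBiperiodic fun p => u (t, p)) ∧
      IsOpen W ∧ closure V ⊆ W ∧ (∀ p, toTorus p ∈ W → ψ p = 0) ∧
      (∀ p, toTorus p ∈ D → ψ p = 1 ∧ pdx ψ p = 0 ∧ 1 + pdx g p = 0) ∧
      (∀ p, 0 ≤ ψ p) ∧ (∀ p, ψ p ≤ 1) ∧ (∀ p, |g p| ≤ ε) ∧
      (∀ p, u (0, p) = 0) ∧ (∀ p, v (0, p) = 0) ∧
      (∀ p, HasDerivAt (fun t => u (t, p)) (torusLift h p) 0) ∧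
      (∀ t x y, HasDerivAt (fun x => u (t, x, y)) (v (t, x, y)) x) ∧
      0 < η ∧ 0 < B ∧ 0 < C ∧ η ≤ 1 ∧ C * η ^ 2 ≤ 1 / 2 ∧
      (∀ t p, |t| ≤ η → |u (t, p)| ≤ B * |t|) ∧
      ∀ t p, |t| ≤ η → ¬(t = 0 ∧ toTorus p ∈ D) →
        0 < 1 + (pdx ψ p * ((1 - C * t ^ 2) * g p - u (t, p)) +
          ψ p * ((1 - C * t ^ 2) * pdx g p - v (t, p))) := by
  have hh := H.isDenjoyField.contDiff
  have hDcl := H.isDenjoyField.isMinimalSet.isClosed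
  have hper := isBiperiodic_torusLift h
  set k := torusLift h with hk
  have hxc : Continuous (pdx k) := (contDiff_pdx (n := 0) (by simpa using hh)).continuous
  obtain ⟨M, hM, hMb⟩ := hper.pdx.exists_bound hxc
  obtain ⟨G, hG2, hGper, hG0, hG1, hGz⟩ := exists_smooth_zeroSet hDcl 2
  set c : ℝ := 1 / (M ^ 2 + 1) with hc
  have hc0 : 0 < c := by positivity
  -- The lower bound `P` for the `x`-derivative.
  let P (p : ℝ × ℝ) : ℝ := c * (pdx k p ^ 2 + G p)
  have hPc : Continuous P := by
    have := hG2.continuous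
    fun_prop
  have hPper : IsBiperiodic P := fun p a b => by
    simp only [P, hper.pdx p a b, hGper p a b]
  have hP0 (p) : 0 ≤ P p := mul_nonneg hc0.le (add_nonneg (sq_nonneg _) (hG0 p))
  have hP1 (p) : P p ≤ 1 := by
    have h1 : pdx k p ^ 2 ≤ M ^ 2 := sq_le_sq' (abs_le.1 (hMb p)).1 (abs_le.1 (hMb p)).2
    simp only [P, hc]
    rw [one_div, inv_mul_le_iff₀ (by positivity)]
    linarith [hG1 p]
  have hPD (p) (hp : toTorus p ∈ D) : P p = 0 := by
    have h1 := H.dx_eq_zero p hp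
    rw [torusDx_eq_pdx hh] at h1
    simp only [P, ← hk, (hGz p).2 hp] at h1 ⊢
    rw [h1]; ring
  have hPpos (p) (hp : toTorus p ∉ D) : 0 < P p := by
    have h1 : 0 < G p := (hG0 p).lt_of_ne fun h => hp ((hGz p).1 h.symm)
    exact mul_pos hc0 (by positivity)
  have hI : ContDiff ℝ 2 (primX P) := by
    have e : primX P = fun p => c * ((∫ ξ in (0 : ℝ)..p.1, (torusDx h (ξ, p.2)) ^ 2)
        + primX G p) := by
      funext p
      have h1 : Continuous fun ξ => pdx k (ξ, p.2) ^ 2 := by fun_prop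
      have h2 : Continuous fun ξ => G (ξ, p.2) := hG2.continuous.comp (by fun_prop)
      simp only [primX, P, torusDx_eq_pdx hh]
      rw [intervalIntegral.integral_const_mul, intervalIntegral.integral_add
        (h1.intervalIntegrable _ _) (h2.intervalIntegrable _ _)]
    rw [e]
    exact contDiff_const.mul (H.contDiff_integral.add (contDiff_primX (n := 2) hG2))
  obtain ⟨ψ, O, W, hψ2, hψper, hψ0, hψ1, hO, hW, hDO, hVW, hψO, hψW⟩ := exists_cutoff hDcl hV
  obtain ⟨m, hm0, hm1, hmP⟩ := hPper.exists_pos_le hPc hO fun p hp => hPpos p fun h => hp (hDO h)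
  obtain ⟨C', hC'⟩ := H.holder (3 / 4) (by norm_num) (by rw [div_lt_one] <;> norm_num)
  obtain ⟨u, v, hu2, huper, hut, hu0, hux, B, hB, huv⟩ := exists_smoothing hh hper
    (C := C') (fun p q => by simpa using hC'.dist_le p q) C'.2
  have hψxc : Continuous (pdx ψ) :=
    (contDiff_pdx (n := 0) (hψ2.of_le (by norm_num))).continuous
  obtain ⟨L, hL, hLb⟩ := hψper.pdx.exists_bound hψxc
  obtain ⟨g, hg2, hgper, hgε, hgP, hgD⟩ := exists_flat_perturbation hDcl
    (fun a b y hab => H.isDenjoyField.exists_notMem hab y) hPc hPper hP0 hP1 hPD hI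
    (ε := min ε (m / (8 * L))) (by positivity)
  have hψx (p) (hp : toTorus p ∈ O) : pdx ψ p = 0 := by
    have h1 := hasDerivAt_pdx (p := p) (hψ2.differentiable two_ne_zero p)
    have h2 : (fun z => ψ (z, p.2)) =ᶠ[𝓝 p.1] fun _ => 1 := by
      have : Continuous fun z : ℝ => toTorus (z, p.2) := continuous_toTorus.comp (by fun_prop)
      filter_upwards [(hO.preimage this).mem_nhds hp] with z hz
      exact hψO _ hz
    exact h1.unique ((hasDerivAt_const p.1 (1 : ℝ)).congr_of_eventuallyEq h2)
  have hv0 (p) : v (0, p) = 0 := by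
    have := (huv 0 p (by simp)).2
    simpa using this
  -- This choice of `C` makes the quadratic form in `(∂_x h, t)` below positive definite.
  set C : ℝ := B + 1 / c with hCdef
  have hC : 0 < C := by positivity
  set η : ℝ := min 1 (min (1 / (2 * C)) (m / (8 * (M + B + L * B)))) with hη
  have hη0 : 0 < η := by positivity
  have hη1 : η ≤ 1 := min_le_left _ _
  have hη2 : η ≤ 1 / (2 * C) := (min_le_right _ _).trans (min_le_left _ _)
  have hη3 : η ≤ m / (8 * (M + B + L * B)) := (min_le_right _ _).trans (min_le_right _ _)
  have hCη : C * η ^ 2 ≤ 1 / 2 := by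
    have h1 : η ^ 2 ≤ 1 / (2 * C) := by nlinarith
    calc C * η ^ 2 ≤ C * (1 / (2 * C)) := by gcongr
      _ = 1 / 2 := by field_simp
  refine ⟨ψ, g, u, v, W, C, η, B, hψ2, hg2, hu2, hψper, hgper, huper, hW, hVW, hψW,
    fun p hp => ⟨hψO p (hDO hp), hψx p (hDO hp), hgD p hp⟩, hψ0, hψ1,
    fun p => (hgε p).trans (min_le_left _ _), hu0, hv0, hut, hux, hη0, hB, hC, hη1, hCη,
    fun t p ht => (huv t p (ht.trans hη1)).1, fun t p ht hne => ?_⟩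
  have hCt : C * t ^ 2 ≤ 1 / 2 := by
    refine le_trans ?_ hCη
    have : t ^ 2 ≤ η ^ 2 := sq_le_sq.2 (by rwa [abs_of_pos hη0])
    gcongr
  have hCt0 : 0 ≤ C * t ^ 2 := by positivity
  obtain ⟨hub, hvb⟩ := huv t p (ht.trans hη1)
  have hgp := hgP p
  by_cases hp : toTorus p ∈ O
  · rw [hψO p hp, hψx p hp, zero_mul, zero_add, one_mul]
    have hv' := (abs_le.1 hvb).2
    have h3 : t * pdx k p ≤ |t| * |pdx k p| := by rw [← abs_mul]; exact le_abs_self _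
    have h4 : (1 / 2) * P p ≤ (1 - C * t ^ 2) * (1 + pdx g p) := by
      have := hP0 p
      nlinarith
    have h5 : c * |pdx k p| ^ 2 ≤ P p := by
      simp only [P, sq_abs]
      have := mul_nonneg hc0.le (hG0 p)
      linarith
    rcases eq_or_ne t 0 with rfl | ht0
    · have h6 := hPpos p fun h => hne ⟨rfl, h⟩
      rw [hv0]
      simp only [ne_eq, OfNat.ofNat_ne_zero, not_false_eq_true, zero_pow, mul_zero, sub_zero,
        one_mul]
      linarith
    · have ht2 : 0 < t ^ 2 := by positivity
      have e1 : C * t ^ 2 = B * t ^ 2 + |t| ^ 2 / c := by rw [hCdef, sq_abs]; ring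
      have e2 : (1 / 2) * (c * |pdx k p| ^ 2) - |t| * |pdx k p| + |t| ^ 2 / c =
          c / 2 * (|pdx k p| - |t| / c) ^ 2 + t ^ 2 / (2 * c) := by
        rw [← sq_abs t]; field_simp; ring
      have h7 : 0 < c / 2 * (|pdx k p| - |t| / c) ^ 2 + t ^ 2 / (2 * c) := by positivity
      linarith
  · have hmp := hmP p hp
    have hg8 : |g p| ≤ m / (8 * L) := (hgε p).trans (min_le_right _ _)
    have hvt : |v (t, p)| ≤ (M + B) * |t| := by
      have h1 : |t * pdx k p| ≤ |t| * M := by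
        rw [abs_mul]; gcongr; exact hMb p
      have h2 : B * t ^ 2 ≤ B * |t| := by
        gcongr
        rw [← sq_abs]
        nlinarith [abs_nonneg t, ht.trans hη1]
      have h3 := abs_sub_abs_le_abs_sub (v (t, p)) (t * pdx k p)
      linarith
    have h1 : |pdx ψ p * ((1 - C * t ^ 2) * g p - u (t, p))| ≤ m / 8 + L * B * |t| := by
      rw [abs_mul]
      have h2 : |(1 - C * t ^ 2) * g p - u (t, p)| ≤ m / (8 * L) + B * |t| := by
        refine (abs_sub _ _).trans (add_le_add ?_ hub)
        rw [abs_mul, abs_of_nonneg (by linarith)]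
        refine le_trans (mul_le_of_le_one_left (abs_nonneg _) (by linarith)) hg8
      calc _ ≤ L * (m / (8 * L) + B * |t|) := by gcongr; exact hLb p
        _ = _ := by field_simp
    have h4 : m / 2 ≤ (1 - C * t ^ 2) * (1 + pdx g p) := by nlinarith
    have h5 : m / 2 - (M + B) * |t| ≤ 1 + ((1 - C * t ^ 2) * pdx g p - v (t, p)) := by
      linarith [(abs_le.1 hvt).2]
    have h6 : (M + B + L * B) * |t| ≤ m / 8 := by
      calc _ ≤ (M + B + L * B) * (m / (8 * (M + B + L * B))) := by
            gcongr; exact ht.trans hη3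
        _ = m / 8 := by field_simp
    have h7 := (abs_le.1 h1).1
    have h8 : m / 2 - (M + B) * |t| ≤ 1 + ψ p * ((1 - C * t ^ 2) * pdx g p - v (t, p)) := by
      have a1 := mul_le_mul_of_nonneg_left h5 (hψ0 p)
      have a2 : (1 - ψ p) * (m / 2 - (M + B) * |t|) ≤ (1 - ψ p) * 1 := by
        refine mul_le_mul_of_nonneg_left ?_ (by linarith [hψ1 p])
        have : 0 ≤ (M + B) * |t| := by positivity
        linarith
      linarith
    linarith

/-- The local model, cut off in `t` at a scale so small that the perturbation stays below `ε`, that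
it vanishes on the collar, and that the tube moves by less than the distance from `closure V` to the
support of the cutoff in space. -/
lemma exists_hamiltonian {h : Torus → ℝ} {D : Set Torus} (H : IsSmoothDenjoyField h D)
    {V : Set Torus} (hV : Disjoint (closure V) D) {δ ε : ℝ} (hδ1 : δ < 1) (hε : 0 < ε) :
    ∃ (K : ThickTorus → UnitAddCircle) (k : ℝ × ℝ × ℝ → ℝ), IsC2Lift K k ∧
      (∀ x y : ℝ, toTorus (x, y) ∈ D →
        hamiltonianField k 0 x y = (0, torusLift h (x, y), 1)) ∧
      (∀ (t : Icc (-1 : ℝ) 1) (x y : ℝ), ¬((t : ℝ) = 0 ∧ toTorus (x, y) ∈ D) →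
        0 < (hamiltonianField k t x y).1) ∧
      (∀ q : ThickTorus, ‖K q - K₀ q‖ < ε) ∧
      (∀ q ∈ collarTube δ V, K q = K₀ q) := by
  obtain ⟨ψ, g, u, v, W, C, η₀, B, hψ2, hg2, hu2, hψper, hgper, huper, hW, hVW, hψW, hDψ, hψ0, hψ1,
    hgε, hu0, hv0, hut, hux, hη₀, hB, hC, hη₀1, hCη, hub, hpos⟩ :=
    exists_model H hV (half_pos hε)
  obtain ⟨r, hr, hrW⟩ := (isClosed_closure (s := V)).isCompact.exists_thickening_subset_open hW hVW
  set η : ℝ := min (min η₀ (ε / (4 * B))) (min r ((1 - δ) / 2)) with hηdef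
  have hη : 0 < η := by
    have : 0 < 1 - δ := by linarith
    positivity
  have hη1 : η ≤ η₀ := (min_le_left _ _).trans (min_le_left _ _)
  have hη2 : η ≤ ε / (4 * B) := (min_le_left _ _).trans (min_le_right _ _)
  have hη3 : η ≤ r := (min_le_right _ _).trans (min_le_left _ _)
  have hη4 : η < 1 - δ := lt_of_le_of_lt ((min_le_right _ _).trans (min_le_right _ _))
    (by linarith)
  let a : ContDiffBump (0 : ℝ) := ⟨η / 2, η, half_pos hη, half_lt_self hη⟩
  have ha2 : ContDiff ℝ 2 a := a.contDiff
  have haz (t : ℝ) (ht : η ≤ |t|) : a t = 0 := a.zero_of_le_dist (by simpa using ht)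
  let w (q : ℝ × ℝ × ℝ) : ℝ := (1 - C * q.1 ^ 2) * g q.2 - u q
  let φ (q : ℝ × ℝ × ℝ) : ℝ := a q.1 * (ψ q.2 * w q)
  have hw2 : ContDiff ℝ 2 w := by fun_prop
  have hφ2 : ContDiff ℝ 2 φ := by fun_prop
  have hφper (t : ℝ) : IsBiperiodic fun p => φ (t, p) := fun p i j => by
    have := huper t p i j
    simp only at this
    simp only [φ, w, hψper p i j, hgper p i j, this]
  choose Φ hΦ using fun t => (hφper t).exists_descent
  have hsmall (t : ℝ) (p : ℝ × ℝ) : |φ (t, p)| < ε := by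
    rcases le_or_gt η |t| with ht | ht
    · simp only [φ, haz t ht, zero_mul, abs_zero, hε]
    · have hCt : C * t ^ 2 ≤ 1 / 2 := by
        refine le_trans ?_ hCη
        have : t ^ 2 ≤ η₀ ^ 2 := sq_le_sq.2 (by rw [abs_of_pos hη₀]; linarith)
        gcongr
      have hCt0 : 0 ≤ C * t ^ 2 := by positivity
      have h1 : |w (t, p)| ≤ ε / 2 + ε / 4 := by
        refine (abs_sub _ _).trans (add_le_add ?_ ((hub t p (ht.le.trans hη1)).trans ?_))
        · rw [abs_mul, abs_of_nonneg (by simp only; linarith)]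
          exact le_trans (mul_le_of_le_one_left (abs_nonneg _) (by simp only; linarith)) (hgε p)
        · calc B * |t| ≤ B * (ε / (4 * B)) := by gcongr; linarith
            _ = ε / 4 := by field_simp
      simp only [φ]
      rw [abs_mul, abs_mul, abs_of_nonneg a.nonneg, abs_of_nonneg (hψ0 p)]
      calc a t * (ψ p * |w (t, p)|) ≤ 1 * (1 * (ε / 2 + ε / 4)) := by
            gcongr
            · exact mul_nonneg (hψ0 p) (abs_nonneg _)
            · exact a.le_one
            · exact hψ1 p
        _ < ε := by linarith
  let k (q : ℝ × ℝ × ℝ) : ℝ := q.2.1 + φ q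
  have hkx (t x y : ℝ) : partialX k t x y = 1 + a t * (pdx ψ (x, y) * w (t, x, y) +
      ψ (x, y) * ((1 - C * t ^ 2) * pdx g (x, y) - v (t, x, y))) := by
    have h1 := hasDerivAt_pdx (p := (x, y)) (hψ2.differentiable two_ne_zero _)
    have h2 := hasDerivAt_pdx (p := (x, y)) (hg2.differentiable two_ne_zero _)
    have h3 := (h2.const_mul (1 - C * t ^ 2)).sub (hux t x y)
    exact ((hasDerivAt_id x).add ((h1.mul h3).const_mul (a t))).deriv
  have hkt (x y : ℝ) : partialT k 0 x y = -(ψ (x, y) * torusLift h (x, y)) := by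
    have h1 : HasDerivAt (fun t : ℝ => x + ψ (x, y) * ((1 - C * t ^ 2) * g (x, y) - u (t, x, y)))
        (-(ψ (x, y) * torusLift h (x, y))) 0 := by
      have h2 : HasDerivAt (fun t : ℝ => (1 - C * t ^ 2) * g (x, y)) 0 0 := by
        have := (((hasDerivAt_pow 2 (0 : ℝ)).const_mul C).const_sub 1).mul_const (g (x, y))
        convert! this using 1
        simp
      have := ((h2.sub (hut (x, y))).const_mul (ψ (x, y))).const_add x
      convert! this using 1
      ring
    have h3 : HasDerivAt (fun t => k (t, x, y)) (-(ψ (x, y) * torusLift h (x, y))) 0 := by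
      refine h1.congr_of_eventuallyEq ?_
      filter_upwards [a.eventuallyEq_one] with t ht
      simp only [k, φ, w, ht, Pi.one_apply, one_mul]
    exact h3.hasDerivWithinAt.derivWithin (uniqueDiffOn_Icc (by norm_num) 0 (by simp))
  have haN (t x y : ℝ) (ht : a t * ψ (x, y) = 0) : φ (t, x, y) = 0 := by
    simp only [φ]; rw [← mul_assoc, ht, zero_mul]
  refine ⟨fun q => q.2.1 + ((Φ q.1 q.2 : ℝ) : UnitAddCircle), k, ⟨?_, fun t x y => ?_⟩,
    fun x y hxy => ?_, fun t x y hne => ?_, ?_, ?_⟩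
  · exact ContDiff.contDiffOn (by fun_prop)
  · simp only [hΦ, k, AddCircle.coe_add]
    rfl
  · obtain ⟨e1, e2, e3⟩ := hDψ _ hxy
    simp only [hamiltonianField, hkx, hkt, e1, e2, hv0]
    have : a 0 = 1 := a.eventuallyEq_one.self_of_nhds
    rw [this]
    simp only [ne_eq, OfNat.ofNat_ne_zero, not_false_eq_true, zero_pow, mul_zero, sub_zero,
      one_mul, zero_mul, zero_add, neg_neg, e3]
  · simp only [hamiltonianField, hkx]
    rcases le_or_gt η |(t : ℝ)| with ht | ht
    · rw [haz _ ht, zero_mul, add_zero]; exact one_pos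
    · have h1 := hpos t (x, y) (ht.le.trans hη1) hne
      have h2 : (0 : ℝ) ≤ a t := a.nonneg
      have h3 : a (t : ℝ) ≤ 1 := a.le_one
      simp only [w]
      set b := pdx ψ (x, y) * ((1 - C * (t : ℝ) ^ 2) * g (x, y) - u (t, x, y)) +
          ψ (x, y) * ((1 - C * (t : ℝ) ^ 2) * pdx g (x, y) - v (t, x, y)) with hb
      rcases h2.eq_or_lt with h4 | h4
      · rw [← h4]; simp
      · have := mul_pos h4 h1
        linarith
  · rintro ⟨t, q⟩
    obtain ⟨p, rfl⟩ := toTorus_surjective q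
    simp only [K₀, add_sub_cancel_left, hΦ]
    exact (norm_coe_unitAddCircle_le _).trans_lt (hsmall t p)
  · rintro ⟨t, q⟩ hq
    obtain ⟨⟨x, y⟩, rfl⟩ := toTorus_surjective q
    have : φ (t, x, y) = 0 := by
      apply haN
      rcases le_or_gt η |(t : ℝ)| with ht | ht
      · rw [haz _ ht, zero_mul]
      · rcases hq with hq | ⟨p, hp, hpq⟩
        · have : 1 - δ < |(t : ℝ)| := hq
          linarith
        · rw [hψW, mul_zero]
          refine hrW (Metric.mem_thickening_iff.2 ⟨p, subset_closure hp, ?_⟩)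
          simp only at hpq
          rw [hpq, Prod.dist_eq, dist_self, dist_eq_norm, add_sub_cancel_left]
          exact max_lt hr ((norm_coe_unitAddCircle_le _).trans_lt (ht.trans_le hη3))
    simp only [K₀, hΦ, this, AddCircle.coe_zero, add_zero]

/-! ### Functions of prescribed decay -/

/-- The weight `(1 + s²)^(-1/2)`. -/
def wt (s : ℝ) : ℝ := (√(1 + s ^ 2))⁻¹

lemma wt_pos (s : ℝ) : 0 < wt s := by unfold wt; positivity

lemma wt_le_one (s : ℝ) : wt s ≤ 1 :=
  inv_le_one_of_one_le₀ (Real.one_le_sqrt.2 (by nlinarith [sq_nonneg s]))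

lemma wt_sq (s : ℝ) : wt s ^ 2 = (1 + s ^ 2)⁻¹ := by
  rw [wt, inv_pow, Real.sq_sqrt (by positivity)]

lemma abs_mul_wt_le (s : ℝ) : |s * wt s| ≤ 1 := by
  rw [← sq_le_one_iff_abs_le_one, mul_pow, wt_sq, ← div_eq_mul_inv, div_le_one (by positivity)]
  linarith

lemma wt_le_mul_wt {s r R : ℝ} (h : |s - r| ≤ R) : wt s ≤ √(2 * (1 + R ^ 2)) * wt r := by
  have hR : (s - r) ^ 2 ≤ R ^ 2 := sq_le_sq' (by linarith [(abs_le.1 h).1]) (abs_le.1 h).2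
  rw [wt, wt, ← div_eq_mul_inv, le_div_iff₀ (by positivity), inv_mul_le_iff₀ (by positivity),
    ← Real.sqrt_mul (by positivity)]
  apply Real.sqrt_le_sqrt
  nlinarith [sq_nonneg (s + (s - r)), mul_nonneg (sq_nonneg s) (sq_nonneg R)]

lemma wt_le_two_mul_wt {s r : ℝ} (h : |s - r| ≤ 1) : wt s ≤ 2 * wt r := by
  have := wt_le_mul_wt h
  rwa [show (2 : ℝ) * (1 + 1 ^ 2) = 2 ^ 2 by norm_num, Real.sqrt_sq zero_le_two] at this

/-- `f = O((1 + s²)^(-p/2))`, uniformly on the whole line. -/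
def HasDecay (f : ℝ → ℝ) (p : ℝ) : Prop := ∃ C, 0 ≤ C ∧ ∀ s, |f s| ≤ C * wt s ^ p

namespace HasDecay

variable {f g : ℝ → ℝ} {p q : ℝ}

lemma of_le {C : ℝ} (h : ∀ s, |f s| ≤ C * wt s ^ p) : HasDecay f p := by
  refine ⟨|C|, abs_nonneg _, fun s => (h s).trans ?_⟩
  have := Real.rpow_nonneg (wt_pos s).le p
  gcongr
  exact le_abs_self C

lemma mul (hf : HasDecay f p) (hg : HasDecay g q) : HasDecay (fun s => f s * g s) (p + q) := by
  obtain ⟨C, hC, hf⟩ := hf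
  obtain ⟨C', hC', hg⟩ := hg
  refine ⟨C * C', by positivity, fun s => ?_⟩
  have := Real.rpow_nonneg (wt_pos s).le p
  rw [abs_mul, Real.rpow_add (wt_pos s)]
  calc |f s| * |g s| ≤ (C * wt s ^ p) * (C' * wt s ^ q) := by
        gcongr
        · exact hf s
        · exact hg s
    _ = _ := by ring

lemma mono (hf : HasDecay f p) (hqp : q ≤ p) : HasDecay f q := by
  obtain ⟨C, hC, hf⟩ := hf
  exact ⟨C, hC, fun s => (hf s).trans (mul_le_mul_of_nonneg_left
    (Real.rpow_le_rpow_of_exponent_ge (wt_pos s) (wt_le_one s) hqp) hC)⟩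

lemma add (hf : HasDecay f p) (hg : HasDecay g p) : HasDecay (fun s => f s + g s) p := by
  obtain ⟨C, hC, hf⟩ := hf
  obtain ⟨C', hC', hg⟩ := hg
  refine ⟨C + C', by positivity, fun s => (abs_add_le _ _).trans ?_⟩
  rw [add_mul]
  exact add_le_add (hf s) (hg s)

lemma neg (hf : HasDecay f p) : HasDecay (fun s => -f s) p := by
  obtain ⟨C, hC, hf⟩ := hf
  exact ⟨C, hC, fun s => by rw [abs_neg]; exact hf s⟩

lemma sub (hf : HasDecay f p) (hg : HasDecay g p) : HasDecay (fun s => f s - g s) p := by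
  simpa only [sub_eq_add_neg] using hf.add hg.neg

lemma const_mul (c : ℝ) (hf : HasDecay f p) : HasDecay (fun s => c * f s) p := by
  obtain ⟨C, hC, hf⟩ := hf
  refine ⟨|c| * C, by positivity, fun s => ?_⟩
  rw [abs_mul, mul_assoc]
  gcongr
  exact hf s

lemma of_bdd {C : ℝ} (h : ∀ s, |f s| ≤ C) : HasDecay f 0 := of_le (C := C) (by simpa using h)

lemma summable_wt_int (hp : 1 < p) : Summable fun n : ℤ => wt n ^ p := by
  refine (Real.summable_abs_int_rpow hp).of_norm_bounded_eventually ?_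
  filter_upwards [Filter.eventually_cofinite_ne (0 : ℤ)] with n hn
  have hn' : 0 < |(n : ℝ)| := abs_pos.2 (by exact_mod_cast hn)
  rw [Real.norm_of_nonneg (Real.rpow_nonneg (wt_pos _).le _), Real.rpow_neg hn'.le,
    ← Real.inv_rpow hn'.le]
  refine Real.rpow_le_rpow (wt_pos _).le ?_ (by linarith)
  rw [wt]
  gcongr
  rw [← Real.sqrt_sq_eq_abs]
  apply Real.sqrt_le_sqrt
  linarith

/-- On bounded sets, the translates of a function of decay better than `1/s` are dominated by a
summable family. -/
lemma exists_summable_bound (hf : HasDecay f p) (hp : 1 < p) (R : ℝ) :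
    ∃ u : ℤ → ℝ, Summable u ∧ (∀ n, 0 ≤ u n) ∧ ∀ (n : ℤ) y, |y| ≤ R → |f (y + n)| ≤ u n := by
  obtain ⟨C, hC, h⟩ := hf
  set D := √(2 * (1 + R ^ 2))
  refine ⟨fun n => C * D ^ p * wt n ^ p, (summable_wt_int hp).mul_left _, fun n => ?_,
    fun n y hy => (h _).trans ?_⟩
  · have := Real.rpow_nonneg (wt_pos n).le p
    positivity
  · simp only
    rw [mul_assoc, ← Real.mul_rpow (by positivity) (wt_pos _).le]
    have := wt_pos (y + n)
    gcongr
    exact wt_le_mul_wt (by simpa using hy)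

lemma summable_shift (hf : HasDecay f p) (hp : 1 < p) (y : ℝ) :
    Summable fun n : ℤ => |f (y + n)| := by
  obtain ⟨u, hu, -, h⟩ := hf.exists_summable_bound hp |y|
  exact Summable.of_nonneg_of_le (fun _ => abs_nonneg _) (fun n => h n y le_rfl) hu

lemma summable_shift_mul (hf : HasDecay f p) (hp : 1 < p) (y : ℝ) {e : ℤ → ℝ} {B : ℝ}
    (he : ∀ n, |e n| ≤ B) : Summable fun n : ℤ => f (y + n) * e n := by
  refine Summable.of_norm_bounded ((hf.summable_shift hp y).mul_right B) fun n => ?_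
  rw [norm_mul]
  gcongr
  · exact le_refl _
  · exact he n

end HasDecay

lemma tsum_shift_add_int (f : ℝ → ℝ) (y : ℝ) (k : ℤ) :
    ∑' n : ℤ, f (y + k + n) = ∑' n : ℤ, f (y + n) := by
  rw [← (Equiv.addLeft k).tsum_eq (fun n : ℤ => f (y + n))]
  simp [add_assoc]

/-- The sums of a decaying function along the translates of `ℤ` are bounded. -/
lemma HasDecay.exists_tsum_bound {f : ℝ → ℝ} {p : ℝ} (hf : HasDecay f p) (hp : 1 < p) :
    ∃ C, 0 ≤ C ∧ ∀ y, ∑' n : ℤ, |f (y + n)| ≤ C := by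
  obtain ⟨u, hu, hu0, h⟩ := hf.exists_summable_bound hp 1
  refine ⟨∑' n, u n, tsum_nonneg hu0, fun y => ?_⟩
  have h1 := tsum_shift_add_int (fun s => |f s|) (Int.fract y) ⌊y⌋
  rw [Int.fract_add_floor] at h1
  rw [h1]
  refine (hf.summable_shift hp _).tsum_le_tsum (fun n => h n _ ?_) hu
  rw [abs_of_nonneg (Int.fract_nonneg y)]
  exact (Int.fract_lt_one y).le

lemma hasDerivAt_tsum_shift {f f' : ℝ → ℝ} {p B : ℝ} (hf : ∀ s, HasDerivAt f (f' s) s)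
    (hd : HasDecay f' p) (hp : 1 < p) {e : ℤ → ℝ} (he : ∀ n, |e n| ≤ B)
    (hs : Summable fun n : ℤ => f (0 + n) * e n) (y : ℝ) :
    HasDerivAt (fun y => ∑' n : ℤ, f (y + n) * e n) (∑' n : ℤ, f' (y + n) * e n) y := by
  obtain ⟨u, hu, hu0, h⟩ := hd.exists_summable_bound hp (|y| + 1)
  have hB : 0 ≤ B := (abs_nonneg _).trans (he 0)
  have hder (n : ℤ) (z : ℝ) : HasDerivAt (fun y => f (y + n) * e n) (f' (z + n) * e n) z :=
    (HasDerivAt.comp_add_const z n (hf (z + n))).mul_const (e n)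
  have hbd (n : ℤ) (z : ℝ) (hz : z ∈ Ioo (-(|y| + 1)) (|y| + 1)) :
      ‖f' (z + n) * e n‖ ≤ u n * B := by
    rw [norm_mul]
    exact mul_le_mul (h n z (abs_le.2 ⟨hz.1.le, hz.2.le⟩)) (he n) (norm_nonneg _) (hu0 n)
  have h0 : (0 : ℝ) ∈ Ioo (-(|y| + 1)) (|y| + 1) :=
    ⟨by linarith [abs_nonneg y], by linarith [abs_nonneg y]⟩
  have hy : y ∈ Ioo (-(|y| + 1)) (|y| + 1) :=
    ⟨by linarith [neg_abs_le y], by linarith [le_abs_self y]⟩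
  exact hasDerivAt_tsum_of_isPreconnected (g := fun (n : ℤ) y => f (y + n) * e n)
    (g' := fun (n : ℤ) y => f' (y + n) * e n) (hu.mul_right B) isOpen_Ioo isPreconnected_Ioo
    (fun n z _ => hder n z) hbd h0 hs hy

/-! ### The lengths of the gaps -/

/-- A primitive of `1 / (√(1 + s²) (1 + arsinh² s))`. It is bounded, and its derivative decays
barely fast enough to be integrable. -/
def gapPrim (s : ℝ) : ℝ := Real.arctan (Real.arsinh s)

/-- The factor `1 / (1 + arsinh² s)`. -/
def slow (s : ℝ) : ℝ := (1 + Real.arsinh s ^ 2)⁻¹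

/-- The derivatives of `gapPrim`, up to the fourth. Each is `wt ^ i` times a polynomial in the
bounded functions `s * wt s`, `arsinh s * slow s` and `slow s`. -/
def gapPrimD : ℕ → ℝ → ℝ
  | 0, s => gapPrim s
  | 1, s => wt s * slow s
  | 2, s => wt s ^ 2 * (-slow s * (s * wt s + 2 * (Real.arsinh s * slow s)))
  | 3, s => wt s ^ 3 * (slow s * (3 * (s * wt s) ^ 2 + 6 * (s * wt s) * (Real.arsinh s * slow s) +
      8 * (Real.arsinh s * slow s) ^ 2 - 1 - 2 * slow s))
  | _, s => wt s ^ 4 * (-3 * (s * wt s) * (slow s * (3 * (s * wt s) ^ 2 +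
      6 * (s * wt s) * (Real.arsinh s * slow s) +
      8 * (Real.arsinh s * slow s) ^ 2 - 1 - 2 * slow s)) -
      2 * (Real.arsinh s * slow s) * slow s * (3 * (s * wt s) ^ 2 +
      6 * (s * wt s) * (Real.arsinh s * slow s) +
      8 * (Real.arsinh s * slow s) ^ 2 - 1 - 2 * slow s) +
      slow s * (6 * (s * wt s) * (1 - (s * wt s) ^ 2) +
        6 * (1 - (s * wt s) ^ 2) * (Real.arsinh s * slow s) +
        6 * (s * wt s) * (slow s - 2 * (Real.arsinh s * slow s) ^ 2) +
        16 * (Real.arsinh s * slow s) * (slow s - 2 * (Real.arsinh s * slow s) ^ 2) +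
        4 * (Real.arsinh s * slow s) * slow s))

lemma slow_pos (s : ℝ) : 0 < slow s := by unfold slow; positivity

lemma slow_le_one (s : ℝ) : slow s ≤ 1 :=
  inv_le_one_of_one_le₀ (by nlinarith [sq_nonneg (Real.arsinh s)])

lemma abs_arsinh_mul_slow_le (s : ℝ) : |Real.arsinh s * slow s| ≤ 1 := by
  rw [abs_mul, abs_of_pos (slow_pos s), slow, ← div_eq_mul_inv, div_le_one (by positivity)]
  rw [← sq_abs]
  nlinarith [sq_nonneg (|Real.arsinh s| - 1), abs_nonneg (Real.arsinh s)]

lemma hasDerivAt_arsinh' (s : ℝ) : HasDerivAt Real.arsinh (wt s) s := Real.hasDerivAt_arsinh s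

lemma hasDerivAt_wt (s : ℝ) : HasDerivAt wt (-(s * wt s) * wt s ^ 2) s := by
  have h1 : HasDerivAt (fun s : ℝ => 1 + s ^ 2) (2 * s) s := by
    simpa using (hasDerivAt_pow 2 s).const_add 1
  have h2 := (h1.sqrt (by positivity)).fun_inv (by positivity)
  refine h2.congr_deriv ?_
  have h3 : 0 < √(1 + s ^ 2) := by positivity
  rw [wt]
  field_simp

lemma hasDerivAt_mul_wt (s : ℝ) :
    HasDerivAt (fun s => s * wt s) (wt s * (1 - (s * wt s) ^ 2)) s := by
  refine ((hasDerivAt_id s).mul (hasDerivAt_wt s)).congr_deriv ?_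
  simp only [id]; ring

lemma hasDerivAt_slow (s : ℝ) :
    HasDerivAt slow (wt s * (-2 * (Real.arsinh s * slow s) * slow s)) s := by
  have h1 := ((hasDerivAt_arsinh' s).pow 2).const_add 1
  have h2 := h1.fun_inv (by simp only [Pi.pow_apply]; positivity)
  refine h2.congr_deriv ?_
  simp only [Pi.pow_apply, slow]
  have : 0 < 1 + Real.arsinh s ^ 2 := by positivity
  field_simp
  norm_num
  ring

lemma hasDerivAt_arsinh_mul_slow (s : ℝ) :
    HasDerivAt (fun s => Real.arsinh s * slow s)
      (wt s * (slow s - 2 * (Real.arsinh s * slow s) ^ 2)) s := by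
  refine ((hasDerivAt_arsinh' s).mul (hasDerivAt_slow s)).congr_deriv ?_
  ring

lemma hasDerivAt_gapPrimD {i : ℕ} (hi : i < 4) (s : ℝ) :
    HasDerivAt (gapPrimD i) (gapPrimD (i + 1) s) s := by
  have hJ := hasDerivAt_wt s
  have hX := hasDerivAt_mul_wt s
  have hT := hasDerivAt_slow s
  have hY := hasDerivAt_arsinh_mul_slow s
  interval_cases i
  · have := (hasDerivAt_arsinh' s).arctan
    refine this.congr_deriv ?_
    simp only [gapPrimD, slow]
    rw [one_div, mul_comm]
  · refine (hJ.mul hT).congr_deriv ?_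
    simp only [gapPrimD]
    ring
  · refine ((hJ.pow 2).mul (hT.neg.mul (hX.add (hY.const_mul 2)))).congr_deriv ?_
    simp only [gapPrimD, Pi.pow_apply, Pi.neg_apply, Pi.add_apply, Pi.mul_apply]
    ring
  · refine ((hJ.pow 3).mul (hT.mul (((((hX.pow 2).const_mul 3).add
      ((hX.const_mul 6).mul hY)).add ((hY.pow 2).const_mul 8)).sub_const 1 |>.sub
      (hT.const_mul 2)))).congr_deriv ?_
    simp only [gapPrimD, Pi.pow_apply, Pi.add_apply, Pi.mul_apply, Pi.sub_apply]
    ring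

lemma exists_gapPrimD_bound {i : ℕ} (hi : i ≤ 4) (hi1 : 1 ≤ i) :
    ∃ C : ℝ, 0 ≤ C ∧ ∀ s, |gapPrimD i s| ≤ C * wt s ^ i := by
  have key (q : ℝ × ℝ × ℝ → ℝ) (hq : Continuous q) (i : ℕ) (f : ℝ → ℝ)
      (hf : ∀ s, f s = wt s ^ i * q (s * wt s, Real.arsinh s * slow s, slow s)) :
      ∃ C : ℝ, 0 ≤ C ∧ ∀ s, |f s| ≤ C * wt s ^ i := by
    obtain ⟨C, hC⟩ := (isCompact_Icc.prod (isCompact_Icc.prod isCompact_Icc) :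
      IsCompact (Icc (-1 : ℝ) 1 ×ˢ Icc (-1 : ℝ) 1 ×ˢ Icc (-1 : ℝ) 1)).exists_bound_of_continuousOn
      hq.continuousOn
    have hb (s : ℝ) : |q (s * wt s, Real.arsinh s * slow s, slow s)| ≤ C :=
      hC _ ⟨abs_le.1 (abs_mul_wt_le s), abs_le.1 (abs_arsinh_mul_slow_le s),
        by linarith [slow_pos s], slow_le_one s⟩
    refine ⟨C, (abs_nonneg _).trans (hb 0), fun s => ?_⟩
    have := wt_pos s
    rw [hf, abs_mul, abs_of_pos (by positivity), mul_comm]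
    gcongr
    exact hb s
  interval_cases i
  · exact key (fun v => v.2.2) (by fun_prop) 1 _ fun s => by simp [gapPrimD]
  · exact key (fun v => -v.2.2 * (v.1 + 2 * v.2.1)) (by fun_prop) 2 _ fun s => rfl
  · exact key (fun v => v.2.2 * (3 * v.1 ^ 2 + 6 * v.1 * v.2.1 + 8 * v.2.1 ^ 2 - 1 - 2 * v.2.2))
      (by fun_prop) 3 _ fun s => rfl
  · exact key (fun v => -3 * v.1 * (v.2.2 * (3 * v.1 ^ 2 + 6 * v.1 * v.2.1 +
      8 * v.2.1 ^ 2 - 1 - 2 * v.2.2)) - 2 * v.2.1 * v.2.2 * (3 * v.1 ^ 2 + 6 * v.1 * v.2.1 +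
      8 * v.2.1 ^ 2 - 1 - 2 * v.2.2) + v.2.2 * (6 * v.1 * (1 - v.1 ^ 2) +
        6 * (1 - v.1 ^ 2) * v.2.1 + 6 * v.1 * (v.2.2 - 2 * v.2.1 ^ 2) +
        16 * v.2.1 * (v.2.2 - 2 * v.2.1 ^ 2) + 4 * v.2.1 * v.2.2)) (by fun_prop) 4 _ fun s => rfl

/-- The length of the gap at time `s` (for `i = 0`), and its derivatives. Differences of the values
of `gapPrim` are used in order that the lengths of the gaps met by a horizontal circle have a
constant sum. -/
def gapD (i : ℕ) (s : ℝ) : ℝ := (1 / 8) * (gapPrimD i (s + 1) - gapPrimD i s)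

/-- The length of the gap at time `s`. -/
abbrev gap : ℝ → ℝ := gapD 0

lemma hasDerivAt_gapD {i : ℕ} (hi : i < 4) (s : ℝ) : HasDerivAt (gapD i) (gapD (i + 1) s) s :=
  (((hasDerivAt_gapPrimD hi (s + 1)).comp_add_const s 1).sub
    (hasDerivAt_gapPrimD hi s)).const_mul (1 / 8)

lemma exists_gapD_eq {i : ℕ} (hi : i < 4) (s : ℝ) :
    ∃ ξ, |ξ - s| ≤ 1 ∧ gapD i s = (1 / 8) * gapPrimD (i + 1) ξ := by
  obtain ⟨ξ, hξ, h⟩ := exists_hasDerivAt_eq_slope (gapPrimD i) (gapPrimD (i + 1))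
    (by linarith : s < s + 1)
    (HasDerivAt.continuousOn fun x _ => hasDerivAt_gapPrimD hi x)
    (fun x _ => hasDerivAt_gapPrimD hi x)
  refine ⟨ξ, by rw [abs_le]; constructor <;> linarith [hξ.1, hξ.2], ?_⟩
  rw [h, gapD]
  ring

lemma gapD_decay {i : ℕ} (hi : i < 4) : HasDecay (gapD i) (i + 1) := by
  obtain ⟨C, hC, h⟩ := exists_gapPrimD_bound (i := i + 1) hi (by omega)
  refine HasDecay.of_le (C := (1 / 8) * C * 2 ^ (i + 1)) fun s => ?_
  obtain ⟨ξ, hξ, e⟩ := exists_gapD_eq hi s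
  have h1 : wt ξ ≤ 2 * wt s := wt_le_two_mul_wt hξ
  have h2 := (wt_pos ξ).le
  rw [e, abs_mul, abs_of_pos (by norm_num : (0 : ℝ) < 1 / 8)]
  have e2 : wt s ^ ((i : ℝ) + 1) = wt s ^ (i + 1) := by
    rw [← Nat.cast_add_one, Real.rpow_natCast]
  rw [e2]
  calc (1 / 8) * |gapPrimD (i + 1) ξ| ≤ (1 / 8) * (C * (2 * wt s) ^ (i + 1)) := by
        gcongr; exact (h ξ).trans (by gcongr)
    _ = _ := by ring

lemma gap_pos (s : ℝ) : 0 < gap s := by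
  obtain ⟨ξ, -, e⟩ := exists_gapD_eq (i := 0) (by norm_num) s
  have h1 := wt_pos ξ
  have h2 := slow_pos ξ
  rw [gap, e]
  simp only [gapPrimD]
  positivity

lemma abs_arsinh_le (s : ℝ) {ε : ℝ} (hε : 0 < ε) : |Real.arsinh s| ≤ (2 / wt s) ^ ε / ε := by
  have key (s : ℝ) (hs : 0 ≤ s) : |Real.arsinh s| ≤ (2 / wt s) ^ ε / ε := by
    rw [abs_of_nonneg (Real.arsinh_nonneg_iff.2 hs), Real.arsinh]
    have h0 : s ≤ √(1 + s ^ 2) := Real.le_sqrt_of_sq_le (by linarith)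
    have h1 : 0 < √(1 + s ^ 2) := by positivity
    refine (Real.log_le_rpow_div (by positivity) hε).trans ?_
    gcongr
    rw [wt, div_inv_eq_mul]
    linarith
  rcases le_total 0 s with hs | hs
  · exact key s hs
  · have := key (-s) (by linarith)
    simpa [wt, Real.arsinh_neg] using this

/-- The gap lengths decay more slowly than any power of exponent above `1`. -/
lemma inv_gap_decay {ε : ℝ} (hε : 0 < ε) : HasDecay (fun s => (gap s)⁻¹) (-(1 + ε)) := by
  refine HasDecay.of_le (C := 8 * 2 ^ (1 + ε) * (1 + (2 ^ (ε / 2) / (ε / 2)) ^ 2)) fun s => ?_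
  obtain ⟨ξ, hξ, e⟩ := exists_gapD_eq (i := 0) (by norm_num) s
  rw [abs_of_pos (inv_pos.2 (gap_pos s)), gap, e]
  simp only [gapPrimD]
  have hJ := wt_pos ξ
  have hJs := wt_pos s
  have h1 : Real.arsinh ξ ^ 2 ≤ (2 ^ (ε / 2) / (ε / 2)) ^ 2 * wt ξ ^ (-ε) := by
    have h2 := abs_arsinh_le ξ (half_pos hε)
    rw [← sq_abs]
    calc |Real.arsinh ξ| ^ 2 ≤ ((2 / wt ξ) ^ (ε / 2) / (ε / 2)) ^ 2 := by gcongr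
      _ = (2 ^ (ε / 2) / (ε / 2)) ^ 2 * wt ξ ^ (-ε) := by
        rw [Real.div_rpow zero_le_two hJ.le, Real.rpow_neg hJ.le,
          show wt ξ ^ ε = (wt ξ ^ (ε / 2)) ^ 2 by
            rw [← Real.rpow_natCast, ← Real.rpow_mul hJ.le]; norm_num]
        have : 0 < wt ξ ^ (ε / 2) := Real.rpow_pos_of_pos hJ _
        field_simp
  have h3 : 1 ≤ wt ξ ^ (-ε) :=
    Real.one_le_rpow_of_pos_of_le_one_of_nonpos hJ (wt_le_one ξ) (by linarith)
  have h4 : 1 + Real.arsinh ξ ^ 2 ≤ (1 + (2 ^ (ε / 2) / (ε / 2)) ^ 2) * wt ξ ^ (-ε) := by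
    rw [add_mul, one_mul]; linarith
  have h5 : wt ξ ^ (-(1 + ε)) ≤ 2 ^ (1 + ε) * wt s ^ (-(1 + ε)) := by
    have h6 : wt s / 2 ≤ wt ξ := by
      have := wt_le_two_mul_wt (s := s) (r := ξ) (by rwa [abs_sub_comm])
      linarith
    calc wt ξ ^ (-(1 + ε)) ≤ (wt s / 2) ^ (-(1 + ε)) :=
          Real.rpow_le_rpow_of_nonpos (by positivity) h6 (by linarith)
      _ = _ := by
        rw [Real.div_rpow hJs.le zero_le_two, Real.rpow_neg zero_le_two, div_inv_eq_mul, mul_comm]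
  have h7 : (1 / 8 * (wt ξ * slow ξ))⁻¹ = 8 * (wt ξ)⁻¹ * (1 + Real.arsinh ξ ^ 2) := by
    rw [slow]; field_simp
  rw [h7]
  have h8 : (wt ξ)⁻¹ * wt ξ ^ (-ε) = wt ξ ^ (-(1 + ε)) := by
    rw [← Real.rpow_neg_one, ← Real.rpow_add hJ]; congr 1; ring
  calc 8 * (wt ξ)⁻¹ * (1 + Real.arsinh ξ ^ 2) ≤
        8 * (wt ξ)⁻¹ * ((1 + (2 ^ (ε / 2) / (ε / 2)) ^ 2) * wt ξ ^ (-ε)) := by gcongr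
    _ = 8 * (1 + (2 ^ (ε / 2) / (ε / 2)) ^ 2) * ((wt ξ)⁻¹ * wt ξ ^ (-ε)) := by ring
    _ ≤ 8 * (1 + (2 ^ (ε / 2) / (ε / 2)) ^ 2) * (2 ^ (1 + ε) * wt s ^ (-(1 + ε))) := by
      rw [h8]; gcongr
    _ = _ := by ring

lemma tendsto_gapPrim_atTop : Filter.Tendsto gapPrim Filter.atTop (𝓝 (Real.pi / 2)) := by
  have h1 : Filter.Tendsto Real.arsinh Filter.atTop Filter.atTop :=
    Real.arsinh_strictMono.monotone.tendsto_atTop_atTop fun b =>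
      ⟨Real.sinh b, (Real.arsinh_sinh b).ge⟩
  exact (Real.tendsto_arctan_atTop.mono_right nhdsWithin_le_nhds).comp h1

lemma gapPrim_neg (s : ℝ) : gapPrim (-s) = -gapPrim s := by
  simp [gapPrim, Real.arsinh_neg, Real.arctan_neg]

/-- The lengths of the gaps met by a horizontal circle add up to `π / 8`. -/
lemma hasSum_gap (y : ℝ) : HasSum (fun n : ℤ => gap (y + n)) (Real.pi / 8) := by
  have h1 : HasSum (fun n : ℕ => gap (y + n)) (1 / 8 * (Real.pi / 2 - gapPrim y)) := by
    rw [hasSum_iff_tendsto_nat_of_nonneg fun n => (gap_pos _).le]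
    have e (N : ℕ) : ∑ n ∈ Finset.range N, gap (y + n) =
        1 / 8 * (gapPrim (y + N) - gapPrim y) := by
      have := Finset.sum_range_sub (fun n : ℕ => gapPrim (y + n)) N
      simp only [Nat.cast_add, Nat.cast_one, Nat.cast_zero, add_zero] at this
      rw [← this, Finset.mul_sum]
      refine Finset.sum_congr rfl fun n _ => ?_
      simp only [gapD, gapPrimD, add_assoc]
    simp_rw [e]
    refine Filter.Tendsto.const_mul _ (Filter.Tendsto.sub_const ?_ _)
    exact tendsto_gapPrim_atTop.comp
      (Filter.tendsto_atTop_add_const_left _ _ tendsto_natCast_atTop_atTop)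
  have h2 : HasSum (fun n : ℕ => gap (y + (-(n + 1 : ℤ) : ℤ)))
      (1 / 8 * (gapPrim y + Real.pi / 2)) := by
    rw [hasSum_iff_tendsto_nat_of_nonneg fun n => (gap_pos _).le]
    have e (N : ℕ) : ∑ n ∈ Finset.range N, gap (y + (-(n + 1 : ℤ) : ℤ)) =
        1 / 8 * (gapPrim y + gapPrim (N - y)) := by
      have := Finset.sum_range_sub (fun n : ℕ => gapPrim (n - y)) N
      simp only [Nat.cast_add, Nat.cast_one, Nat.cast_zero, zero_sub, gapPrim_neg,
        sub_neg_eq_add] at this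
      rw [add_comm (gapPrim y), ← this, Finset.mul_sum]
      refine Finset.sum_congr rfl fun n _ => ?_
      simp only [gapD, gapPrimD]
      have e1 : y + ((-(n + 1 : ℤ) : ℤ) : ℝ) + 1 = -((n : ℝ) - y) := by push_cast; ring
      have e2 : y + ((-(n + 1 : ℤ) : ℤ) : ℝ) = -((n : ℝ) + 1 - y) := by push_cast; ring
      rw [e1, e2, gapPrim_neg, gapPrim_neg]
      ring
    simp_rw [e]
    refine Filter.Tendsto.const_mul _ (Filter.Tendsto.const_add _ ?_)
    exact tendsto_gapPrim_atTop.comp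
      (Filter.tendsto_atTop_add_const_right _ _ tendsto_natCast_atTop_atTop)
  have h3 : HasSum (fun n : ℤ => gap (y + n)) _ := HasSum.of_nat_of_neg_add_one
    (f := fun n : ℤ => gap (y + n)) (by simpa using h1) (by exact_mod_cast h2)
  convert! h3 using 1
  ring

lemma gap_lt_half (s : ℝ) : gap s < 1 / 2 := by
  have h := (hasSum_gap s)
  have h1 := h.summable.le_tsum 0 fun n _ => (gap_pos _).le
  rw [h.tsum_eq] at h1
  simp only [Int.cast_zero, add_zero] at h1
  linarith [Real.pi_lt_four]

lemma summable_gap_mul (y : ℝ) {e : ℤ → ℝ} {B : ℝ} (he : ∀ n, |e n| ≤ B) :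
    Summable fun n : ℤ => gap (y + n) * e n := by
  refine Summable.of_norm_bounded ((hasSum_gap y).summable.mul_right B) fun n => ?_
  rw [norm_mul, Real.norm_of_nonneg (gap_pos _).le]
  have := gap_pos (y + n)
  gcongr
  exact he n

lemma tsum_gapD_one (y : ℝ) : ∑' n : ℤ, gapD 1 (y + n) = 0 := by
  have h := hasDerivAt_tsum_shift (hasDerivAt_gapD (i := 0) (by norm_num)) (gapD_decay (i := 1)
    (by norm_num)) (by norm_num) (e := fun _ => 1) (B := 1) (by simp)
    (summable_gap_mul 0 (B := 1) (by simp)) y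
  simp only [mul_one, (hasSum_gap _).tsum_eq] at h
  exact h.unique (hasDerivAt_const y _) |>.symm ▸ rfl

/-! ### Blowing up an orbit of a rotation -/

/-- The rotation number of the Denjoy flow. -/
def rot : ℝ := √2

lemma irrational_rot : Irrational rot := irrational_sqrt_two

lemma rot_mul_int_add_ne {n k : ℤ} (hn : n ≠ 0) : rot * n + k ≠ 0 := by
  have := ((irrational_rot.mul_intCast hn).add_intCast k).ne_zero
  simpa using this

/-- A choice, made equivariantly under `ℤ`, of an integer `fl z` for which `z - fl z ∈ [0, 1]`; it
differs from the integer part only in that an integer may be sent to its predecessor. -/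
structure IsCut (fl : ℝ → ℤ) : Prop where
  le_floor : ∀ z, fl z ≤ ⌊z⌋
  le_cut : ∀ z, ⌈z⌉ - 1 ≤ fl z
  add_int : ∀ z (k : ℤ), fl (z + k) = fl z + k

/-- The largest integer strictly below `z`. -/
def lowerCut (z : ℝ) : ℤ := ⌈z⌉ - 1

lemma isCut_floor : IsCut Int.floor where
  le_floor _ := le_rfl
  le_cut z := by have := Int.ceil_le_floor_add_one z; omega
  add_int z k := Int.floor_add_intCast z k

lemma isCut_lowerCut : IsCut lowerCut where
  le_floor z := by have := Int.ceil_le_floor_add_one z; unfold lowerCut; omega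
  le_cut _ := le_rfl
  add_int z k := by simp only [lowerCut, Int.ceil_add_intCast]; ring

/-- The position on the horizontal circle at height `y` of the point with angle `θ` of the rotation
flow, after the orbit of the origin has been blown up: the gap which `gap` attributes to the time
`s = y + n` sits at the angle `rot * s`. The cut `fl` decides between the two ends of a gap. -/
def pos (fl : ℝ → ℤ) (θ y : ℝ) : ℝ :=
  θ - ∑' n : ℤ, gap (y + n) * ((θ - rot * (y + n)) - fl (θ - rot * (y + n)))

section Pos

variable {fl fl' : ℝ → ℤ}

lemma IsCut.abs_sub_le (h : IsCut fl) (z : ℝ) : |z - fl z| ≤ 1 := by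
  have h1 : (fl z : ℝ) ≤ z := (by exact_mod_cast h.le_floor z : (fl z : ℝ) ≤ ⌊z⌋).trans
    (Int.floor_le z)
  have h2 : (⌈z⌉ : ℝ) - 1 ≤ fl z := by exact_mod_cast h.le_cut z
  rw [abs_le]
  constructor <;> linarith [Int.le_ceil z]

lemma IsCut.le_of_lt (h : IsCut fl) (h' : IsCut fl') {z z' : ℝ} (hz : z < z') :
    fl z ≤ fl' z' := by
  refine (h.le_floor z).trans (le_trans ?_ (h'.le_cut z'))
  have : ⌊z⌋ < ⌈z'⌉ := by
    rw [Int.lt_ceil]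
    exact (Int.floor_le z).trans_lt hz
  omega

lemma IsCut.summable (h : IsCut fl) (θ y : ℝ) : Summable fun n : ℤ =>
    gap (y + n) * ((θ - rot * (y + n)) - fl (θ - rot * (y + n))) :=
  summable_gap_mul y fun _ => h.abs_sub_le _

lemma IsCut.pos_add_int (h : IsCut fl) (θ y : ℝ) (k : ℤ) : pos fl (θ + k) y = pos fl θ y + k := by
  have (n : ℤ) : (θ + k - rot * (y + n)) - fl (θ + k - rot * (y + n)) =
      (θ - rot * (y + n)) - fl (θ - rot * (y + n)) := by
    rw [show θ + k - rot * (y + n) = θ - rot * (y + n) + k by ring, h.add_int]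
    push_cast; ring
  simp only [pos, this]
  ring

lemma pos_add_int_right (fl : ℝ → ℤ) (θ y : ℝ) (k : ℤ) : pos fl θ (y + k) = pos fl θ y := by
  have := tsum_shift_add_int (fun s => gap s * ((θ - rot * s) - fl (θ - rot * s))) y k
  rw [pos, this, pos]

lemma IsCut.pos_sub_pos (h : IsCut fl) (h' : IsCut fl') (θ θ' y : ℝ) :
    pos fl' θ' y - pos fl θ y = (1 - Real.pi / 8) * (θ' - θ) + ∑' n : ℤ, gap (y + n) *
      ((fl' (θ' - rot * (y + n)) - fl (θ - rot * (y + n)) : ℤ) : ℝ) := by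
  have s1 := h.summable θ y
  have s2 := h'.summable θ' y
  have s3 := (hasSum_gap y).summable.mul_right (θ' - θ)
  have e1 : pos fl' θ' y - pos fl θ y = (θ' - θ) - ∑' n : ℤ,
      (gap (y + n) * ((θ' - rot * (y + n)) - fl' (θ' - rot * (y + n))) -
      gap (y + n) * ((θ - rot * (y + n)) - fl (θ - rot * (y + n)))) := by
    rw [s2.tsum_sub s1, pos, pos]; ring
  have e2 : ∑' n : ℤ, gap (y + n) * (θ' - θ) = Real.pi / 8 * (θ' - θ) := by
    rw [tsum_mul_right, (hasSum_gap y).tsum_eq]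
  have e3 : ∑' n : ℤ, gap (y + n) *
      ((fl' (θ' - rot * (y + n)) - fl (θ - rot * (y + n)) : ℤ) : ℝ) =
      ∑' n : ℤ, gap (y + n) * (θ' - θ) - ∑' n : ℤ,
      (gap (y + n) * ((θ' - rot * (y + n)) - fl' (θ' - rot * (y + n))) -
      gap (y + n) * ((θ - rot * (y + n)) - fl (θ - rot * (y + n)))) := by
    rw [← s3.tsum_sub (s2.sub s1)]
    refine tsum_congr fun n => ?_
    push_cast; ring
  rw [e1, e3, e2]; ring

lemma IsCut.pos_lt_pos (h : IsCut fl) (h' : IsCut fl') {θ θ' : ℝ} (hθ : θ < θ') (y : ℝ) :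
    pos fl θ y < pos fl' θ' y := by
  rw [← sub_pos, h.pos_sub_pos h']
  have h1 : 0 < (1 - Real.pi / 8) * (θ' - θ) := by
    have := Real.pi_lt_four
    exact mul_pos (by linarith) (by linarith)
  refine add_pos_of_pos_of_nonneg h1 (tsum_nonneg fun n => mul_nonneg (gap_pos _).le ?_)
  have := h.le_of_lt h' (z := θ - rot * (y + n)) (z' := θ' - rot * (y + n)) (by linarith)
  exact_mod_cast sub_nonneg.2 this

lemma IsCut.abs_pos_sub_le (h : IsCut fl) (θ y : ℝ) : |pos fl θ y - θ| ≤ 1 := by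
  have h1 : pos fl θ y - θ = -∑' n : ℤ, gap (y + n) *
      ((θ - rot * (y + n)) - fl (θ - rot * (y + n))) := by rw [pos]; ring
  rw [h1, abs_neg]
  have h2 := norm_tsum_le_tsum_norm (h.summable θ y).norm
  refine h2.trans ((Summable.tsum_le_tsum (fun n => ?_) (h.summable θ y).norm
    (hasSum_gap y).summable).trans ?_)
  · rw [norm_mul, Real.norm_of_nonneg (gap_pos _).le]
    exact mul_le_of_le_one_right (gap_pos _).le (h.abs_sub_le _)
  · rw [(hasSum_gap y).tsum_eq]
    linarith [Real.pi_lt_four]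

/-- The position, along a trajectory of the flow. -/
lemma pos_trajectory (fl : ℝ → ℤ) (θ s : ℝ) : pos fl (θ + rot * s) s = θ + rot * s -
    ∑' n : ℤ, gap (s + n) * ((θ - rot * n) - fl (θ - rot * n)) := by
  rw [pos]
  have (n : ℤ) : θ + rot * s - rot * (s + n) = θ - rot * n := by ring
  simp only [this]

lemma IsCut.hasDerivAt_pos (h : IsCut fl) (θ s : ℝ) :
    HasDerivAt (fun s => pos fl (θ + rot * s) s)
      (rot - ∑' n : ℤ, gapD 1 (s + n) * ((θ - rot * n) - fl (θ - rot * n))) s := by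
  simp only [pos_trajectory]
  have h1 : HasDerivAt (fun s => θ + rot * s) rot s := by
    simpa using ((hasDerivAt_id s).const_mul rot).const_add θ
  exact h1.sub (hasDerivAt_tsum_shift (hasDerivAt_gapD (i := 0) (by norm_num))
    (gapD_decay (i := 1) (by norm_num)) (by norm_num) (B := 1) (fun n => h.abs_sub_le _)
    (summable_gap_mul 0 fun n => h.abs_sub_le _) s)

end Pos

/-! ### The edges of the gaps -/

/-- The weight of the `n`-th gap in the position of the left edge of the gap `0`. -/
def edgeWt (n : ℤ) : ℝ := (0 - rot * n) - lowerCut (0 - rot * n)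

lemma abs_edgeWt_le (n : ℤ) : |edgeWt n| ≤ 1 := isCut_lowerCut.abs_sub_le _

/-- The left edge of the gap at time `s`. -/
def edge (s : ℝ) : ℝ := pos lowerCut (rot * s) s

/-- The velocity of the left edge of the gap at time `s`. -/
def edgeD (s : ℝ) : ℝ := rot - ∑' n : ℤ, gapD 1 (s + n) * edgeWt n

/-- The acceleration of the left edge of the gap at time `s`. -/
def edgeD2 (s : ℝ) : ℝ := -∑' n : ℤ, gapD 2 (s + n) * edgeWt n

lemma hasDerivAt_edge (s : ℝ) : HasDerivAt edge (edgeD s) s := by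
  have := isCut_lowerCut.hasDerivAt_pos 0 s
  simp only [zero_add] at this
  exact this

lemma hasDerivAt_edgeD (s : ℝ) : HasDerivAt edgeD (edgeD2 s) s :=
  (hasDerivAt_tsum_shift (hasDerivAt_gapD (i := 1) (by norm_num))
    (gapD_decay (i := 2) (by norm_num)) (by norm_num) (B := 1) abs_edgeWt_le
    ((gapD_decay (i := 1) (by norm_num)).summable_shift_mul (by norm_num) 0
      abs_edgeWt_le) s).const_sub rot

lemma continuous_edgeD2 : Continuous edgeD2 := by
  refine Continuous.neg (continuous_iff_continuousAt.2 fun s => ?_)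
  exact (hasDerivAt_tsum_shift (hasDerivAt_gapD (i := 2) (by norm_num))
    (gapD_decay (i := 3) (by norm_num)) (by norm_num) (B := 1) abs_edgeWt_le
    ((gapD_decay (i := 2) (by norm_num)).summable_shift_mul (by norm_num) 0
      abs_edgeWt_le) s).continuousAt

lemma exists_tsum_mul_bound {f : ℝ → ℝ} {p : ℝ} (hf : HasDecay f p) (hp : 1 < p) {e : ℤ → ℝ}
    (he : ∀ n, |e n| ≤ 1) : ∃ C, ∀ y, |∑' n : ℤ, f (y + n) * e n| ≤ C := by
  obtain ⟨C, -, hC⟩ := hf.exists_tsum_bound hp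
  refine ⟨C, fun y => le_trans ?_ (hC y)⟩
  have h1 := (hf.summable_shift_mul hp y he).norm
  refine (norm_tsum_le_tsum_norm h1).trans (h1.tsum_le_tsum (fun n => ?_)
    (hf.summable_shift hp y))
  rw [norm_mul]
  exact mul_le_of_le_one_right (abs_nonneg _) (he n)

lemma edgeD_decay : HasDecay edgeD 0 := by
  obtain ⟨C, hC⟩ := exists_tsum_mul_bound (gapD_decay (i := 1) (by norm_num)) (by norm_num)
    abs_edgeWt_le
  exact HasDecay.of_bdd (C := |rot| + C) fun s => (abs_sub _ _).trans (by gcongr; exact hC s)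

lemma edgeD2_decay : HasDecay edgeD2 0 := by
  obtain ⟨C, hC⟩ := exists_tsum_mul_bound (gapD_decay (i := 2) (by norm_num)) (by norm_num)
    abs_edgeWt_le
  exact HasDecay.of_bdd (C := C) fun s => by rw [edgeD2, abs_neg]; exact hC s

lemma abs_edge_sub_le (s : ℝ) : |edge s - rot * s| ≤ 1 := isCut_lowerCut.abs_pos_sub_le _ _

/-- The right edge of a gap. -/
lemma edge_add_gap (s : ℝ) : edge s + gap s = pos Int.floor (rot * s) s := by
  have h := isCut_lowerCut.pos_sub_pos isCut_floor (rot * s) (rot * s) s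
  rw [sub_self, mul_zero, zero_add, tsum_eq_single 0] at h
  · have e : rot * s - rot * (s + ((0 : ℤ) : ℝ)) = 0 := by simp
    rw [e] at h
    simp only [lowerCut, Int.ceil_zero, Int.floor_zero] at h
    rw [edge]
    norm_num at h
    linarith
  · intro n hn
    have e : rot * s - rot * (s + n) = -(rot * n) := by ring
    rw [e]
    have : ⌈-(rot * n)⌉ = ⌊-(rot * n)⌋ + 1 := by
      refine le_antisymm (Int.ceil_le_floor_add_one _) ?_
      refine Int.add_one_le_iff.2 (Int.lt_ceil.2 ?_)
      refine lt_of_le_of_ne (Int.floor_le _) fun h => ?_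
      exact rot_mul_int_add_ne hn (k := ⌊-(rot * n)⌋) (by rw [h]; ring)
    simp [lowerCut, this]

lemma edge_eq_pos (y : ℝ) (n k : ℤ) :
    edge (y + n) + k = pos lowerCut (rot * (y + n) + k) y := by
  rw [isCut_lowerCut.pos_add_int, ← pos_add_int_right lowerCut _ y n, edge]

lemma edge_add_gap_eq_pos (y : ℝ) (n k : ℤ) :
    edge (y + n) + gap (y + n) + k = pos Int.floor (rot * (y + n) + k) y := by
  rw [isCut_floor.pos_add_int, ← pos_add_int_right Int.floor _ y n, edge_add_gap]

/-- The point `p` of the plane lies in the lift with index `k` of the gap of index `n`. -/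
def InGap (n k : ℤ) (p : ℝ × ℝ) : Prop :=
  edge (p.2 + n) + k < p.1 ∧ p.1 < edge (p.2 + n) + gap (p.2 + n) + k

/-- Distinct gaps are disjoint. -/
lemma InGap.index_unique {n k n' k' : ℤ} {p : ℝ × ℝ} (h : InGap n k p) (h' : InGap n' k' p) :
    n = n' := by
  have key {n k n' k' : ℤ} (h : InGap n k p) (h' : InGap n' k' p)
      (hlt : rot * (p.2 + n) + k < rot * (p.2 + n') + k') : False := by
    have h1 := isCut_floor.pos_lt_pos isCut_lowerCut hlt p.2
    rw [← edge_add_gap_eq_pos, ← edge_eq_pos] at h1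
    linarith [h.2, h'.1]
  by_contra hne
  rcases lt_trichotomy (rot * (p.2 + n) + k) (rot * (p.2 + n') + k') with hlt | heq | hlt
  · exact key h h' hlt
  · refine rot_mul_int_add_ne (sub_ne_zero.2 hne) (k := k - k') ?_
    push_cast
    linarith
  · exact key h' h hlt

/-! ### Sums of staircases along the gaps -/

/-- `ζ` rises from `0` to `c` between `1/4` and `3/4`, and is constant elsewhere. -/
structure IsStep (c : ℝ) (ζ : ℝ → ℝ) : Prop where
  lo : ∀ v < 1 / 4, ζ v = 0
  hi : ∀ v, 3 / 4 < v → ζ v = c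

namespace IsStep

variable {c : ℝ} {ζ : ℝ → ℝ}

lemma deriv (h : IsStep c ζ) : IsStep 0 (deriv ζ) where
  lo v hv := by
    have : ζ =ᶠ[𝓝 v] fun _ => 0 := by
      filter_upwards [Iio_mem_nhds hv] with w hw using h.lo w hw
    rw [this.deriv_eq, deriv_const]
  hi v hv := by
    have : ζ =ᶠ[𝓝 v] fun _ => c := by
      filter_upwards [Ioi_mem_nhds hv] with w hw using h.hi w hw
    rw [this.deriv_eq, deriv_const]

lemma id_mul (h : IsStep 0 ζ) : IsStep 0 (fun v => v * ζ v) where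
  lo v hv := by rw [h.lo v hv, mul_zero]
  hi v hv := by rw [h.hi v hv, mul_zero]

lemma sq (h : IsStep 0 ζ) : IsStep 0 (fun v => ζ v ^ 2) where
  lo v hv := by rw [h.lo v hv]; norm_num
  hi v hv := by rw [h.hi v hv]; norm_num

lemma exists_bound (h : IsStep c ζ) (hc : Continuous ζ) : ∃ Z, 0 ≤ Z ∧ ∀ v, |ζ v| ≤ Z := by
  obtain ⟨Z, hZ⟩ := (isCompact_Icc (a := (1 / 4 : ℝ)) (b := 3 / 4)).exists_bound_of_continuousOn
    hc.continuousOn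
  refine ⟨max |c| Z, (abs_nonneg c).trans (le_max_left _ _), fun v => ?_⟩
  rcases lt_or_ge v (1 / 4) with h1 | h1
  · rw [h.lo v h1, abs_zero]
    exact (abs_nonneg c).trans (le_max_left _ _)
  rcases lt_or_ge (3 / 4) v with h2 | h2
  · rw [h.hi v h2]
    exact le_max_left _ _
  · exact (hZ v ⟨h1, h2⟩).trans (le_max_right _ _)

end IsStep

/-- The staircase, as a function of `x`, whose steps have height `c` and the shape `ζ`, and lie over
the gap at time `s` and its translates. -/
def stair (c : ℝ) (ζ : ℝ → ℝ) (x s : ℝ) : ℝ :=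
  c * ⌊x - edge s⌋ + ζ (Int.fract (x - edge s) / gap s)

lemma stair_zero (β : ℝ → ℝ) (x s : ℝ) : stair 0 β x s = β (Int.fract (x - edge s) / gap s) := by
  simp [stair]

lemma stair_add_int (c : ℝ) (ζ : ℝ → ℝ) (x s : ℝ) (k : ℤ) :
    stair c ζ (x + k) s = stair c ζ x s + c * k := by
  rw [stair, stair, show x + k - edge s = x - edge s + k by ring, Int.floor_add_intCast,
    Int.fract_add_intCast]
  push_cast; ring

section Stair

variable {c : ℝ} {ζ : ℝ → ℝ}

/-- Near each of its points, a staircase has an expression which does not involve integer parts. -/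
lemma stair_eq (h : IsStep c ζ) {x s : ℝ} {j : ℤ} (h1 : j - 1 / 2 < x - edge s)
    (h2 : x - edge s < j + 1) : stair c ζ x s = c * j + ζ ((x - edge s - j) / gap s) := by
  have hg := gap_pos s
  rcases le_or_gt (j : ℝ) (x - edge s) with h3 | h3
  · have : ⌊x - edge s⌋ = j := Int.floor_eq_iff.2 ⟨h3, h2⟩
    rw [stair, Int.fract, this]
  · have : ⌊x - edge s⌋ = j - 1 := Int.floor_eq_iff.2 ⟨by push_cast; linarith, by push_cast; linarith⟩
    rw [stair, Int.fract, this, h.hi, h.lo]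
    · push_cast; ring
    · have : (x - edge s - j) / gap s < 0 := div_neg_of_neg_of_pos (by linarith) hg
      linarith
    · rw [lt_div_iff₀ hg]
      push_cast
      linarith [gap_lt_half s]

lemma continuous_edge : Continuous edge :=
  continuous_iff_continuousAt.2 fun s => (hasDerivAt_edge s).continuousAt

lemma continuous_gapD {i : ℕ} (hi : i < 4) : Continuous (gapD i) :=
  continuous_iff_continuousAt.2 fun s => (hasDerivAt_gapD hi s).continuousAt

lemma stair_eventuallyEq (h : IsStep c ζ) (p : ℝ × ℝ) :
    (fun q : ℝ × ℝ => stair c ζ q.1 q.2) =ᶠ[𝓝 p] fun q => c * ⌊p.1 - edge p.2⌋ +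
      ζ ((q.1 - edge q.2 - ⌊p.1 - edge p.2⌋) / gap q.2) := by
  have hcont : ContinuousAt (fun q : ℝ × ℝ => q.1 - edge q.2) p :=
    (continuous_fst.sub (continuous_edge.comp continuous_snd)).continuousAt
  have h1 := Int.floor_le (p.1 - edge p.2)
  have h2 := Int.lt_floor_add_one (p.1 - edge p.2)
  filter_upwards [hcont.eventually (lt_mem_nhds (a := (⌊p.1 - edge p.2⌋ : ℝ) - 1 / 2)
    (by linarith)), hcont.eventually (gt_mem_nhds h2)] with q hq1 hq2
  exact stair_eq h hq1 hq2

lemma continuous_stair (h : IsStep c ζ) (hζ : Continuous ζ) :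
    Continuous fun p : ℝ × ℝ => stair c ζ p.1 p.2 := by
  refine continuous_iff_continuousAt.2 fun p => ContinuousAt.congr ?_ (stair_eventuallyEq h p).symm
  have h1 : Continuous fun q : ℝ × ℝ => (q.1 - edge q.2 - ⌊p.1 - edge p.2⌋) / gap q.2 :=
    ((continuous_fst.sub (continuous_edge.comp continuous_snd)).sub continuous_const).div
      ((continuous_gapD (by norm_num)).comp continuous_snd) fun q => (gap_pos _).ne'
  exact ((hζ.comp h1).const_add _).continuousAt

lemma hasDerivAt_stair_fst (h : IsStep c ζ) (hζ : Differentiable ℝ ζ) (x s : ℝ) :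
    HasDerivAt (fun x => stair c ζ x s) ((gap s)⁻¹ * stair 0 (deriv ζ) x s) x := by
  have he := (stair_eventuallyEq h (x, s)).comp_tendsto
    ((continuous_id.prodMk continuous_const).tendsto' x (x, s) rfl : Filter.Tendsto
      (fun x : ℝ => (x, s)) (𝓝 x) (𝓝 (x, s)))
  refine HasDerivAt.congr_of_eventuallyEq ?_ he
  have h1 : HasDerivAt (fun x' => (x' - edge s - ⌊x - edge s⌋) / gap s) (1 / gap s) x :=
    (((hasDerivAt_id x).sub_const _).sub_const _).div_const _
  refine (((hζ _).hasDerivAt.comp x h1).const_add (c * ⌊x - edge s⌋)).congr_deriv ?_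
  rw [stair_zero, Int.fract]
  ring

lemma hasDerivAt_stair_snd (h : IsStep c ζ) (hζ : Differentiable ℝ ζ) (x s : ℝ) :
    HasDerivAt (fun s => stair c ζ x s) (-((gap s)⁻¹ * edgeD s * stair 0 (deriv ζ) x s) -
      (gap s)⁻¹ * gapD 1 s * stair 0 (fun v => v * deriv ζ v) x s) s := by
  have he := (stair_eventuallyEq h (x, s)).comp_tendsto
    ((continuous_const.prodMk continuous_id).tendsto' s (x, s) rfl : Filter.Tendsto
      (fun s : ℝ => (x, s)) (𝓝 s) (𝓝 (x, s)))
  refine HasDerivAt.congr_of_eventuallyEq ?_ he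
  have h1 : HasDerivAt (fun s' => (x - edge s' - ⌊x - edge s⌋) / gap s') _ s :=
    (((hasDerivAt_edge s).const_sub x).sub_const _).div (hasDerivAt_gapD (by norm_num) s)
      (gap_pos s).ne'
  refine (((hζ _).hasDerivAt.comp s h1).const_add (c * ⌊x - edge s⌋)).congr_deriv ?_
  simp only [stair_zero, Int.fract]
  have := (gap_pos s).ne'
  field_simp

/-- A step of height `0` vanishes outside the gaps. -/
lemma inGap_of_stair_ne_zero (h : IsStep 0 ζ) {n : ℤ} {p : ℝ × ℝ}
    (hne : stair 0 ζ p.1 (p.2 + n) ≠ 0) : InGap n ⌊p.1 - edge (p.2 + n)⌋ p := by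
  rw [stair_zero] at hne
  have hg := gap_pos (p.2 + n)
  have h1 : 1 / 4 ≤ Int.fract (p.1 - edge (p.2 + n)) / gap (p.2 + n) :=
    not_lt.1 fun h1 => hne (h.lo _ h1)
  have h2 : Int.fract (p.1 - edge (p.2 + n)) / gap (p.2 + n) ≤ 3 / 4 :=
    not_lt.1 fun h2 => hne (h.hi _ h2)
  rw [le_div_iff₀ hg] at h1
  rw [div_le_iff₀ hg] at h2
  have h3 := Int.floor_add_fract (p.1 - edge (p.2 + n))
  constructor <;> linarith

end Stair

/-! ### Series of functions on the plane -/

/-- The partial sums of the series converge uniformly on bounded sets. -/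
def UnifSum (f : ℤ → ℝ × ℝ → ℝ) : Prop :=
  ∀ R : ℝ, TendstoUniformlyOn (fun (F : Finset ℤ) p => ∑ n ∈ F, f n p) (fun p => ∑' n, f n p)
    Filter.atTop {p | |p.1| < R ∧ |p.2| < R}

namespace UnifSum

variable {f f' g : ℤ → ℝ × ℝ → ℝ}

lemma hasSum (hf : UnifSum f) (p : ℝ × ℝ) : HasSum (fun n => f n p) (∑' n, f n p) :=
  (hf (max |p.1| |p.2| + 1)).tendsto_at
    ⟨by linarith [le_max_left |p.1| |p.2|], by linarith [le_max_right |p.1| |p.2|]⟩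

lemma sub (hf : UnifSum f) (hg : UnifSum g) : UnifSum fun n p => f n p - g n p := fun R => by
  have h := (hf R).fun_sub (hg R)
  simp only [← Finset.sum_sub_distrib] at h
  refine h.congr_right fun p _ => ?_
  exact ((hf.hasSum p).summable.tsum_sub (hg.hasSum p).summable).symm

lemma isOpen_box (R : ℝ) : IsOpen {p : ℝ × ℝ | |p.1| < R ∧ |p.2| < R} :=
  (isOpen_lt (f := fun p : ℝ × ℝ => |p.1|) (by fun_prop) continuous_const).inter
    (isOpen_lt (f := fun p : ℝ × ℝ => |p.2|) (by fun_prop) continuous_const)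

lemma continuous (hf : UnifSum f) (hc : ∀ n, Continuous (f n)) :
    Continuous fun p => ∑' n, f n p := by
  refine continuous_iff_continuousAt.2 fun p => ?_
  refine ((hf (max |p.1| |p.2| + 1)).continuousOn ?_).continuousAt ((isOpen_box _).mem_nhds
    ⟨by linarith [le_max_left |p.1| |p.2|], by linarith [le_max_right |p.1| |p.2|]⟩)
  exact Filter.Frequently.of_forall fun F =>
    (continuous_finsetSum F fun n _ => hc n).continuousOn

lemma hasDerivAt_fst (hf : UnifSum f) (hf' : UnifSum f')
    (h : ∀ n (p : ℝ × ℝ), HasDerivAt (fun x => f n (x, p.2)) (f' n p) p.1) (p : ℝ × ℝ) :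
    HasDerivAt (fun x => ∑' n, f n (x, p.2)) (∑' n, f' n p) p.1 := by
  set R := max |p.1| |p.2| + 1
  have h2 : |p.2| < R := by linarith [le_max_right |p.1| |p.2|]
  have hU : IsOpen {x : ℝ | |x| < R} := isOpen_lt continuous_abs continuous_const
  have hu : TendstoUniformlyOn (fun (F : Finset ℤ) x => ∑ n ∈ F, f' n (x, p.2))
      (fun x => ∑' n, f' n (x, p.2)) Filter.atTop {x : ℝ | |x| < R} :=
    ((hf' R).comp (fun x => (x, p.2))).mono fun x hx => ⟨hx, h2⟩
  exact hasDerivAt_of_tendstoUniformlyOn hU hu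
    (Filter.Eventually.of_forall fun F x _ => HasDerivAt.fun_sum fun n _ => h n (x, p.2))
    (fun x _ => hf.hasSum (x, p.2))
    (by show |p.1| < R; linarith [le_max_left |p.1| |p.2|])

lemma hasDerivAt_snd (hf : UnifSum f) (hf' : UnifSum f')
    (h : ∀ n (p : ℝ × ℝ), HasDerivAt (fun y => f n (p.1, y)) (f' n p) p.2) (p : ℝ × ℝ) :
    HasDerivAt (fun y => ∑' n, f n (p.1, y)) (∑' n, f' n p) p.2 := by
  set R := max |p.1| |p.2| + 1
  have h1 : |p.1| < R := by linarith [le_max_left |p.1| |p.2|]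
  have hU : IsOpen {x : ℝ | |x| < R} := isOpen_lt continuous_abs continuous_const
  have hu : TendstoUniformlyOn (fun (F : Finset ℤ) y => ∑ n ∈ F, f' n (p.1, y))
      (fun y => ∑' n, f' n (p.1, y)) Filter.atTop {x : ℝ | |x| < R} :=
    ((hf' R).comp (fun y => (p.1, y))).mono fun y hy => ⟨h1, hy⟩
  exact hasDerivAt_of_tendstoUniformlyOn hU hu
    (Filter.Eventually.of_forall fun F y _ => HasDerivAt.fun_sum fun n _ => h n (p.1, y))
    (fun y _ => hf.hasSum (p.1, y))
    (by show |p.2| < R; linarith [le_max_right |p.1| |p.2|])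

end UnifSum

/-! ### Sums over the gaps -/

/-- The contribution of the `n`-th gap to a sum of staircases with weights `m`. The term
`c * (rot * n)` compensates for the drift of the gaps. -/
def gapTerm (m : ℝ → ℝ) (c : ℝ) (ζ : ℝ → ℝ) (n : ℤ) (p : ℝ × ℝ) : ℝ :=
  m (p.2 + n) * (c * (rot * n) + stair c ζ p.1 (p.2 + n))

/-- The sum of the staircases over all gaps, with weights `m`. -/
def gapSum (m : ℝ → ℝ) (c : ℝ) (ζ : ℝ → ℝ) (p : ℝ × ℝ) : ℝ := ∑' n, gapTerm m c ζ n p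

section GapSum

variable {m m' : ℝ → ℝ} {c : ℝ} {ζ : ℝ → ℝ} {q : ℝ}

lemma gapTerm_zero (m β : ℝ → ℝ) (n : ℤ) (p : ℝ × ℝ) :
    gapTerm m 0 β n p = m (p.2 + n) * stair 0 β p.1 (p.2 + n) := by
  simp [gapTerm]

lemma abs_drift_add_stair_le {Z : ℝ} (hζ : ∀ v, |ζ v| ≤ Z) (n : ℤ) (p : ℝ × ℝ) :
    |c * (rot * n) + stair c ζ p.1 (p.2 + n)| ≤ |c| * (|rot| * |p.2| + |p.1| + 2) + Z := by
  have h1 := abs_edge_sub_le (p.2 + n)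
  set z := p.1 - edge (p.2 + n) with hz
  have e : c * (rot * n) + stair c ζ p.1 (p.2 + n) = c * (-(rot * p.2) + p.1 -
      (edge (p.2 + n) - rot * (p.2 + n)) - Int.fract z) + ζ (Int.fract z / gap (p.2 + n)) := by
    rw [stair, ← hz, Int.fract, hz]; ring
  rw [e]
  refine (abs_add_le _ _).trans (add_le_add ?_ (hζ _))
  rw [abs_mul]
  gcongr
  have h2 : |Int.fract z| ≤ 1 := by
    rw [abs_of_nonneg (Int.fract_nonneg z)]; exact (Int.fract_lt_one z).le
  refine (abs_sub _ _).trans ?_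
  refine (add_le_add ((abs_sub _ _).trans (add_le_add (abs_add_le _ _) h1)) h2).trans ?_
  rw [abs_neg, abs_mul]
  linarith

lemma unifSum_gapTerm (hm : HasDecay m q) (hq : 1 < q) (h : IsStep c ζ) (hζ : Continuous ζ) :
    UnifSum (gapTerm m c ζ) := fun R => by
  obtain ⟨Z, hZ0, hZ⟩ := h.exists_bound hζ
  obtain ⟨u, hu, hu0, hub⟩ := hm.exists_summable_bound hq R
  refine tendstoUniformlyOn_tsum (hu.mul_right (|c| * (|rot| * R + R + 2) + Z)) fun n p hp => ?_
  rw [gapTerm, norm_mul]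
  have hR : 0 ≤ R := (abs_nonneg _).trans hp.1.le
  refine mul_le_mul (hub n _ hp.2.le) ((abs_drift_add_stair_le hZ n p).trans ?_)
    (norm_nonneg _) (hu0 n)
  have := hp.1.le
  have := hp.2.le
  gcongr

/-- The translates of a decaying function become uniformly small on bounded sets. -/
lemma HasDecay.exists_finset_lt (hm : HasDecay m q) (hq : 0 < q) (R : ℝ) {ε : ℝ} (hε : 0 < ε) :
    ∃ F : Finset ℤ, ∀ n ∉ F, ∀ y, |y| ≤ R → |m (y + n)| < ε := by
  obtain ⟨C, hC, h⟩ := hm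
  have h2 : HasDecay (fun s => wt s ^ (2 : ℝ)) 2 :=
    HasDecay.of_le (C := 1) fun s => by
      rw [one_mul, abs_of_nonneg (Real.rpow_nonneg (wt_pos s).le _)]
  obtain ⟨u, hu, -, hub⟩ := h2.exists_summable_bound (by norm_num) R
  have h3 : Filter.Tendsto (fun n => C * u n ^ (q / 2)) Filter.cofinite (𝓝 0) := by
    have := (hu.tendsto_cofinite_zero.rpow_const (p := q / 2) (Or.inr (by positivity))).const_mul C
    rwa [Real.zero_rpow (by positivity), mul_zero] at this
  have h4 := Filter.eventually_cofinite.1 (h3.eventually (gt_mem_nhds hε))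
  refine ⟨h4.toFinset, fun n hn y hy => ?_⟩
  simp only [Finite.mem_toFinset, mem_ofPred_eq, not_not] at hn
  refine lt_of_le_of_lt ((h _).trans ?_) hn
  have h5 := hub n y hy
  rw [abs_of_nonneg (Real.rpow_nonneg (wt_pos _).le _)] at h5
  have h6 : wt (y + n) ^ q = (wt (y + n) ^ (2 : ℝ)) ^ (q / 2) := by
    rw [← Real.rpow_mul (wt_pos _).le]; congr 1; ring
  rw [h6]
  have := Real.rpow_nonneg (wt_pos (y + n)).le 2
  gcongr

/-- At each point, at most one of the terms with steps of height `0` is nonzero. -/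
lemma exists_gapTerm_eq_zero (h : IsStep 0 ζ) (p : ℝ × ℝ) :
    ∃ n₀, ∀ (m : ℝ → ℝ), ∀ n ≠ n₀, gapTerm m 0 ζ n p = 0 := by
  by_cases hex : ∃ n₀ : ℤ, stair 0 ζ p.1 (p.2 + n₀) ≠ 0
  · obtain ⟨n₀, hn₀⟩ := hex
    refine ⟨n₀, fun m n hn => ?_⟩
    rw [gapTerm_zero]
    by_contra hne
    exact hn ((inGap_of_stair_ne_zero h (right_ne_zero_of_mul hne)).index_unique
      (inGap_of_stair_ne_zero h hn₀))
  · push Not at hex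
    exact ⟨0, fun m n _ => by rw [gapTerm_zero, hex, mul_zero]⟩

/-- Because the gaps are disjoint, sums with steps of height `0` converge as soon as the weights
tend to zero. -/
lemma unifSum_gapTerm_zero (hm : HasDecay m q) (hq : 0 < q) (h : IsStep 0 ζ) (hζ : Continuous ζ) :
    UnifSum (gapTerm m 0 ζ) := fun R => by
  obtain ⟨Z, hZ0, hZ⟩ := h.exists_bound hζ
  rw [Metric.tendstoUniformlyOn_iff]
  intro ε hε
  obtain ⟨F₀, hF₀⟩ := hm.exists_finset_lt hq R (ε := ε / (Z + 1)) (by positivity)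
  filter_upwards [Filter.eventually_ge_atTop F₀] with F hF p hp
  obtain ⟨n₀, hn₀⟩ := exists_gapTerm_eq_zero h p
  rw [tsum_eq_single n₀ (hn₀ m)]
  by_cases hmem : n₀ ∈ F
  · rw [Finset.sum_eq_single_of_mem n₀ hmem fun n _ hn => hn₀ m n hn, dist_self]
    exact hε
  · rw [Finset.sum_eq_zero fun n hn => hn₀ m n fun e => hmem (e ▸ hn), dist_zero_right,
      gapTerm_zero, norm_mul]
    have h1 := hF₀ n₀ (fun hn => hmem (hF hn)) p.2 hp.2.le
    have h2 : |stair 0 ζ p.1 (p.2 + n₀)| ≤ Z := by rw [stair_zero]; exact hZ _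
    calc |m (p.2 + n₀)| * |stair 0 ζ p.1 (p.2 + n₀)| ≤ |m (p.2 + n₀)| * (Z + 1) := by
          gcongr; linarith
      _ < ε / (Z + 1) * (Z + 1) := by gcongr
      _ = ε := by field_simp

lemma continuous_gapTerm (hm : Continuous m) (h : IsStep c ζ) (hζ : Continuous ζ) (n : ℤ) :
    Continuous (gapTerm m c ζ n) := by
  have h1 : Continuous fun p : ℝ × ℝ => stair c ζ p.1 (p.2 + n) :=
    (continuous_stair h hζ).comp (continuous_fst.prodMk (continuous_snd.add continuous_const))
  exact (hm.comp (continuous_snd.add continuous_const)).mul (h1.const_add _)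

lemma hasDerivAt_gapTerm_fst (h : IsStep c ζ) (hζ : Differentiable ℝ ζ) (n : ℤ) (p : ℝ × ℝ) :
    HasDerivAt (fun x => gapTerm m c ζ n (x, p.2))
      (gapTerm (fun s => m s * (gap s)⁻¹) 0 (deriv ζ) n p) p.1 := by
  refine (((hasDerivAt_stair_fst h hζ p.1 (p.2 + n)).const_add (c * (rot * n))).const_mul
    (m (p.2 + n))).congr_deriv ?_
  rw [gapTerm_zero]; ring

lemma hasDerivAt_gapTerm_snd (hm : ∀ s, HasDerivAt m (m' s) s) (h : IsStep c ζ)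
    (hζ : Differentiable ℝ ζ) (n : ℤ) (p : ℝ × ℝ) :
    HasDerivAt (fun y => gapTerm m c ζ n (p.1, y))
      (gapTerm m' c ζ n p - gapTerm (fun s => m s * (gap s)⁻¹ * edgeD s) 0 (deriv ζ) n p -
        gapTerm (fun s => m s * (gap s)⁻¹ * gapD 1 s) 0 (fun v => v * deriv ζ v) n p) p.2 := by
  have h1 := HasDerivAt.comp_add_const p.2 (n : ℝ) (hm (p.2 + n))
  have h2 := HasDerivAt.comp_add_const p.2 (n : ℝ) (hasDerivAt_stair_snd h hζ p.1 (p.2 + n))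
  refine (h1.mul (h2.const_add (c * (rot * n)))).congr_deriv ?_
  simp only [gapTerm_zero]
  rw [gapTerm]; ring

/-- The partial derivatives of a sum of staircases are sums of the same kind. -/
lemma hasDerivAt_gapSum (hm : ∀ s, HasDerivAt m (m' s) s) (hd : HasDecay m (3 / 2))
    (hd' : HasDecay m' (3 / 2)) (h : IsStep c ζ) (hζ : ContDiff ℝ 1 ζ) (p : ℝ × ℝ) :
    HasDerivAt (fun x => gapSum m c ζ (x, p.2))
      (gapSum (fun s => m s * (gap s)⁻¹) 0 (deriv ζ) p) p.1 ∧
    HasDerivAt (fun y => gapSum m c ζ (p.1, y))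
      (gapSum m' c ζ p - gapSum (fun s => m s * (gap s)⁻¹ * edgeD s) 0 (deriv ζ) p -
        gapSum (fun s => m s * (gap s)⁻¹ * gapD 1 s) 0 (fun v => v * deriv ζ v) p) p.2 := by
  have hζ' : Differentiable ℝ ζ := hζ.differentiable one_ne_zero
  have hζ'' : Continuous (deriv ζ) := hζ.continuous_deriv le_rfl
  have hi := hd.mul (inv_gap_decay (ε := 1 / 10) (by norm_num))
  have u0 := unifSum_gapTerm hd (by norm_num) h hζ.continuous
  have u1 := unifSum_gapTerm_zero hi (by norm_num) h.deriv hζ''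
  have u2 := unifSum_gapTerm hd' (by norm_num) h hζ.continuous
  have u3 := unifSum_gapTerm_zero (hi.mul edgeD_decay) (by norm_num) h.deriv hζ''
  have u4 := unifSum_gapTerm_zero (hi.mul (gapD_decay (i := 1) (by norm_num))) (by norm_num)
    h.deriv.id_mul (continuous_id.mul hζ'')
  refine ⟨u0.hasDerivAt_fst u1 (fun n p => hasDerivAt_gapTerm_fst h hζ' n p) p, ?_⟩
  refine (u0.hasDerivAt_snd ((u2.sub u3).sub u4)
    (fun n p => hasDerivAt_gapTerm_snd hm h hζ' n p) p).congr_deriv ?_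
  rw [((u2.sub u3).hasSum p).summable.tsum_sub (u4.hasSum p).summable,
    (u2.hasSum p).summable.tsum_sub (u3.hasSum p).summable]
  rfl

lemma continuous_gapSum_zero (hm : Continuous m) (hd : HasDecay m q) (hq : 0 < q)
    (h : IsStep 0 ζ) (hζ : Continuous ζ) : Continuous (gapSum m 0 ζ) :=
  (unifSum_gapTerm_zero hd hq h hζ).continuous fun n => continuous_gapTerm hm h hζ n

lemma continuous_edgeD : Continuous edgeD :=
  continuous_iff_continuousAt.2 fun s => (hasDerivAt_edgeD s).continuousAt

lemma continuous_inv_gap : Continuous fun s => (gap s)⁻¹ :=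
  (continuous_gapD (by norm_num)).inv₀ fun s => (gap_pos s).ne'

/-- A sum of staircases is continuously differentiable if its weights decay, together with their
derivative. -/
lemma contDiff_gapSum (hm : ∀ s, HasDerivAt m (m' s) s) (hm' : Continuous m')
    (hd : HasDecay m (3 / 2)) (hd' : HasDecay m' (3 / 2)) (h : IsStep c ζ) (hζ : ContDiff ℝ 1 ζ) :
    ContDiff ℝ 1 (gapSum m c ζ) := by
  have hζ'' : Continuous (deriv ζ) := hζ.continuous_deriv le_rfl
  have hi := hd.mul (inv_gap_decay (ε := 1 / 10) (by norm_num))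
  have hmc : Continuous m := continuous_iff_continuousAt.2 fun s => (hm s).continuousAt
  have hc := hmc.mul continuous_inv_gap
  refine contDiff_succ_of_deriv₂ (n := 0) (f₂ := fun p => gapSum m' c ζ p -
      gapSum (fun s => m s * (gap s)⁻¹ * edgeD s) 0 (deriv ζ) p -
        gapSum (fun s => m s * (gap s)⁻¹ * gapD 1 s) 0 (fun v => v * deriv ζ v) p) (fun x y => (hasDerivAt_gapSum hm hd hd' h hζ (x, y)).1)
    (fun x y => (hasDerivAt_gapSum hm hd hd' h hζ (x, y)).2) ?_ ?_
  · exact contDiff_zero.2 (continuous_gapSum_zero hc hi (by norm_num) h.deriv hζ'')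
  · refine contDiff_zero.2 ((Continuous.sub ?_ ?_).sub ?_)
    · exact (unifSum_gapTerm hd' (by norm_num) h hζ.continuous).continuous fun n =>
        continuous_gapTerm hm' h hζ.continuous n
    · exact continuous_gapSum_zero (hc.mul continuous_edgeD) (hi.mul edgeD_decay) (by norm_num)
        h.deriv hζ''
    · exact continuous_gapSum_zero (hc.mul (continuous_gapD (by norm_num)))
        (hi.mul (gapD_decay (i := 1) (by norm_num))) (by norm_num)
        h.deriv.id_mul (continuous_id.mul hζ'')

/-- Sums of staircases are periodic, if their drift cancels. -/
lemma isBiperiodic_gapSum (hs : UnifSum (gapTerm m c ζ))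
    (h0 : c = 0 ∨ ((∀ y, Summable fun n : ℤ => m (y + n)) ∧ ∀ y, ∑' n : ℤ, m (y + n) = 0)) :
    IsBiperiodic (gapSum m c ζ) := by
  have hsum (y : ℝ) : Summable (fun n : ℤ => c * m (y + n)) ∧ ∑' n : ℤ, c * m (y + n) = 0 := by
    rcases h0 with rfl | ⟨h1, h2⟩
    · simp
    · exact ⟨(h1 y).mul_left c, by rw [tsum_mul_left, h2, mul_zero]⟩
  intro p k l
  have e1 : gapSum m c ζ (p.1 + k, p.2 + l) =
      ∑' n : ℤ, gapTerm m c ζ (n - l) (p.1 + k, p.2 + l) :=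
    ((Equiv.subRight l).tsum_eq fun n => gapTerm m c ζ n (p.1 + k, p.2 + l)).symm
  have e2 (n : ℤ) : gapTerm m c ζ (n - l) (p.1 + k, p.2 + l) =
      gapTerm m c ζ n p + (k - rot * l) * (c * m (p.2 + n)) := by
    have : p.2 + l + ((n - l : ℤ) : ℝ) = p.2 + n := by push_cast; ring
    simp only [gapTerm, this, stair_add_int]
    push_cast; ring
  rw [e1]
  simp only [e2]
  rw [(hs.hasSum p).summable.tsum_add ((hsum p.2).1.mul_left _), tsum_mul_left, (hsum p.2).2,
    mul_zero, add_zero]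
  rfl

end GapSum

/-! ### Decaying weights -/

/-- `f` is continuously differentiable, and `f` and its derivative have decay `p`. -/
def HasDecay₁ (f : ℝ → ℝ) (p : ℝ) : Prop :=
  ∃ f' : ℝ → ℝ, (∀ s, HasDerivAt f (f' s) s) ∧ Continuous f' ∧ HasDecay f p ∧ HasDecay f' p

namespace HasDecay₁

variable {f g : ℝ → ℝ} {p q : ℝ}

lemma continuous (hf : HasDecay₁ f p) : Continuous f := by
  obtain ⟨f', h, -⟩ := hf
  exact continuous_iff_continuousAt.2 fun s => (h s).continuousAt

lemma hasDecay (hf : HasDecay₁ f p) : HasDecay f p := by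
  obtain ⟨f', -, -, h, -⟩ := hf
  exact h

lemma mono (hf : HasDecay₁ f p) (hqp : q ≤ p) : HasDecay₁ f q := by
  obtain ⟨f', h, hc, h0, h1⟩ := hf
  exact ⟨f', h, hc, h0.mono hqp, h1.mono hqp⟩

lemma mul (hf : HasDecay₁ f p) (hg : HasDecay₁ g q) :
    HasDecay₁ (fun s => f s * g s) (p + q) := by
  have cf := hf.continuous
  have cg := hg.continuous
  obtain ⟨f', h, hc, h0, h1⟩ := hf
  obtain ⟨g', k, kc, k0, k1⟩ := hg
  exact ⟨fun s => f' s * g s + f s * g' s, fun s => (h s).mul (k s),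
    (hc.mul cg).add (cf.mul kc), h0.mul k0, (h1.mul k0).add (h0.mul k1)⟩

lemma sub (hf : HasDecay₁ f p) (hg : HasDecay₁ g p) : HasDecay₁ (fun s => f s - g s) p := by
  obtain ⟨f', h, hc, h0, h1⟩ := hf
  obtain ⟨g', k, kc, k0, k1⟩ := hg
  exact ⟨fun s => f' s - g' s, fun s => (h s).sub (k s), hc.sub kc, h0.sub k0, h1.sub k1⟩

lemma const_mul (c : ℝ) (hf : HasDecay₁ f p) : HasDecay₁ (fun s => c * f s) p := by
  obtain ⟨f', h, hc, h0, h1⟩ := hf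
  exact ⟨fun s => c * f' s, fun s => (h s).const_mul c, hc.const_mul c, h0.const_mul c,
    h1.const_mul c⟩

end HasDecay₁

lemma gapD_decay₁ {i : ℕ} (hi : i < 3) : HasDecay₁ (gapD i) (i + 1) := by
  refine ⟨gapD (i + 1), hasDerivAt_gapD (by omega), continuous_gapD (by omega),
    gapD_decay (by omega), (gapD_decay (by omega)).mono ?_⟩
  push_cast; linarith

lemma hasDerivAt_inv_gap (s : ℝ) :
    HasDerivAt (fun s => (gap s)⁻¹) (-(gapD 1 s * ((gap s)⁻¹ * (gap s)⁻¹))) s := by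
  refine ((hasDerivAt_gapD (i := 0) (by norm_num) s).fun_inv (gap_pos s).ne').congr_deriv ?_
  have := (gap_pos s).ne'
  field_simp

lemma inv_gap_decay₁ {ε : ℝ} (hε : 0 < ε) (hε1 : ε ≤ 1) :
    HasDecay₁ (fun s => (gap s)⁻¹) (-(1 + ε)) := by
  have h := inv_gap_decay hε
  refine ⟨_, hasDerivAt_inv_gap, ?_, h,
    ((gapD_decay (i := 1) (by norm_num)).mul (h.mul h)).neg.mono ?_⟩
  · exact ((continuous_gapD (by norm_num)).mul (continuous_inv_gap.mul continuous_inv_gap)).neg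
  · push_cast; linarith

lemma edgeD_decay₁ : HasDecay₁ edgeD 0 :=
  ⟨edgeD2, hasDerivAt_edgeD, continuous_edgeD2, edgeD_decay, edgeD2_decay⟩

lemma HasDecay₁.contDiff_gapSum {m : ℝ → ℝ} {p c : ℝ} {ζ : ℝ → ℝ} (hm : HasDecay₁ m p)
    (hp : 3 / 2 ≤ p) (h : IsStep c ζ) (hζ : ContDiff ℝ 1 ζ) : ContDiff ℝ 1 (gapSum m c ζ) := by
  obtain ⟨m', h1, h2, h3, h4⟩ := hm
  exact _root_.contDiff_gapSum h1 h2 (h3.mono hp) (h4.mono hp) h hζ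

/-! ### Hölder continuity of sums over the gaps -/

/-- Hölder continuity of a real function on the plane. -/
def IsHolder (α : ℝ) (f : ℝ × ℝ → ℝ) : Prop :=
  ∃ C, 0 ≤ C ∧ ∀ p q, |f p - f q| ≤ C * dist p q ^ α

lemma IsHolder.sub {α : ℝ} {f g : ℝ × ℝ → ℝ} (hf : IsHolder α f) (hg : IsHolder α g) :
    IsHolder α (fun p => f p - g p) := by
  obtain ⟨C, hC, hf⟩ := hf
  obtain ⟨C', hC', hg⟩ := hg
  refine ⟨C + C', by positivity, fun p q => ?_⟩
  rw [show f p - g p - (f q - g q) = (f p - f q) - (g p - g q) by ring, add_mul]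
  exact (abs_sub _ _).trans (add_le_add (hf p q) (hg p q))

lemma le_interpolate {d A B α : ℝ} (hd : 0 ≤ d) (hA : d ≤ A) (hB : d ≤ B) (hα : 0 ≤ α)
    (hα1 : α ≤ 1) : d ≤ A ^ α * B ^ (1 - α) := by
  rcases hd.eq_or_lt with rfl | hd'
  · positivity
  · calc d = d ^ α * d ^ (1 - α) := by rw [← Real.rpow_add hd']; simp
      _ ≤ A ^ α * B ^ (1 - α) := by
        have : 0 ≤ A := hd.trans hA
        have : 0 ≤ 1 - α := by linarith
        gcongr

/-- A bounded function is Hölder continuous, if it is so at distances below `1`. -/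
lemma isHolder_of_bounded {α B C : ℝ} {f : ℝ × ℝ → ℝ} (hα : 0 ≤ α) (hB : ∀ p, |f p| ≤ B)
    (hC0 : 0 ≤ C) (hC : ∀ p q, dist p q ≤ 1 → |f p - f q| ≤ C * dist p q ^ α) :
    IsHolder α f := by
  have hB0 : 0 ≤ B := (abs_nonneg _).trans (hB 0)
  refine ⟨C + 2 * B, by positivity, fun p q => ?_⟩
  have h0 : 0 ≤ dist p q ^ α := Real.rpow_nonneg dist_nonneg _
  rcases le_total (dist p q) 1 with h | h
  · exact (hC p q h).trans (by gcongr; linarith)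
  · have h1 : 1 ≤ dist p q ^ α := Real.one_le_rpow h hα
    have h2 := (abs_sub (f p) (f q)).trans (add_le_add (hB p) (hB q))
    nlinarith

lemma IsBiperiodic.isHolder {f : ℝ × ℝ → ℝ} (hf : IsBiperiodic f) (hc : ContDiff ℝ 1 f) {α : ℝ}
    (hα : 0 ≤ α) (hα1 : α ≤ 1) : IsHolder α f := by
  obtain ⟨L, hL0, hL⟩ := hf.fderiv.exists_bound (hc.continuous_fderiv one_ne_zero)
  obtain ⟨B, hB0, hB⟩ := hf.exists_bound hc.continuous
  refine isHolder_of_bounded hα hB hL0.le fun p q hpq => ?_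
  have h1 : |f p - f q| ≤ L * dist p q := (lipschitzWith_of_nnnorm_fderiv_le (C := ⟨L, hL0.le⟩)
    (hc.differentiable one_ne_zero) hL).dist_le_mul p q
  refine h1.trans ?_
  gcongr
  rcases (dist_nonneg (x := p) (y := q)).eq_or_lt with h | h
  · rw [← h]; positivity
  · conv_lhs => rw [← Real.rpow_one (dist p q)]
    exact Real.rpow_le_rpow_of_exponent_ge h hpq hα1

lemma wt_rpow_le {s r : ℝ} (h : |s - r| ≤ 1) (q : ℝ) : wt s ^ q ≤ 2 ^ |q| * wt r ^ q := by
  have hs := wt_pos s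
  have hr := wt_pos r
  rcases le_total 0 q with hq | hq
  · rw [abs_of_nonneg hq, ← Real.mul_rpow zero_le_two hr.le]
    exact Real.rpow_le_rpow hs.le (wt_le_two_mul_wt h) hq
  · have h1 : wt r / 2 ≤ wt s := by
      have := wt_le_two_mul_wt (s := r) (r := s) (by rwa [abs_sub_comm])
      linarith
    rw [abs_of_nonpos hq, Real.rpow_neg zero_le_two, inv_mul_eq_div,
      ← Real.div_rpow hr.le zero_le_two]
    exact Real.rpow_le_rpow_of_nonpos (by positivity) h1 hq

section Holder

variable {m β : ℝ → ℝ} {q α ε : ℝ}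

lemma exists_gapTerm_bound (hm : HasDecay m q) (h : IsStep 0 β) (hβ : Continuous β) :
    ∃ C, 0 ≤ C ∧ ∀ n p, |gapTerm m 0 β n p| ≤ C * wt (p.2 + n) ^ q := by
  obtain ⟨C, hC, hm⟩ := hm
  obtain ⟨Z, hZ0, hZ⟩ := h.exists_bound hβ
  refine ⟨C * Z, by positivity, fun n p => ?_⟩
  rw [gapTerm_zero, abs_mul, stair_zero]
  calc |m (p.2 + n)| * |β _| ≤ (C * wt (p.2 + n) ^ q) * Z :=
        mul_le_mul (hm _) (hZ _) (abs_nonneg _) ((abs_nonneg _).trans (hm _))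
    _ = _ := by ring

/-- A term of decay `1 - ε` whose gradient grows at most as the power `2 ε` is Hölder continuous,
uniformly, by interpolation. -/
lemma exists_gapTerm_holder (hm : HasDecay₁ m (1 - ε)) (h : IsStep 0 β) (hβ : ContDiff ℝ 1 β)
    (hε : 0 < ε) (hα : 0 ≤ α) (hα1 : α ≤ 1)
    (hεα : 2 * ε * α ≤ (1 - ε) * (1 - α)) :
    ∃ C, 0 ≤ C ∧ ∀ n p q, dist p q ≤ 1 →
      |gapTerm m 0 β n p - gapTerm m 0 β n q| ≤ C * dist p q ^ α := by
  obtain ⟨m', hmd, -, hm0, hm1⟩ := hm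
  have hβ' := hβ.continuous_deriv le_rfl
  have hi := hm0.mul (inv_gap_decay hε)
  obtain ⟨A, hA0, hA⟩ := exists_gapTerm_bound hm0 h hβ.continuous
  obtain ⟨B, hB0, hB⟩ := exists_gapTerm_bound (q := -(2 * ε)) (hi.mono (by linarith)) h.deriv hβ'
  obtain ⟨B₁, hB₁0, hB₁⟩ := exists_gapTerm_bound (q := -(2 * ε)) (hm1.mono (by linarith)) h
    hβ.continuous
  obtain ⟨B₂, hB₂0, hB₂⟩ := exists_gapTerm_bound (q := -(2 * ε))
    ((hi.mul edgeD_decay).mono (by linarith)) h.deriv hβ'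
  obtain ⟨B₃, hB₃0, hB₃⟩ := exists_gapTerm_bound (q := -(2 * ε))
    ((hi.mul (gapD_decay (i := 1) (by norm_num))).mono (by push_cast; linarith)) h.deriv.id_mul
    (continuous_id.mul hβ')
  set G := B + (B₁ + B₂ + B₃) * 2 ^ |-(2 * ε)| with hG
  set A' := A + A * 2 ^ |1 - ε| with hA'
  have hG0 : 0 ≤ G := by positivity
  have hA'0 : 0 ≤ A' := by positivity
  refine ⟨G ^ α * A' ^ (1 - α), by positivity, fun n p q hpq => ?_⟩
  have hw := wt_pos (p.2 + n)
  have hx : |p.1 - q.1| ≤ dist p q := le_max_left _ _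
  have hy : |p.2 - q.2| ≤ dist p q := le_max_right _ _
  have hs (y : ℝ) (hy' : |y - p.2| ≤ 1) : |(y + n) - (p.2 + n)| ≤ 1 := by simpa using hy'
  have b1 : |gapTerm m 0 β n p - gapTerm m 0 β n (q.1, p.2)| ≤
      B * wt (p.2 + n) ^ (-(2 * ε)) * |p.1 - q.1| :=
    convex_univ.norm_image_sub_le_of_norm_hasDerivWithin_le (f := fun x => gapTerm m 0 β n (x, p.2))
      (fun x _ => (hasDerivAt_gapTerm_fst h (hβ.differentiable one_ne_zero) n
        (x, p.2)).hasDerivWithinAt) (fun x _ => hB n (x, p.2)) trivial trivial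
  have b2 : |gapTerm m 0 β n (q.1, p.2) - gapTerm m 0 β n q| ≤
      (B₁ + B₂ + B₃) * (2 ^ |-(2 * ε)| * wt (p.2 + n) ^ (-(2 * ε))) * |p.2 - q.2| := by
    refine (convex_uIcc q.2 p.2).norm_image_sub_le_of_norm_hasDerivWithin_le
      (f := fun y => gapTerm m 0 β n (q.1, y))
      (fun y _ => (hasDerivAt_gapTerm_snd hmd h (hβ.differentiable one_ne_zero) n
        (q.1, y)).hasDerivWithinAt) (fun y hy' => ?_) left_mem_uIcc right_mem_uIcc
    have hyp : |y - p.2| ≤ 1 := by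
      rw [uIcc_comm] at hy'
      have := abs_sub_left_of_mem_uIcc hy'
      rw [abs_sub_comm q.2] at this
      linarith
    have h1 := wt_rpow_le (hs y hyp) (-(2 * ε))
    refine ((abs_sub _ _).trans (add_le_add ((abs_sub _ _).trans (add_le_add (hB₁ n _)
      (hB₂ n _))) (hB₃ n _))).trans ?_
    rw [← add_mul, ← add_mul]
    gcongr
  have b3 : |gapTerm m 0 β n p - gapTerm m 0 β n q| ≤
      G * wt (p.2 + n) ^ (-(2 * ε)) * dist p q := by
    refine (abs_sub_le _ (gapTerm m 0 β n (q.1, p.2)) _).trans ((add_le_add b1 b2).trans ?_)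
    have := Real.rpow_nonneg hw.le (-(2 * ε))
    calc _ ≤ B * wt (p.2 + n) ^ (-(2 * ε)) * dist p q +
          (B₁ + B₂ + B₃) * (2 ^ |-(2 * ε)| * wt (p.2 + n) ^ (-(2 * ε))) * dist p q := by gcongr
      _ = _ := by rw [hG]; ring
  have b4 : |gapTerm m 0 β n p - gapTerm m 0 β n q| ≤ A' * wt (p.2 + n) ^ (1 - ε) := by
    have h1 := wt_rpow_le (hs q.2 (by rw [abs_sub_comm]; linarith)) (1 - ε)
    refine ((abs_sub _ _).trans (add_le_add (hA n p) (hA n q))).trans ?_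
    calc _ ≤ A * wt (p.2 + n) ^ (1 - ε) + A * (2 ^ |1 - ε| * wt (p.2 + n) ^ (1 - ε)) := by gcongr
      _ = _ := by rw [hA']; ring
  refine (le_interpolate (abs_nonneg _) b3 b4 hα hα1).trans ?_
  have hw1 : 0 ≤ wt (p.2 + n) ^ (-(2 * ε)) := Real.rpow_nonneg hw.le _
  have hw2 : 0 ≤ wt (p.2 + n) ^ (1 - ε) := Real.rpow_nonneg hw.le _
  have e : (wt (p.2 + n) ^ (-(2 * ε))) ^ α * (wt (p.2 + n) ^ (1 - ε)) ^ (1 - α) ≤ 1 := by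
    rw [← Real.rpow_mul hw.le, ← Real.rpow_mul hw.le, ← Real.rpow_add hw]
    exact Real.rpow_le_one hw.le (wt_le_one _) (by linarith)
  rw [Real.mul_rpow (by positivity) dist_nonneg, Real.mul_rpow hG0 hw1, Real.mul_rpow hA'0 hw2]
  have := Real.rpow_nonneg (dist_nonneg (x := p) (y := q)) α
  calc _ = G ^ α * A' ^ (1 - α) * dist p q ^ α *
        ((wt (p.2 + n) ^ (-(2 * ε))) ^ α * (wt (p.2 + n) ^ (1 - ε)) ^ (1 - α)) := by ring
    _ ≤ _ := mul_le_of_le_one_right (by positivity) e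

/-- Since at each point at most one term is nonzero, the Hölder continuity of the terms passes to
the sum. -/
lemma isHolder_gapSum (hm : HasDecay₁ m (1 - ε)) (h : IsStep 0 β) (hβ : ContDiff ℝ 1 β)
    (hε : 0 < ε) (hε1 : ε ≤ 1) (hα : 0 ≤ α) (hα1 : α ≤ 1)
    (hεα : 2 * ε * α ≤ (1 - ε) * (1 - α)) : IsHolder α (gapSum m 0 β) := by
  obtain ⟨C, hC0, hC⟩ := exists_gapTerm_holder hm h hβ hε hα hα1 hεα
  obtain ⟨m', hmd, -, hm0, hm1⟩ := hm
  obtain ⟨B, hB0, hB⟩ := exists_gapTerm_bound (q := 0) (hm0.mono (by linarith)) h hβ.continuous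
  refine isHolder_of_bounded (B := B) (C := 2 * C) hα (fun p => ?_) (by positivity)
    fun p q hpq => ?_
  · obtain ⟨n₀, hn₀⟩ := exists_gapTerm_eq_zero h p
    rw [gapSum, tsum_eq_single n₀ (hn₀ m)]
    simpa using hB n₀ p
  · obtain ⟨n₀, hn₀⟩ := exists_gapTerm_eq_zero h p
    obtain ⟨n₁, hn₁⟩ := exists_gapTerm_eq_zero h q
    have e1 : gapSum m 0 β p = ∑ n ∈ ({n₀, n₁} : Finset ℤ), gapTerm m 0 β n p :=
      tsum_eq_sum fun n hn => hn₀ m n fun e => hn (by simp [e])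
    have e2 : gapSum m 0 β q = ∑ n ∈ ({n₀, n₁} : Finset ℤ), gapTerm m 0 β n q :=
      tsum_eq_sum fun n hn => hn₁ m n fun e => hn (by simp [e])
    rw [e1, e2, ← Finset.sum_sub_distrib]
    refine (Finset.abs_sum_le_sum_abs _ _).trans ((Finset.sum_le_card_nsmul _ _ _
      fun n _ => hC n p q hpq).trans ?_)
    rw [nsmul_eq_mul, mul_assoc]
    have : (({n₀, n₁} : Finset ℤ).card : ℝ) ≤ 2 := by exact_mod_cast Finset.card_le_two
    have := Real.rpow_nonneg (dist_nonneg (x := p) (y := q)) α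
    gcongr

end Holder

/-! ### The Denjoy vector field -/

/-- A smooth step of height `1`. -/
def step (v : ℝ) : ℝ := Real.smoothTransition (2 * v - 1 / 2)

lemma isStep_step : IsStep 1 step where
  lo v hv := Real.smoothTransition.zero_of_nonpos (by linarith)
  hi v hv := Real.smoothTransition.one_of_one_le (by linarith)

lemma contDiff_step {n : ℕ} : ContDiff ℝ n step :=
  Real.smoothTransition.contDiff.comp (by fun_prop)

lemma contDiff_deriv_step {n : ℕ} : ContDiff ℝ n (deriv step) :=
  ((contDiff_succ_iff_deriv (n := n)).1 (contDiff_step (n := n + 1))).2.2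

/-- The horizontal component of the Denjoy vector field, on the plane. Over each gap it interpolates
between the velocities of the two edges of the gap. -/
def denjoyLift (p : ℝ × ℝ) : ℝ := rot + gapSum (gapD 1) 1 step p

/-- The derivative in `x` of `denjoyLift`. -/
def denjoyDx : ℝ × ℝ → ℝ := gapSum (fun s => gapD 1 s * (gap s)⁻¹) 0 (deriv step)

/-- The derivative in `y` of `denjoyLift`. -/
def denjoyDy (p : ℝ × ℝ) : ℝ := gapSum (gapD 2) 1 step p -
  gapSum (fun s => gapD 1 s * (gap s)⁻¹ * edgeD s) 0 (deriv step) p -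
  gapSum (fun s => gapD 1 s * (gap s)⁻¹ * gapD 1 s) 0 (fun v => v * deriv step v) p

lemma gapD_one_decay₁ : HasDecay₁ (gapD 1) 2 :=
  (gapD_decay₁ (by norm_num)).mono (by norm_num)

lemma gapD_two_decay₁ : HasDecay₁ (gapD 2) 3 :=
  (gapD_decay₁ (by norm_num)).mono (by norm_num)

lemma hasDerivAt_denjoyLift (p : ℝ × ℝ) :
    HasDerivAt (fun x => denjoyLift (x, p.2)) (denjoyDx p) p.1 ∧
      HasDerivAt (fun y => denjoyLift (p.1, y)) (denjoyDy p) p.2 := by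
  have h := hasDerivAt_gapSum (hasDerivAt_gapD (i := 1) (by norm_num))
    ((gapD_decay (by norm_num)).mono (by norm_num)) ((gapD_decay (by norm_num)).mono (by norm_num))
    isStep_step contDiff_step p
  exact ⟨h.1.const_add _, h.2.const_add _⟩

lemma contDiff_denjoyLift : ContDiff ℝ 1 denjoyLift :=
  contDiff_const.add (gapD_one_decay₁.contDiff_gapSum (by norm_num) isStep_step contDiff_step)

lemma tsum_gapD_two (y : ℝ) : ∑' n : ℤ, gapD 2 (y + n) = 0 := by
  have h := hasDerivAt_tsum_shift (hasDerivAt_gapD (i := 1) (by norm_num)) (gapD_decay (i := 2)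
    (by norm_num)) (by norm_num) (e := fun _ => 1) (B := 1) (by simp)
    ((gapD_decay (i := 1) (by norm_num)).summable_shift_mul (B := 1) (by norm_num) 0 (by simp)) y
  simp only [mul_one, tsum_gapD_one] at h
  exact h.unique (hasDerivAt_const y _)

lemma summable_gapD {i : ℕ} (hi : i < 4) (hi1 : 1 ≤ i) (y : ℝ) :
    Summable fun n : ℤ => gapD i (y + n) := by
  have hi' : (1 : ℝ) ≤ i := by exact_mod_cast hi1
  simpa using (gapD_decay hi).summable_shift_mul (by linarith) y (e := fun _ => 1) (B := 1) (by simp)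

lemma isBiperiodic_denjoyLift : IsBiperiodic denjoyLift := fun p k l => by
  have := isBiperiodic_gapSum (unifSum_gapTerm (gapD_decay (i := 1) (by norm_num)) (by norm_num)
    isStep_step (contDiff_step (n := 1)).continuous)
    (Or.inr ⟨summable_gapD (by norm_num) (by norm_num), tsum_gapD_one⟩) p k l
  rw [denjoyLift, denjoyLift, this]

lemma isHolder_denjoyLift {α : ℝ} (hα : 0 < α) (hα1 : α < 1) :
    IsHolder α denjoyDx ∧ IsHolder α denjoyDy := by
  set ε := (1 - α) / 4 with hε
  have hε0 : 0 < ε := by rw [hε]; linarith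
  have hε1 : ε ≤ 1 := by rw [hε]; linarith
  have hεα : 2 * ε * α ≤ (1 - ε) * (1 - α) := by rw [hε]; nlinarith
  have hi := gapD_one_decay₁.mul (inv_gap_decay₁ hε0 hε1)
  have hs := isStep_step.deriv
  refine ⟨?_, IsHolder.sub (IsHolder.sub ?_ ?_) ?_⟩
  · exact isHolder_gapSum (hi.mono (by linarith)) hs contDiff_deriv_step hε0 hε1 hα.le hα1.le hεα
  · refine IsBiperiodic.isHolder ?_ (gapD_two_decay₁.contDiff_gapSum (by norm_num) isStep_step
      contDiff_step) hα.le hα1.le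
    exact isBiperiodic_gapSum (unifSum_gapTerm (gapD_decay (i := 2) (by norm_num)) (by norm_num)
      isStep_step (contDiff_step (n := 1)).continuous)
      (Or.inr ⟨summable_gapD (by norm_num) (by norm_num), tsum_gapD_two⟩)
  · exact isHolder_gapSum ((hi.mul edgeD_decay₁).mono (by linarith)) hs contDiff_deriv_step
      hε0 hε1 hα.le hα1.le hεα
  · exact isHolder_gapSum ((hi.mul gapD_one_decay₁).mono (by linarith)) hs.id_mul
      (contDiff_id.mul contDiff_deriv_step) hε0 hε1 hα.le hα1.le hεα

lemma fderiv_denjoyLift_apply (p w : ℝ × ℝ) :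
    fderiv ℝ denjoyLift p w = w.1 * denjoyDx p + w.2 * denjoyDy p := by
  have hd := contDiff_denjoyLift.differentiable one_ne_zero p
  have h1 : fderiv ℝ denjoyLift p (1, 0) = denjoyDx p :=
    (hasDerivAt_pdx hd).unique (hasDerivAt_denjoyLift p).1
  have h2 : fderiv ℝ denjoyLift p (0, 1) = denjoyDy p :=
    (hasDerivAt_pdy hd).unique (hasDerivAt_denjoyLift p).2
  have e : w = w.1 • ((1 : ℝ), (0 : ℝ)) + w.2 • ((0 : ℝ), (1 : ℝ)) := by
    ext <;> simp
  conv_lhs => rw [e]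
  rw [map_add, map_smul, map_smul, h1, h2, smul_eq_mul, smul_eq_mul]

lemma holderWith_fderiv_denjoyLift {α : NNReal} (hα : 0 < α) (hα1 : α < 1) :
    ∃ C : NNReal, HolderWith C α (fderiv ℝ denjoyLift) := by
  obtain ⟨⟨C, hC0, hC⟩, C', hC0', hC'⟩ := isHolder_denjoyLift (α := α) (by exact_mod_cast hα)
    (by exact_mod_cast hα1)
  refine ⟨⟨C + C', by positivity⟩, fun p q => ?_⟩
  have h0 : 0 ≤ dist p q ^ (α : ℝ) := Real.rpow_nonneg dist_nonneg _
  have h1 : dist (fderiv ℝ denjoyLift p) (fderiv ℝ denjoyLift q) ≤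
      (C + C') * dist p q ^ (α : ℝ) := by
    rw [dist_eq_norm]
    refine ContinuousLinearMap.opNorm_le_bound _ (by positivity) fun w => ?_
    rw [sub_apply, fderiv_denjoyLift_apply, fderiv_denjoyLift_apply,
      show w.1 * denjoyDx p + w.2 * denjoyDy p - (w.1 * denjoyDx q + w.2 * denjoyDy q) =
        w.1 * (denjoyDx p - denjoyDx q) + w.2 * (denjoyDy p - denjoyDy q) by ring]
    refine (norm_add_le _ _).trans ?_
    rw [norm_mul, norm_mul]
    calc _ ≤ ‖w‖ * (C * dist p q ^ (α : ℝ)) + ‖w‖ * (C' * dist p q ^ (α : ℝ)) := by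
          gcongr
          · exact norm_fst_le w
          · exact hC p q
          · exact norm_snd_le w
          · exact hC' p q
      _ = _ := by ring
  rw [edist_dist, edist_dist, ENNReal.ofReal_rpow_of_nonneg dist_nonneg (by positivity)]
  refine (ENNReal.ofReal_le_ofReal h1).trans ?_
  rw [ENNReal.ofReal_mul (by positivity)]
  refine le_of_eq ?_
  congr 1
  rw [ENNReal.ofReal]
  congr 1
  exact Real.toNNReal_of_nonneg _

/-! ### The integral of the square of the derivative -/

/-- The primitive of the square of the derivative of `step`. -/
def sqStep (v : ℝ) : ℝ := ∫ w in (0 : ℝ)..v, deriv step w ^ 2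

lemma hasDerivAt_sqStep (v : ℝ) : HasDerivAt sqStep (deriv step v ^ 2) v := by
  have hc : Continuous fun w => deriv step w ^ 2 := (contDiff_deriv_step (n := 0)).continuous.pow 2
  exact intervalIntegral.integral_hasDerivAt_right (hc.intervalIntegrable _ _)
    (hc.stronglyMeasurableAtFilter _ _) hc.continuousAt

lemma deriv_sqStep : deriv sqStep = fun v => deriv step v ^ 2 :=
  funext fun v => (hasDerivAt_sqStep v).deriv

lemma contDiff_sqStep : ContDiff ℝ 1 sqStep := by
  rw [contDiff_one_iff_deriv, deriv_sqStep]
  exact ⟨fun v => (hasDerivAt_sqStep v).differentiableAt,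
    (contDiff_deriv_step (n := 0)).continuous.pow 2⟩

lemma isStep_sqStep : IsStep (sqStep 1) sqStep := by
  have hs := isStep_step.deriv.sq
  have key {a b : ℝ} (h : ∀ v ∈ uIcc a b, deriv step v ^ 2 = 0) : sqStep a = sqStep b := by
    have h1 := intervalIntegral.integral_eq_sub_of_hasDerivAt
      (fun v _ => hasDerivAt_sqStep v) (a := a) (b := b)
      ((((contDiff_deriv_step (n := 0)).continuous.pow 2).intervalIntegrable _ _))
    rw [intervalIntegral.integral_congr (g := fun _ => 0) h, intervalIntegral.integral_zero] at h1
    linarith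
  constructor
  · intro v hv
    rw [key (b := 0) fun w hw => hs.lo w ?_]
    · simp [sqStep]
    · exact hw.2.trans_lt (max_lt hv (by norm_num))
  · intro v hv
    exact key fun w hw => hs.hi w ((lt_min hv (by norm_num)).trans_le hw.1)

/-- The weights of the primitive of the square of `denjoyDx`. -/
def sqWeight (s : ℝ) : ℝ := gapD 1 s * gapD 1 s * (gap s)⁻¹

/-- The derivative of `sqWeight`. -/
def sqWeightD (s : ℝ) : ℝ := 2 * (gapD 1 s * gapD 2 s * (gap s)⁻¹) -
  gapD 1 s * gapD 1 s * gapD 1 s * ((gap s)⁻¹ * (gap s)⁻¹)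

lemma hasDerivAt_sqWeight (s : ℝ) : HasDerivAt sqWeight (sqWeightD s) s := by
  have h := hasDerivAt_gapD (i := 1) (by norm_num) s
  refine ((h.mul h).mul (hasDerivAt_inv_gap s)).congr_deriv ?_
  simp only [sqWeightD, Pi.mul_apply]
  ring

lemma inv_gap_decay₁' : HasDecay₁ (fun s => (gap s)⁻¹) (-(11 / 10)) :=
  (inv_gap_decay₁ (ε := 1 / 10) (by norm_num) (by norm_num)).mono (by norm_num)

lemma sqWeight_decay₁ : HasDecay₁ sqWeight (29 / 10) :=
  ((gapD_one_decay₁.mul gapD_one_decay₁).mul inv_gap_decay₁').mono (by norm_num)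

lemma sqWeightD_decay₁ : HasDecay₁ sqWeightD (38 / 10) := by
  refine HasDecay₁.sub (HasDecay₁.const_mul 2 ?_) ?_
  · exact ((gapD_one_decay₁.mul gapD_two_decay₁).mul inv_gap_decay₁').mono (by norm_num)
  · exact (((gapD_one_decay₁.mul gapD_one_decay₁).mul gapD_one_decay₁).mul
      (inv_gap_decay₁'.mul inv_gap_decay₁')).mono (by norm_num)

lemma denjoyDx_sq (p : ℝ × ℝ) : denjoyDx p ^ 2 =
    gapSum (fun s => sqWeight s * (gap s)⁻¹) 0 (fun v => deriv step v ^ 2) p := by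
  obtain ⟨n₀, hn₀⟩ := exists_gapTerm_eq_zero isStep_step.deriv p
  have e (n : ℤ) : gapTerm (fun s => sqWeight s * (gap s)⁻¹) 0 (fun v => deriv step v ^ 2) n p =
      gapTerm (fun s => gapD 1 s * (gap s)⁻¹) 0 (deriv step) n p ^ 2 := by
    simp only [gapTerm_zero, stair_zero, sqWeight]; ring
  rw [gapSum, tsum_eq_single n₀ fun n hn => by rw [e, hn₀ _ n hn]; norm_num, e, denjoyDx, gapSum,
    tsum_eq_single n₀ (hn₀ _)]

lemma contDiff_integral_denjoyDx_sq :
    ContDiff ℝ 2 (fun p : ℝ × ℝ => ∫ ξ in (0 : ℝ)..p.1, denjoyDx (ξ, p.2) ^ 2) := by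
  have hd := fun p => hasDerivAt_gapSum hasDerivAt_sqWeight
    (sqWeight_decay₁.hasDecay.mono (by norm_num)) (sqWeightD_decay₁.hasDecay.mono (by norm_num)) isStep_sqStep contDiff_sqStep p
  rw [deriv_sqStep] at hd
  have hs := isStep_step.deriv.sq
  have hcs : ContDiff ℝ 1 fun v => deriv step v ^ 2 := contDiff_deriv_step.pow 2
  have hi := sqWeight_decay₁.mul inv_gap_decay₁'
  have hV : ContDiff ℝ 2 (gapSum sqWeight (sqStep 1) sqStep) := by
    refine contDiff_succ_of_deriv₂ (n := 1) (f₂ := fun p => gapSum sqWeightD (sqStep 1) sqStep p -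
      gapSum (fun s => sqWeight s * (gap s)⁻¹ * edgeD s) 0 (fun v => deriv step v ^ 2) p -
        gapSum (fun s => sqWeight s * (gap s)⁻¹ * gapD 1 s) 0 (fun v => v * deriv step v ^ 2) p)
      (fun x y => (hd (x, y)).1) (fun x y => (hd (x, y)).2) ?_ (ContDiff.sub (ContDiff.sub ?_ ?_) ?_)
    · exact hi.contDiff_gapSum (by norm_num) hs hcs
    · exact sqWeightD_decay₁.contDiff_gapSum (by norm_num) isStep_sqStep contDiff_sqStep
    · exact (hi.mul edgeD_decay₁).contDiff_gapSum (by norm_num) hs hcs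
    · exact (hi.mul gapD_one_decay₁).contDiff_gapSum (by norm_num) hs.id_mul (contDiff_id.mul hcs)
  have e (p : ℝ × ℝ) : ∫ ξ in (0 : ℝ)..p.1, denjoyDx (ξ, p.2) ^ 2 =
      gapSum sqWeight (sqStep 1) sqStep p - gapSum sqWeight (sqStep 1) sqStep (0, p.2) := by
    have hc : Continuous fun p => denjoyDx p ^ 2 := by
      have := (hi.contDiff_gapSum (by norm_num) hs hcs).continuous
      exact this.congr fun p => (denjoyDx_sq p).symm
    refine intervalIntegral.integral_eq_sub_of_hasDerivAt
      (f := fun x => gapSum sqWeight (sqStep 1) sqStep (x, p.2)) (fun x _ => ?_)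
      ((hc.comp (by fun_prop)).intervalIntegrable _ _)
    exact (hd (x, p.2)).1.congr_deriv (denjoyDx_sq (x, p.2)).symm
  simp only [e]
  exact hV.sub (hV.comp (contDiff_const.prodMk contDiff_snd))

/-! ### The trajectories of the minimal set -/

section Cut

variable {fl fl' : ℝ → ℤ}

lemma IsCut.eq_of_forall_ne (h : IsCut fl) (h' : IsCut fl') {z : ℝ} (hz : ∀ k : ℤ, (k : ℝ) ≠ z) :
    fl z = fl' z := by
  have h1 : ⌊z⌋ < ⌈z⌉ := Int.lt_ceil.2 ((Int.floor_le z).lt_of_ne (hz _))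
  have := h.le_floor z
  have := h.le_cut z
  have := h'.le_floor z
  have := h'.le_cut z
  omega

/-- If the cuts agree at the angle of one gap and this angle is an integer, then no other gap sits
at the same angle, and the cuts give the same position. -/
lemma pos_congr (h : IsCut fl) (h' : IsCut fl') {θ y : ℝ} {n j : ℤ}
    (hj : θ - rot * (y + n) = j) (he : fl j = fl' j) : pos fl θ y = pos fl' θ y := by
  have (i : ℤ) : fl (θ - rot * (y + i)) = fl' (θ - rot * (y + i)) := by
    rcases eq_or_ne i n with rfl | hi
    · rw [hj, he]
    · refine h.eq_of_forall_ne h' fun k hk => rot_mul_int_add_ne (sub_ne_zero.2 hi) (k := k - j) ?_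
      push_cast
      rw [hk, ← hj]
      ring
  simp only [pos, this]

/-- The position avoids the gaps, and lies between two consecutive copies of each gap. -/
lemma IsCut.pos_mem (h : IsCut fl) (θ y : ℝ) (n : ℤ) :
    edge (y + n) + gap (y + n) + fl (θ - rot * (y + n)) ≤ pos fl θ y ∧
      pos fl θ y ≤ edge (y + n) + fl (θ - rot * (y + n)) + 1 := by
  set z := θ - rot * (y + n) with hz
  have h0 := (abs_le.1 (h.abs_sub_le z)).2
  have hfl : (fl z : ℝ) ≤ z := (by exact_mod_cast h.le_floor z : (fl z : ℝ) ≤ ⌊z⌋).trans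
    (Int.floor_le z)
  constructor
  · rw [edge_add_gap_eq_pos]
    rcases hfl.lt_or_eq with h1 | h1
    · exact (isCut_floor.pos_lt_pos h (by rw [hz] at h1 ⊢; linarith) y).le
    · have e1 : rot * (y + n) + fl z = θ := by rw [h1, hz]; ring
      rw [e1]
      refine (pos_congr isCut_floor h (n := n) (j := fl z) (by rw [h1]) ?_).le
      rw [Int.floor_intCast, h1]
  · have e2 : edge (y + n) + fl z + 1 = edge (y + n) + ((fl z + 1 : ℤ) : ℝ) := by
      push_cast; ring
    rw [e2, edge_eq_pos]
    rcases (sub_le_iff_le_add'.1 h0).lt_or_eq with h1 | h1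
    · exact (h.pos_lt_pos isCut_lowerCut (by push_cast; rw [hz] at h1 ⊢; linarith) y).le
    · have h2 : ((fl z + 1 : ℤ) : ℝ) = z := by push_cast; exact h1.symm
      have e1 : rot * (y + n) + ((fl z + 1 : ℤ) : ℝ) = θ := by rw [h2, hz]; ring
      rw [e1]
      refine (pos_congr h isCut_lowerCut (n := n) (j := fl z + 1) h2.symm ?_).le
      rw [h2]
      have : ⌈z⌉ = fl z + 1 := by
        have h3 := Int.ceil_intCast (R := ℝ) (fl z + 1)
        rwa [h2] at h3
      rw [lowerCut, this]
      ring

lemma IsCut.not_inGap (h : IsCut fl) (θ y : ℝ) (n k : ℤ) : ¬InGap n k (pos fl θ y, y) := by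
  rintro ⟨h1, h2⟩
  obtain ⟨h3, h4⟩ := h.pos_mem θ y n
  simp only at h1 h2
  have h5 : (fl (θ - rot * (y + n)) : ℝ) < k := by linarith
  have h6 : (k : ℝ) < fl (θ - rot * (y + n)) + 1 := by linarith
  have h7 : fl (θ - rot * (y + n)) < k := by exact_mod_cast h5
  have h8 : k < fl (θ - rot * (y + n)) + 1 := by exact_mod_cast h6
  omega

lemma IsCut.stair_pos (h : IsCut fl) (θ y : ℝ) (n : ℤ) :
    stair 1 step (pos fl θ y) (y + n) = fl (θ - rot * (y + n)) + 1 := by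
  obtain ⟨h3, h4⟩ := h.pos_mem θ y n
  have hg := gap_pos (y + n)
  set j := fl (θ - rot * (y + n))
  rcases h4.lt_or_eq with h5 | h5
  · rw [stair_eq isStep_step (j := j) (by linarith) (by linarith), isStep_step.hi, one_mul]
    rw [lt_div_iff₀ hg]
    linarith
  · have e : pos fl θ y - edge (y + n) = ((j + 1 : ℤ) : ℝ) := by push_cast; linarith
    rw [stair_eq isStep_step (j := j + 1) (by rw [e]; linarith) (by rw [e]; linarith), e,
      isStep_step.lo _ (by rw [sub_self, zero_div]; norm_num)]
    push_cast; ring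

/-- On the complement of the gaps, the field is the velocity of the positions. -/
lemma IsCut.denjoyLift_pos (h : IsCut fl) (θ y : ℝ) : denjoyLift (pos fl θ y, y) =
    rot - ∑' n : ℤ, gapD 1 (y + n) * ((θ - rot * (y + n)) - fl (θ - rot * (y + n))) := by
  have e (n : ℤ) : gapTerm (gapD 1) 1 step n (pos fl θ y, y) = gapD 1 (y + n) * (θ - rot * y + 1) -
      gapD 1 (y + n) * ((θ - rot * (y + n)) - fl (θ - rot * (y + n))) := by
    simp only [gapTerm, h.stair_pos]; ring
  have s1 := (summable_gapD (i := 1) (by norm_num) le_rfl y).mul_right (θ - rot * y + 1)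
  have s2 := (gapD_decay (i := 1) (by norm_num)).summable_shift_mul (by norm_num) y
    (e := fun n : ℤ => (θ - rot * (y + n)) - fl (θ - rot * (y + n))) (B := 1)
    fun n => h.abs_sub_le _
  simp only [denjoyLift, gapSum, e]
  rw [s1.tsum_sub s2, tsum_mul_right, tsum_gapD_one]
  ring

/-- From the right, positions converge to the right end of a possible gap. -/
lemma IsCut.tendsto_pos_right (h : IsCut fl) (θ y : ℝ) :
    Filter.Tendsto (fun θ' => pos fl θ' y) (𝓝[>] θ) (𝓝 (pos Int.floor θ y)) := by
  have hid : Filter.Tendsto (fun θ' : ℝ => θ') (𝓝[>] θ) (𝓝 θ) := nhdsWithin_le_nhds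
  refine hid.sub (tendsto_tsum_of_dominated_convergence (hasSum_gap y).summable (fun n => ?_)
    (Filter.Eventually.of_forall fun θ' n => ?_))
  · refine Filter.Tendsto.const_mul _ ((hid.sub_const _).sub ?_)
    refine Filter.Tendsto.congr' ?_ tendsto_const_nhds
    have hlt : θ < rot * (y + n) + ⌊θ - rot * (y + n)⌋ + 1 := by
      linarith [Int.lt_floor_add_one (θ - rot * (y + n))]
    filter_upwards [Ioo_mem_nhdsGT hlt] with θ' hθ'
    have h1 := isCut_floor.le_of_lt h (sub_lt_sub_right hθ'.1 (rot * (y + n)))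
    have h2 := h.le_floor (θ' - rot * (y + n))
    have h3 : ⌊θ' - rot * (y + n)⌋ < ⌊θ - rot * (y + n)⌋ + 1 :=
      Int.floor_lt.2 (by push_cast; linarith [hθ'.2])
    have : ⌊θ - rot * (y + n)⌋ = fl (θ' - rot * (y + n)) := by omega
    rw [this]
  · rw [norm_mul, Real.norm_of_nonneg (gap_pos _).le]
    exact mul_le_of_le_one_right (gap_pos _).le (h.abs_sub_le _)

/-- From the left, positions converge to the left end of a possible gap. -/
lemma IsCut.tendsto_pos_left (h : IsCut fl) (θ y : ℝ) :
    Filter.Tendsto (fun θ' => pos fl θ' y) (𝓝[<] θ) (𝓝 (pos lowerCut θ y)) := by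
  have hid : Filter.Tendsto (fun θ' : ℝ => θ') (𝓝[<] θ) (𝓝 θ) := nhdsWithin_le_nhds
  refine hid.sub (tendsto_tsum_of_dominated_convergence (hasSum_gap y).summable (fun n => ?_)
    (Filter.Eventually.of_forall fun θ' n => ?_))
  · refine Filter.Tendsto.const_mul _ ((hid.sub_const _).sub ?_)
    refine Filter.Tendsto.congr' ?_ tendsto_const_nhds
    have hlt : rot * (y + n) + lowerCut (θ - rot * (y + n)) < θ := by
      have := Int.ceil_lt_add_one (θ - rot * (y + n))
      rw [lowerCut]
      push_cast
      linarith
    filter_upwards [Ioo_mem_nhdsLT hlt] with θ' hθ'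
    have h1 := h.le_of_lt isCut_lowerCut (sub_lt_sub_right hθ'.2 (rot * (y + n)))
    have h2 := h.le_cut (θ' - rot * (y + n))
    have h3 : lowerCut (θ - rot * (y + n)) < ⌈θ' - rot * (y + n)⌉ :=
      Int.lt_ceil.2 (by linarith [hθ'.1])
    have : lowerCut (θ - rot * (y + n)) = fl (θ' - rot * (y + n)) := by omega
    rw [this]
  · rw [norm_mul, Real.norm_of_nonneg (gap_pos _).le]
    exact mul_le_of_le_one_right (gap_pos _).le (h.abs_sub_le _)

end Cut

/-- The points outside all gaps are exactly the positions. -/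
lemma exists_eq_pos {p : ℝ × ℝ} (hp : ∀ n k, ¬InGap n k p) :
    ∃ fl θ, IsCut fl ∧ (fl = Int.floor ∨ fl = lowerCut) ∧ p = (pos fl θ p.2, p.2) := by
  obtain ⟨x, y⟩ := p
  set S := {t | pos Int.floor t y ≤ x}
  have hne : S.Nonempty := ⟨x - 1, by
    have := (abs_le.1 (isCut_floor.abs_pos_sub_le (x - 1) y)).2
    show pos Int.floor (x - 1) y ≤ x
    linarith⟩
  have hbd : BddAbove S := ⟨x + 1, fun t (ht : pos Int.floor t y ≤ x) => by
    have := (abs_le.1 (isCut_floor.abs_pos_sub_le t y)).1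
    linarith⟩
  set θ := sSup S
  have h1 : pos lowerCut θ y ≤ x := by
    refine le_of_tendsto (isCut_floor.tendsto_pos_left θ y) ?_
    filter_upwards [self_mem_nhdsWithin] with θ' hθ'
    obtain ⟨t, ht, hlt⟩ := exists_lt_of_lt_csSup hne hθ'
    exact (isCut_floor.pos_lt_pos isCut_floor hlt y).le.trans ht
  have h2 : x ≤ pos Int.floor θ y := by
    refine ge_of_tendsto (isCut_floor.tendsto_pos_right θ y) ?_
    filter_upwards [self_mem_nhdsWithin] with θ' hθ'
    by_contra! hcon
    exact absurd (le_csSup hbd (show θ' ∈ S from hcon.le)) (not_le.2 hθ')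
  rcases h1.eq_or_lt with h1 | h1
  · exact ⟨lowerCut, θ, isCut_lowerCut, Or.inr rfl, by rw [h1]⟩
  rcases h2.eq_or_lt with h2 | h2
  · exact ⟨Int.floor, θ, isCut_floor, Or.inl rfl, by rw [h2]⟩
  exfalso
  by_cases hex : ∃ n k : ℤ, θ = rot * (y + n) + k
  · obtain ⟨n, k, e⟩ := hex
    rw [e] at h1 h2
    rw [← edge_eq_pos] at h1
    rw [← edge_add_gap_eq_pos] at h2
    exact hp n k ⟨h1, h2⟩
  · push Not at hex
    have (n : ℤ) : lowerCut (θ - rot * (y + n)) = ⌊θ - rot * (y + n)⌋ :=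
      isCut_lowerCut.eq_of_forall_ne isCut_floor fun k hk => hex n k (by rw [hk]; ring)
    have e : pos lowerCut θ y = pos Int.floor θ y := by simp only [pos, this]
    linarith

/-! ### The Denjoy continuum -/

/-- The horizontal component of the Denjoy vector field, on the torus. -/
def denjoyField : Torus → ℝ := isBiperiodic_denjoyLift.exists_descent.choose

lemma torusLift_denjoyField : torusLift denjoyField = denjoyLift :=
  funext isBiperiodic_denjoyLift.exists_descent.choose_spec

/-- The complement of the gaps. -/
def denjoySet : Set Torus := (toTorus '' {p | ∃ n k, InGap n k p})ᶜ

lemma toTorus_mem_denjoySet {p : ℝ × ℝ} : toTorus p ∈ denjoySet ↔ ∀ n k, ¬InGap n k p := by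
  constructor
  · intro h n k hp
    exact h ⟨p, ⟨n, k, hp⟩, rfl⟩
  · rintro h ⟨q, ⟨n, k, h1, h2⟩, hq⟩
    obtain ⟨a, b, rfl⟩ := toTorus_eq_iff.1 hq
    have e : q.2 + b + ((n - b : ℤ) : ℝ) = q.2 + n := by push_cast; ring
    refine h (n - b) (k + a) ⟨?_, ?_⟩
    · simp only [e]; push_cast; linarith
    · simp only [e]; push_cast; linarith

lemma isClosed_denjoySet : IsClosed denjoySet := by
  refine (isOpenMap_toTorus _ ?_).isClosed_compl
  have e : {p | ∃ n k, InGap n k p} = ⋃ (n : ℤ) (k : ℤ), {p | InGap n k p} := by ext; simp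
  rw [e]
  refine isOpen_iUnion fun n => isOpen_iUnion fun k => ?_
  have h1 : Continuous fun p : ℝ × ℝ => edge (p.2 + n) :=
    continuous_edge.comp (continuous_snd.add continuous_const)
  have h2 : Continuous fun p : ℝ × ℝ => gap (p.2 + n) :=
    (continuous_gapD (by norm_num)).comp (continuous_snd.add continuous_const)
  exact (isOpen_lt (h1.add continuous_const) continuous_fst).inter
    (isOpen_lt continuous_fst ((h1.add h2).add continuous_const))

/-- The trajectory of the positions which start at height `y`. -/
lemma IsCut.isTrajectory {fl : ℝ → ℤ} (h : IsCut fl) (θ y : ℝ) :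
    IsTrajectory denjoyField fun s => (pos fl (θ + rot * s) (y + s), y + s) := by
  refine isTrajectory_of_hasDerivAt fun s => ?_
  have h1 := HasDerivAt.comp_const_add y s (h.hasDerivAt_pos (θ - rot * y) (y + s))
  have e (s : ℝ) : θ - rot * y + rot * (y + s) = θ + rot * s := by ring
  simp only [e] at h1
  refine h1.congr_deriv ?_
  rw [torusLift_denjoyField, h.denjoyLift_pos]
  congr 1
  refine tsum_congr fun n => ?_
  rw [show θ + rot * s - rot * (y + s + n) = θ - rot * y - rot * n by ring]

lemma contDiff_denjoyField : ContDiff ℝ 1 (torusLift denjoyField) := by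
  rw [torusLift_denjoyField]; exact contDiff_denjoyLift

lemma exists_trajectory_eq {c : ℝ → ℝ × ℝ} (hc : IsTrajectory denjoyField c)
    (h0 : toTorus (c 0) ∈ denjoySet) : ∃ fl θ, IsCut fl ∧
      c = fun s => (pos fl (θ + rot * s) ((c 0).2 + s), (c 0).2 + s) := by
  obtain ⟨fl, θ, hfl, -, e⟩ := exists_eq_pos (toTorus_mem_denjoySet.1 h0)
  refine ⟨fl, θ, hfl, hc.unique contDiff_denjoyField (hfl.isTrajectory θ _) (s := 0) ?_⟩
  simpa using e

lemma isFlowInvariant_denjoySet : IsFlowInvariant denjoyField denjoySet := fun c hc h0 s => by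
  obtain ⟨fl, θ, hfl, e⟩ := exists_trajectory_eq hc h0
  rw [e]
  exact toTorus_mem_denjoySet.2 (hfl.not_inGap _ _)

/-- All trajectories have the rotation number `rot`, because they cannot cross those of the
positions. -/
lemma abs_trajectory_sub_le {c : ℝ → ℝ × ℝ} (hc : IsTrajectory denjoyField c) (s : ℝ) :
    |(c s).1 - (c 0).1 - rot * s| ≤ 3 := by
  have key (θ : ℝ) := isCut_floor.isTrajectory θ (c 0).2
  have hb (θ s : ℝ) := abs_le.1 (isCut_floor.abs_pos_sub_le (θ + rot * s) ((c 0).2 + s))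
  have h1 := (key ((c 0).1 - 2)).lt_of_lt contDiff_denjoyField hc (by simp) (s₀ := 0)
    (by linarith [(hb ((c 0).1 - 2) 0).2]) s
  have h2 := hc.lt_of_lt contDiff_denjoyField (key ((c 0).1 + 2)) (by simp) (s₀ := 0)
    (by linarith [(hb ((c 0).1 + 2) 0).1]) s
  have h3 := (hb ((c 0).1 - 2) s).1
  have h4 := (hb ((c 0).1 + 2) s).2
  simp only at h1 h2
  rw [abs_le]
  constructor <;> linarith

lemma isAperiodic_denjoyField : IsAperiodic denjoyField := fun c hc s hs heq => by
  obtain ⟨k, m, e⟩ := toTorus_eq_iff.1 heq.symm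
  have hm : s = m := by
    have h1 := hc.snd_eq s
    rw [e] at h1
    simpa using h1.symm
  have hper : (fun t => c (t + s)) = fun t => ((c t).1 + k, (c t).2 + m) :=
    (hc.shift s).unique contDiff_denjoyField (hc.translate k m) (s := 0) (by simpa using e)
  have hiter (j : ℕ) : (c (j * s)).1 = (c 0).1 + j * k := by
    induction j with
    | zero => simp
    | succ j ih =>
      have := congrArg Prod.fst (congrFun hper (j * s))
      simp only at this
      rw [show ((j + 1 : ℕ) : ℝ) * s = j * s + s by push_cast; ring, this, ih]
      push_cast; ring
  have hne : |(k : ℝ) - rot * m| > 0 := by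
    refine abs_pos.2 fun h => ?_
    have hm0 : m ≠ 0 := by rintro rfl; simp at hm; exact hs.ne' hm
    exact rot_mul_int_add_ne hm0 (k := -k) (by push_cast; linarith)
  obtain ⟨j, hj⟩ := exists_nat_gt (3 / |(k : ℝ) - rot * m|)
  rw [div_lt_iff₀ hne] at hj
  have h1 := abs_trajectory_sub_le hc (j * s)
  rw [hiter, hm, show (c 0).1 + j * k - (c 0).1 - rot * (j * m) = j * (k - rot * m) by ring,
    abs_mul, Nat.abs_cast] at h1
  linarith

lemma dense_orbit (θ : ℝ) {a b : ℝ} (hab : a < b) :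
    ∃ n k : ℤ, θ + rot * n + k ∈ Ioo a b := by
  have hd : Dense (AddSubgroup.closure {1, rot} : Set ℝ) :=
    dense_addSubgroupClosure_pair_iff.2 (by simpa using irrational_rot)
  obtain ⟨z, hz, h1, h2⟩ := hd.exists_between (sub_lt_sub_right hab θ)
  obtain ⟨k, n, rfl⟩ := AddSubgroup.mem_closure_pair.1 hz
  simp only [zsmul_eq_mul, mul_one] at h1 h2
  exact ⟨n, k, by linarith, by linarith⟩

lemma isMinimalSet_denjoySet : IsMinimalSet denjoyField denjoySet where
  isClosed := isClosed_denjoySet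
  nonempty := ⟨toTorus (pos Int.floor 0 0, 0),
    toTorus_mem_denjoySet.2 (isCut_floor.not_inGap 0 0)⟩
  invariant := isFlowInvariant_denjoySet
  minimal E hED hE hne hinv := by
    refine hED.antisymm fun q hq => ?_
    obtain ⟨e, he⟩ := hne
    obtain ⟨p, rfl⟩ := toTorus_surjective e
    obtain ⟨fl, θ, hfl, -, e⟩ := exists_eq_pos (toTorus_mem_denjoySet.1 (hED he))
    have horb (s : ℝ) : toTorus (pos fl (θ + rot * s) (p.2 + s), p.2 + s) ∈ E :=
      hinv _ (hfl.isTrajectory θ p.2) (by simpa [← e] using he) s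
    obtain ⟨⟨x, y⟩, rfl⟩ := toTorus_surjective q
    have hmem (n k : ℤ) :
        pos fl (θ + rot * (y - p.2) + rot * n + k) y ∈ {x | toTorus (x, y) ∈ E} := by
      have h1 := horb (y - p.2 + n)
      rw [show p.2 + (y - p.2 + n) = y + n by ring, pos_add_int_right] at h1
      have h2 : toTorus (pos fl (θ + rot * (y - p.2 + n)) y, y + n) =
          toTorus (pos fl (θ + rot * (y - p.2) + rot * n + k) y, y) := by
        refine toTorus_eq_iff.2 ⟨k, -n, ?_⟩
        rw [hfl.pos_add_int, show θ + rot * (y - p.2 + n) = θ + rot * (y - p.2) + rot * n by ring]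
        push_cast
        rw [add_neg_cancel_right]
      rw [mem_ofPred_eq, ← h2]
      exact h1
    have hcl : IsClosed {x | toTorus (x, y) ∈ E} :=
      hE.preimage (continuous_toTorus.comp (by fun_prop))
    obtain ⟨fl', θ', -, hfl', e'⟩ := exists_eq_pos (toTorus_mem_denjoySet.1 hq)
    -- the angles of the orbit are dense, so that `x` is a one-sided limit of points of `E`
    rw [e']
    by_contra hcon
    have hcon' := hcl.isOpen_compl.mem_nhds hcon
    rcases hfl' with rfl | rfl
    · obtain ⟨b, hb, h⟩ := (mem_nhdsGT_iff_exists_Ioo_subset).1 (hfl.tendsto_pos_right θ' y hcon')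
      obtain ⟨n, k, hnk⟩ := dense_orbit (θ + rot * (y - p.2)) hb
      exact h hnk (hmem n k)
    · obtain ⟨b, hb, h⟩ := (mem_nhdsLT_iff_exists_Ioo_subset).1 (hfl.tendsto_pos_left θ' y hcon')
      obtain ⟨n, k, hnk⟩ := dense_orbit (θ + rot * (y - p.2)) hb
      exact h hnk (hmem n k)

lemma denjoySet_ne_univ : denjoySet ≠ univ := fun h => by
  have h1 : toTorus (edge 0 + gap 0 / 2, 0) ∈ denjoySet := h ▸ mem_univ _
  have h2 := gap_pos 0
  refine toTorus_mem_denjoySet.1 h1 0 0 ⟨?_, ?_⟩ <;> simp <;> linarith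

lemma torusDx_denjoyField : torusDx denjoyField = denjoyDx := funext fun p => by
  rw [torusDx, torusLift_denjoyField]
  exact (hasDerivAt_denjoyLift p).1.deriv

lemma isSmoothDenjoyField_denjoyField : IsSmoothDenjoyField denjoyField denjoySet where
  isDenjoyField :=
    { contDiff := contDiff_denjoyField
      aperiodic := isAperiodic_denjoyField
      isMinimalSet := isMinimalSet_denjoySet
      ne_univ := denjoySet_ne_univ }
  holder α hα hα1 := by
    rw [torusLift_denjoyField]
    exact holderWith_fderiv_denjoyLift hα hα1
  dx_eq_zero p hp := by
    rw [torusDx_denjoyField]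
    refine (tsum_congr fun n => ?_).trans tsum_zero
    rw [gapTerm_zero]
    by_contra hne
    exact toTorus_mem_denjoySet.1 hp n _
      (inGap_of_stair_ne_zero isStep_step.deriv (right_ne_zero_of_mul hne))
  contDiff_integral := by
    rw [torusDx_denjoyField]
    exact contDiff_integral_denjoyDx_sq

end

theorem proposition4 :
    (∃ (h : Torus → ℝ) (D : Set Torus), IsSmoothDenjoyField h D) ∧
    ∀ (h : Torus → ℝ) (D : Set Torus), IsSmoothDenjoyField h D →
      ∀ (p₀ : Torus) (V₀ : Set Torus), V₀ ∈ 𝓝 p₀ → Disjoint (closure V₀) D →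
      ∀ δ : ℝ, 0 < δ → δ < 1 →
      ∀ ε : ℝ, 0 < ε →
        ∃ (K : ThickTorus → UnitAddCircle) (k : ℝ × ℝ × ℝ → ℝ), IsC2Lift K k ∧
          (∀ x y : ℝ, toTorus (x, y) ∈ D →
            hamiltonianField k 0 x y = (0, torusLift h (x, y), 1)) ∧
          (∀ (t : Icc (-1 : ℝ) 1) (x y : ℝ), ¬((t : ℝ) = 0 ∧ toTorus (x, y) ∈ D) →
            0 < (hamiltonianField k t x y).1) ∧
          (∀ q : ThickTorus, ‖K q - K₀ q‖ < ε) ∧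
          (∀ q ∈ collarTube δ V₀, K q = K₀ q) :=
  ⟨⟨denjoyField, denjoySet, isSmoothDenjoyField_denjoyField⟩,
    fun _ _ H _ _ _ hV _ _ hδ1 _ hε => exists_hamiltonian H hV hδ1 hε⟩
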